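/- **Setting.** A *DurEC object* $X$ is a durable, detectable LL/SC object with external context; here its state is a triple $(\mathrm{val},\mathrm{bit},\mathrm{seq})$. It is accessed through DurEC handles $g$. $X.\mathrm{ECLL}(g)$ returns the state. $X.\mathrm{ECSC}(g,s,(v,b))$ fails (returns false, changing nothing) if $X.\mathrm{seq}\ne s$; otherwise it sets $(\mathrm{val},\mathrm{bit})$ to $(v,b)$, increases $\mathrm{seq}$, and returns true. Each of these operations takes effect at one instant. If its process crashes, it takes effect at one instant before the completion of $X.\mathrm{recover}(g)$, or never. $\mathrm{detect}(g)$ returns a number that strictly increases with each successful ECSC through $g$ and does not change otherwise. Every DurEC operation takes $O(1)$ steps; every DurEC object and DurEC handle occupies $O(1)$ space. A *DuraCAS handle* $h$ consists of two DurEC handles $h.\mathrm{Critical}$, $h.\mathrm{Casual}$ and a field $h.\mathrm{op}\in\{\mathrm{CAS},\mathrm{Write}\}$, all in non-volatile memory. Each process acquires one handle, at a time of its choice, by CreateHandle, and uses it for all objects. A *DuraCAS object* with initial value $v_0$ consists of two DurEC objects $W,Z$, with $Z.\mathrm{val}=v_0$ and $W.\mathrm{bit}=Z.\mathrm{bit}=0$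 initially. Its methods are as follows. - transfer-write$(h)$: $z\leftarrow Z.\mathrm{ECLL}(h.\mathrm{Casual})$; $w\leftarrow W.\mathrm{ECLL}(h.\mathrm{Casual})$; if $z.\mathrm{bit}\neq w.\mathrm{bit}$, execute $Z.\mathrm{ECSC}(h.\mathrm{Casual},z.\mathrm{seq},(w.\mathrm{val},w.\mathrm{bit}))$. (This is a subroutine.) - read$(h)$: $z\leftarrow Z.\mathrm{ECLL}(h.\mathrm{Casual})$; return $z.\mathrm{val}$. - CAS$(h,old,new)$: $h.\mathrm{op}\leftarrow\mathrm{CAS}$; then twice: $z\leftarrow Z.\mathrm{ECLL}(h.\mathrm{Critical})$; if $z.\mathrm{val}\ne old$ return false; if $old=new$ return true; transfer-write$(h)$; if $Z.\mathrm{ECSC}(h.\mathrm{Critical},z.\mathrm{seq},(new,z.\mathrm{bit}))$ return true. After the second iteration, return false. - write$(h,v)$: $h.\mathrm{op}\leftarrow\mathrm{Write}$; $w\leftarrow W.\mathrm{ECLL}(h.\mathrm{Critical})$; $z\leftarrow Z.\mathrm{ECLL}(h.\mathrm{Casual})$; if $z.\mathrm{val}=v$ return ack; if $z.\mathrm{bit}=w.\mathrm{bit}$,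 execute $W.\mathrm{ECSC}(h.\mathrm{Critical},w.\mathrm{seq},(v,1-w.\mathrm{bit}))$; transfer-write$(h)$ twice; return ack. - recover$(h)$: $W.\mathrm{recover}(h.\mathrm{Casual})$; $Z.\mathrm{recover}(h.\mathrm{Casual})$; if $h.\mathrm{op}=\mathrm{CAS}$, $Z.\mathrm{recover}(h.\mathrm{Critical})$; otherwise $W.\mathrm{recover}(h.\mathrm{Critical})$ and then transfer-write$(h)$ twice. - detect$(h)$: $d\leftarrow\mathrm{detect}(h.\mathrm{Critical})$; return $(d,\mathrm{true})$ if $h.\mathrm{op}=\mathrm{CAS}$ and $(d,\mathrm{ack})$ otherwise. Any number of processes access any number of DuraCAS objects asynchronously. A process may crash at any time, losing its program counter and local variables but not the non-volatile memory. If it crashed inside a read, write, CAS or recover on an object $O$, its next method is $O.\mathrm{recover}$, which may crash and be repeated. An operation (read, write or CAS) *completes* when it returns or, if it crashed, when the recover that follows returns. **Theorem.** In every finite run: 1. *(Durable linearizability and detectability.)* For each DuraCAS object $O$ there is a sequence $S$ of operations invoked on $O$, each with a response, that is a legal sequential execution of a readable and writable CAS object from $O$'s initial value. It contains every operation on $O$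 that returned, with the response it returned, and respects the order of operations one of which completed before the other was invoked. (Crashed or incomplete operations may or may not occur in $S$.) Moreover, suppose that a process executed detect before and after the completion of an operation $\alpha$ of its own on $O$, with no other read, write or CAS of that process between the two executions, and that these returned $(d_1,r_1)$ and $(d_2,r_2)$. Then $d_1\le d_2$. If $d_1<d_2$, then $\alpha$ occurs in $S$ with response $r_2$. If $d_1=d_2$, then $\alpha$ is safe to repeat: if any set of operations of this kind (with $d_1=d_2$) is deleted from $S$, the rest is still a legal sequential execution. 2. *(Wait-freedom and constant time.)* Every execution of read, write, CAS, recover or detect finishes within $O(1)$ steps of its own process, whatever the other processes do, unless its process crashes; it is never blocked. 3. *(Space.)* The space used is $O(m+n)$ if $m$ DuraCAS objects have been created and $n$ processes have acquired handles. The constants in 2 and 3 depend only on the constants for DurEC objects. -/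

import Mathlib

namespace DuraCAS

universe u v w

/-! ### The implemented type: a readable, writable compare-and-swap object -/

/-- Operations of a writable CAS object with values in `V`. -/
inductive Op (V : Type u) : Type u
  | read
  | write (v : V)
  | cas (old new : V)

/-- Responses of a writable CAS object. -/
inductive Resp (V : Type u) : Type u
  | val (v : V)
  | ack
  | bool (b : Bool)

/-- Sequential specification: the new value and the response of an operation applied to the
value `s`. -/
def Op.apply {V : Type u} [DecidableEq V] : Op V → V → V × Resp V
  | .read, s => (s, .val s)
  | .write v, _ => (v, .ack)
  | .cas old new, s => if s = old then (new, .bool true) else (s, .bool false)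

/-! ### The base objects: DurEC objects

A DurEC object is a durable, detectable, external-context LL/SC object.  Its state consists of a
value (here a pair of a value and a bit) and a sequence number. -/

/-- State of a DurEC object, which is also what `ECLL` returns. -/
structure ECState (V : Type u) : Type u where
  val : V
  bit : Bool
  seq : ℕ

/-- The two DurEC objects inside a DuraCAS object. -/
inductive Cell : Type
  | W
  | Z
  deriving DecidableEq

/-- The two DurEC handles inside a DuraCAS handle. -/
inductive Role : Type
  | critical
  | casual
  deriving DecidableEq

/-- The contents of the field `op` of a DuraCAS handle. -/
inductive Tag : Type
  | cas
  | write
  deriving DecidableEq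

/-- An operation that has been invoked on a DurEC object `x` through some DurEC handle and is
neither finished nor, if its process crashed, closed by `x.recover`.  The field `res` is `none`
until the operation takes effect; then it is the response. -/
inductive Pending (V : Type u) (Obj : Type v) : Type (max u v)
  | ll (x : Obj × Cell) (res : Option (ECState V))
  | sc (x : Obj × Cell) (s : ℕ) (v : V) (b : Bool) (res : Option Bool)

/-- The DurEC object on which a pending operation was invoked. -/
def Pending.target {V : Type u} {Obj : Type v} : Pending V Obj → Obj × Cell
  | .ll x _ => x
  | .sc x _ _ _ _ => x

/-- State of a DurEC handle: its detection value, and the operation pending through it. -/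
structure ECHandle (V : Type u) (Obj : Type v) : Type (max u v) where
  det : ℕ
  pend : Option (Pending V Obj)

/-- A DuraCAS handle (in non-volatile memory): two DurEC handles and the field `op`. -/
structure Handle (V : Type u) (Obj : Type v) : Type (max u v) where
  ec : Role → ECHandle V Obj
  op : Tag

/-! ### The algorithm -/

/-- What a DuraCAS method returns: the response of a read, write or CAS; the completion of
`recover`; the pair returned by `detect`. -/
inductive Out (V : Type u) : Type u
  | resp (r : Resp V)
  | recovered
  | detected (d : ℕ) (r : Resp V)

/-- Code of a method: calls to DurEC objects through a DurEC handle of the caller, and accesses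
to the field `op` of the caller's handle, each followed by the rest of the code. -/
inductive Prog (V : Type u) (Obj : Type v) : Type (max u v)
  | done (r : Out V)
  | ecll (x : Obj × Cell) (g : Role) (k : ECState V → Prog V Obj)
  | ecsc (x : Obj × Cell) (g : Role) (s : ℕ) (v : V) (b : Bool) (k : Bool → Prog V Obj)
  | ecrecover (x : Obj × Cell) (g : Role) (k : Prog V Obj)
  | ecdetect (g : Role) (k : ℕ → Prog V Obj)
  | setOp (t : Tag) (k : Prog V Obj)
  | getOp (k : Tag → Prog V Obj)

section Code

variable {V : Type u} {Obj : Type v}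

/-- `transfer-write`, followed by `k`: read `Z`, read `W` and, if their bits differ, try to move
the value and the bit of `W` to `Z`. -/
def transferWrite (o : Obj) (k : Prog V Obj) : Prog V Obj :=
  .ecll (o, .Z) .casual fun z =>
  .ecll (o, .W) .casual fun w =>
  if z.bit ≠ w.bit then .ecsc (o, .Z) .casual z.seq w.val w.bit fun _ => k else k

/-- `read`. -/
def readCode (o : Obj) : Prog V Obj :=
  .ecll (o, .Z) .casual fun z => .done (.resp (.val z.val))

/-- The for-loop of `CAS`, with the number of iterations that remain. -/
def casLoop [DecidableEq V] (o : Obj) (old new : V) : ℕ → Prog V Obj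
  | 0 => .done (.resp (.bool false))
  | n + 1 =>
    .ecll (o, .Z) .critical fun z =>
    if z.val ≠ old then .done (.resp (.bool false))
    else if old = new then .done (.resp (.bool true))
    else transferWrite o <|
      .ecsc (o, .Z) .critical z.seq new z.bit fun success =>
      if success then .done (.resp (.bool true)) else casLoop o old new n

/-- `CAS`: the loop is executed at most twice. -/
def casCode [DecidableEq V] (o : Obj) (old new : V) : Prog V Obj :=
  .setOp .cas (casLoop o old new 2)

/-- `write`. -/
def writeCode [DecidableEq V] (o : Obj) (v : V) : Prog V Obj :=
  .setOp .write <|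
  .ecll (o, .W) .critical fun w =>
  .ecll (o, .Z) .casual fun z =>
  if z.val = v then .done (.resp .ack)
  else
    let rest := transferWrite o (transferWrite o (.done (.resp .ack)))
    if z.bit = w.bit then .ecsc (o, .W) .critical w.seq v (!w.bit) fun _ => rest else rest

/-- `recover`. -/
def recoverCode (o : Obj) : Prog V Obj :=
  .ecrecover (o, .W) .casual <|
  .ecrecover (o, .Z) .casual <|
  .getOp fun t =>
  match t with
  | .cas => .ecrecover (o, .Z) .critical (.done .recovered)
  | .write =>
    .ecrecover (o, .W) .critical <|
    transferWrite o (transferWrite o (.done .recovered))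

/-- `detect`. -/
def detectCode : Prog V Obj :=
  .ecdetect .critical fun d =>
  .getOp fun t =>
  match t with
  | .cas => .done (.detected d (.bool true))
  | .write => .done (.detected d .ack)

/-- The code of the implemented operations. -/
def Op.code [DecidableEq V] (o : Obj) : Op V → Prog V Obj
  | .read => readCode o
  | .write v => writeCode o v
  | .cas old new => casCode o old new

end Code

/-! ### Configurations and steps -/

/-- Control state of a process (volatile).  In `running t k call` a method is being executed, `k`
is the code that remains, and `call = some f` if the process is inside the DurEC operation at the
head of `k` and can spend `f` more steps on internal work there.  The field `t` is the DuraCAS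
object on which the method is executed (`none` for `detect`, which concerns a handle only).  In
`crashed o` the process crashed inside a method on `o` and has not restarted `o.recover` yet. -/
inductive Ctl (V : Type u) (Obj : Type v) : Type (max u v)
  | idle
  | crashed (o : Obj)
  | running (t : Option Obj) (k : Prog V Obj) (call : Option ℕ)

/-- The control state after a crash: the program counter and all local variables are lost. -/
def Ctl.crash {V : Type u} {Obj : Type v} : Ctl V Obj → Ctl V Obj
  | .running (some o) _ _ => .crashed o
  | .running none _ _ => .idle
  | .idle => .idle
  | .crashed o => .crashed o

/-- Configurations: the DurEC objects, the handle of each process, and the control states.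
`none` means that the object, or the handle, has not been created. -/
structure Config (V : Type u) (Obj : Type v) (P : Type w) : Type (max u v w) where
  ec : Obj × Cell → Option (ECState V)
  hnd : P → Option (Handle V Obj)
  ctl : P → Ctl V Obj

/-- The initial configuration: no objects and no handles. -/
def Config.init (V : Type u) (Obj : Type v) (P : Type w) : Config V Obj P where
  ec _ := none
  hnd _ := none
  ctl _ := .idle

/-- Labels of steps: the visible events, and `tau p`, a step of `p` inside a method. -/
inductive Label (V : Type u) (Obj : Type v) (P : Type w) : Type (max u v w)
  | newObj (o : Obj) (v : V)
  | newHandle (p : P)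
  | inv (p : P) (o : Obj) (op : Op V)
  | ret (p : P) (r : Resp V)
  | recInv (p : P) (o : Obj)
  | recRet (p : P)
  | detInv (p : P)
  | detRet (p : P) (d : ℕ) (r : Resp V)
  | crash (p : P)
  | tau (p : P)

section Semantics

variable {V : Type u} {Obj : Type v} {P : Type w}

/-- The event by which a method returns. -/
def Out.label (p : P) : Out V → Label V Obj P
  | .resp r => .ret p r
  | .recovered => .recRet p
  | .detected d r => .detRet p d r

variable [DecidableEq V] [DecidableEq Obj] [DecidableEq P]

/-- Change the control state of `p`. -/
def Config.setCtl (c : Config V Obj P) (p : P) (a : Ctl V Obj) : Config V Obj P :=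
  { c with ctl := Function.update c.ctl p a }

/-- Change the handle of `p`. -/
def Config.setHnd (c : Config V Obj P) (p : P) (h : Handle V Obj) : Config V Obj P :=
  { c with hnd := Function.update c.hnd p (some h) }

/-- Change the state of a DurEC object. -/
def Config.setEC (c : Config V Obj P) (x : Obj × Cell) (s : ECState V) : Config V Obj P :=
  { c with ec := Function.update c.ec x (some s) }

/-- Change the DurEC handle `g` inside a DuraCAS handle. -/
def Handle.setEC (h : Handle V Obj) (g : Role) (a : ECHandle V Obj) : Handle V Obj :=
  { h with ec := Function.update h.ec g a }

/-- Change the operation pending through the DurEC handle `g`. -/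
def Handle.setPend (h : Handle V Obj) (g : Role) (a : Option (Pending V Obj)) : Handle V Obj :=
  h.setEC g { h.ec g with pend := a }

/-- The steps of the system.  Each process accesses DuraCAS objects through its own handle.

An operation on a DurEC object is invoked, takes effect at one instant and then returns.  If the
process crashes in between, an operation that has not taken effect yet can still do so at any
moment until the recovery method of that DurEC object returns for that handle; if it has not taken
effect by then, it never does.  No operation may be invoked, and no detection be started, through
a DurEC handle with a pending operation.  A successful `ECSC` raises the sequence number of the
object and the detection value of the handle, by arbitrary amounts; nothing else changes them.
Inside each DurEC operation the process can spend at most `T` steps on internal work. -/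
inductive Step (T : ℕ) : Config V Obj P → Label V Obj P → Config V Obj P → Prop
  /-- Creation of a DuraCAS object with initial value `v`: both bits are initially 0, and `Z`
  holds `v`; the initial value of `W` is irrelevant. -/
  | newObj (c : Config V Obj P) (o : Obj) (v w₀ : V) (sW sZ : ℕ)
      (fresh : ∀ x, c.ec (o, x) = none) :
      Step T c (.newObj o v)
        ((c.setEC (o, .W) ⟨w₀, false, sW⟩).setEC (o, .Z) ⟨v, false, sZ⟩)
  /-- A process acquires a handle. -/
  | newHandle (c : Config V Obj P) (p : P) (det : Role → ℕ) (t : Tag)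
      (fresh : c.hnd p = none) :
      Step T c (.newHandle p) (c.setHnd p ⟨fun g => ⟨det g, none⟩, t⟩)
  /-- Invocation of a read, write or CAS. -/
  | inv (c : Config V Obj P) (p : P) (o : Obj) (op : Op V)
      (idle : c.ctl p = .idle) (hh : c.hnd p ≠ none) (ho : ∀ x, c.ec (o, x) ≠ none) :
      Step T c (.inv p o op) (c.setCtl p (.running (some o) (op.code o) none))
  /-- After a crash inside a method on `o`, the process must execute `o.recover` first; an idle
  process may execute it as well. -/
  | recInv (c : Config V Obj P) (p : P) (o : Obj)
      (ready : c.ctl p = .crashed o ∨ c.ctl p = .idle)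
      (hh : c.hnd p ≠ none) (ho : ∀ x, c.ec (o, x) ≠ none) :
      Step T c (.recInv p o) (c.setCtl p (.running (some o) (recoverCode o) none))
  /-- Invocation of `detect`. -/
  | detInv (c : Config V Obj P) (p : P)
      (idle : c.ctl p = .idle) (hh : c.hnd p ≠ none) :
      Step T c (.detInv p) (c.setCtl p (.running none detectCode none))
  /-- A method returns. -/
  | finish (c : Config V Obj P) (p : P) (t : Option Obj) (r : Out V)
      (hc : c.ctl p = .running t (.done r) none) :
      Step T c (r.label p) (c.setCtl p .idle)
  /-- A process can crash at any time; the contents of the non-volatile memory survive. -/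
  | crash (c : Config V Obj P) (p : P) :
      Step T c (.crash p) (c.setCtl p (c.ctl p).crash)
  | setOp (c : Config V Obj P) (p : P) (t : Option Obj) (a : Tag) (k : Prog V Obj)
      (h : Handle V Obj) (hc : c.ctl p = .running t (.setOp a k) none) (hh : c.hnd p = some h) :
      Step T c (.tau p) ((c.setHnd p { h with op := a }).setCtl p (.running t k none))
  | getOp (c : Config V Obj P) (p : P) (t : Option Obj) (k : Tag → Prog V Obj)
      (h : Handle V Obj) (hc : c.ctl p = .running t (.getOp k) none) (hh : c.hnd p = some h) :
      Step T c (.tau p) (c.setCtl p (.running t (k h.op) none))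
  /-- Internal work of a DurEC operation. -/
  | work (c : Config V Obj P) (p : P) (t : Option Obj) (k : Prog V Obj) (f : ℕ)
      (hc : c.ctl p = .running t k (some (f + 1))) :
      Step T c (.tau p) (c.setCtl p (.running t k (some f)))
  | llInv (c : Config V Obj P) (p : P) (t : Option Obj) (x : Obj × Cell) (g : Role)
      (k : ECState V → Prog V Obj) (h : Handle V Obj)
      (hc : c.ctl p = .running t (.ecll x g k) none)
      (hh : c.hnd p = some h) (free : (h.ec g).pend = none) :
      Step T c (.tau p) ((c.setHnd p (h.setPend g (some (.ll x none)))).setCtl p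
        (.running t (.ecll x g k) (some T)))
  | llEffect (c : Config V Obj P) (p : P) (x : Obj × Cell) (g : Role) (h : Handle V Obj)
      (s : ECState V) (hh : c.hnd p = some h) (hp : (h.ec g).pend = some (.ll x none))
      (hs : c.ec x = some s) :
      Step T c (.tau p) (c.setHnd p (h.setPend g (some (.ll x (some s)))))
  | llRet (c : Config V Obj P) (p : P) (t : Option Obj) (x : Obj × Cell) (g : Role)
      (k : ECState V → Prog V Obj) (f : ℕ) (h : Handle V Obj) (s : ECState V)
      (hc : c.ctl p = .running t (.ecll x g k) (some f))
      (hh : c.hnd p = some h) (hp : (h.ec g).pend = some (.ll x (some s))) :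
      Step T c (.tau p) ((c.setHnd p (h.setPend g none)).setCtl p (.running t (k s) none))
  | scInv (c : Config V Obj P) (p : P) (t : Option Obj) (x : Obj × Cell) (g : Role)
      (s : ℕ) (v : V) (b : Bool) (k : Bool → Prog V Obj) (h : Handle V Obj)
      (hc : c.ctl p = .running t (.ecsc x g s v b k) none)
      (hh : c.hnd p = some h) (free : (h.ec g).pend = none) :
      Step T c (.tau p) ((c.setHnd p (h.setPend g (some (.sc x s v b none)))).setCtl p
        (.running t (.ecsc x g s v b k) (some T)))
  /-- A successful `ECSC` takes effect. -/
  | scSuccess (c : Config V Obj P) (p : P) (x : Obj × Cell) (g : Role) (s : ℕ) (v : V) (b : Bool)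
      (h : Handle V Obj) (y : ECState V) (seq' det' : ℕ) (hh : c.hnd p = some h)
      (hp : (h.ec g).pend = some (.sc x s v b none)) (hy : c.ec x = some y)
      (hseq : y.seq = s) (hseq' : y.seq < seq') (hdet' : (h.ec g).det < det') :
      Step T c (.tau p) ((c.setEC x ⟨v, b, seq'⟩).setHnd p
        (h.setEC g ⟨det', some (.sc x s v b (some true))⟩))
  /-- A failing `ECSC` takes effect. -/
  | scFailure (c : Config V Obj P) (p : P) (x : Obj × Cell) (g : Role) (s : ℕ) (v : V) (b : Bool)
      (h : Handle V Obj) (y : ECState V) (hh : c.hnd p = some h)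
      (hp : (h.ec g).pend = some (.sc x s v b none)) (hy : c.ec x = some y)
      (hseq : y.seq ≠ s) :
      Step T c (.tau p) (c.setHnd p (h.setPend g (some (.sc x s v b (some false)))))
  | scRet (c : Config V Obj P) (p : P) (t : Option Obj) (x : Obj × Cell) (g : Role)
      (s : ℕ) (v : V) (b : Bool) (k : Bool → Prog V Obj) (f : ℕ) (h : Handle V Obj) (r : Bool)
      (hc : c.ctl p = .running t (.ecsc x g s v b k) (some f))
      (hh : c.hnd p = some h) (hp : (h.ec g).pend = some (.sc x s v b (some r))) :
      Step T c (.tau p) ((c.setHnd p (h.setPend g none)).setCtl p (.running t (k r) none))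
  | ecrecoverInv (c : Config V Obj P) (p : P) (t : Option Obj) (x : Obj × Cell) (g : Role)
      (k : Prog V Obj) (hc : c.ctl p = .running t (.ecrecover x g k) none) :
      Step T c (.tau p) (c.setCtl p (.running t (.ecrecover x g k) (some T)))
  /-- The recovery method of `x` returns: an operation on `x` that was pending through `g` is
  closed. -/
  | ecrecoverRet (c : Config V Obj P) (p : P) (t : Option Obj) (x : Obj × Cell) (g : Role)
      (k : Prog V Obj) (f : ℕ) (h : Handle V Obj)
      (hc : c.ctl p = .running t (.ecrecover x g k) (some f)) (hh : c.hnd p = some h) :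
      Step T c (.tau p)
        ((c.setHnd p (h.setPend g ((h.ec g).pend.filter fun a => a.target ≠ x))).setCtl p
          (.running t k none))
  | ecdetectInv (c : Config V Obj P) (p : P) (t : Option Obj) (g : Role)
      (k : ℕ → Prog V Obj) (h : Handle V Obj)
      (hc : c.ctl p = .running t (.ecdetect g k) none)
      (hh : c.hnd p = some h) (free : (h.ec g).pend = none) :
      Step T c (.tau p) (c.setCtl p (.running t (.ecdetect g k) (some T)))
  | ecdetectRet (c : Config V Obj P) (p : P) (t : Option Obj) (g : Role)
      (k : ℕ → Prog V Obj) (f : ℕ) (h : Handle V Obj)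
      (hc : c.ctl p = .running t (.ecdetect g k) (some f)) (hh : c.hnd p = some h) :
      Step T c (.tau p) (c.setCtl p (.running t (k (h.ec g).det) none))

/-- `Run T H c`: the sequence of labels `H` leads from the initial configuration to `c`. -/
inductive Run (T : ℕ) : List (Label V Obj P) → Config V Obj P → Prop
  | nil : Run T [] (Config.init V Obj P)
  | snoc (H : List (Label V Obj P)) (c c' : Config V Obj P) (l : Label V Obj P)
      (hr : Run T H c) (hs : Step T c l c') : Run T (H ++ [l]) c'

end Semantics

/-! ### Durable linearizability and detectability -/

section Correctness

variable {V : Type u} {Obj : Type v} {P : Type w}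

/-- The operation invoked by `p` at position `i` of `H` completes at position `j`: either
it returns (`out` is its response), or it crashed and `recover` returns (`out = none`). -/
def Completes (H : List (Label V Obj P)) (p : P) (i j : ℕ) (out : Option (Resp V)) : Prop :=
  (∃ o op, H[i]? = some (.inv p o op)) ∧ i < j ∧
  ((∃ r, H[j]? = some (.ret p r) ∧ out = some r) ∨ (H[j]? = some (.recRet p) ∧ out = none)) ∧
  ∀ k, i < k → k < j → (∀ r, H[k]? ≠ some (.ret p r)) ∧ H[k]? ≠ some (.recRet p)

/-- An entry of a linearization: the position of the invocation, the operation, its response. -/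
structure Entry (V : Type u) : Type u where
  id : ℕ
  op : Op V
  resp : Resp V

/-- `S` is a sequential execution from the value `s`, with correct responses. -/
def Legal [DecidableEq V] : V → List (Entry V) → Prop
  | _, [] => True
  | s, e :: S => (e.op.apply s).2 = e.resp ∧ Legal (e.op.apply s).1 S

/-- `S` is a durable linearization of the operations on `o` in `H`.  The interval of an
operation extends from its invocation to its response or, if it crashed, to the completion of
the recovery; an operation that returns is linearized with the response it returned, one that
crashed or is incomplete is linearized or never takes effect. -/
structure IsDurableLinearization [DecidableEq V] (H : List (Label V Obj P)) (o : Obj)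
    (S : List (Entry V)) : Prop where
  invoked : ∀ e ∈ S, ∃ p, H[e.id]? = some (.inv p o e.op)
  nodup : (S.map Entry.id).Nodup
  returned : ∀ p op i j r, H[i]? = some (.inv p o op) → Completes H p i j (some r) →
    ∃ e ∈ S, e.id = i ∧ e.resp = r
  realTime : S.Pairwise fun a b => ¬ ∃ p j out, Completes H p b.id j out ∧ j < a.id
  legal : ∀ v, .newObj o v ∈ H → Legal v S

/-- The process that invoked the operation at position `i` of `H` executed `detect` before and
after it, with no other operation of that process in between; the first execution returned
detection value `d₁`, and the second one returned `(d₂, r₂)`. -/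
def Bracketed (H : List (Label V Obj P)) (o : Obj) (i d₁ d₂ : ℕ) (r₂ : Resp V) : Prop :=
  ∃ p op a b j r₁ out, H[i]? = some (.inv p o op) ∧
    a < i ∧ H[a]? = some (.detRet p d₁ r₁) ∧
    Completes H p i j out ∧
    j < b ∧ H[b]? = some (.detRet p d₂ r₂) ∧
    ∀ k, a < k → k < b → k ≠ i → ∀ o' op', H[k]? ≠ some (.inv p o' op')

/-- Detectability, relative to a linearization `S` of the operations on `o` in `H`.  An increase
of the detection value across an operation tells that the operation took effect, and with which
response.  Otherwise the detection value is unchanged and the operation is safe to repeat: it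
never took effect, or its effect is invisible to all others, so that all the rest of `S` is
legal without it (and without any further operations whose detection value did not change). -/
structure Detects [DecidableEq V] (H : List (Label V Obj P)) (o : Obj) (S : List (Entry V)) :
    Prop where
  mono : ∀ i d₁ d₂ r₂, Bracketed H o i d₁ d₂ r₂ → d₁ ≤ d₂
  effective : ∀ i d₁ d₂ r₂, Bracketed H o i d₁ d₂ r₂ → d₁ < d₂ →
    ∃ e ∈ S, e.id = i ∧ e.resp = r₂
  safe : ∀ A : Finset ℕ, (∀ i ∈ A, ∃ d r₂, Bracketed H o i d d r₂) →
    ∀ v, .newObj o v ∈ H → Legal v (S.filter fun e => e.id ∉ A)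

/-! ### Time and space -/

/-- The event starts a method of `p`: a read, write or CAS, `recover`, or `detect`. -/
def Label.Starts (p : P) (l : Label V Obj P) : Prop :=
  (∃ o op, l = .inv p o op) ∨ (∃ o, l = .recInv p o) ∨ l = .detInv p

/-- A method of `p` returns. -/
def Label.Returns (p : P) (l : Label V Obj P) : Prop :=
  (∃ r, l = .ret p r) ∨ l = .recRet p ∨ ∃ d r, l = .detRet p d r

/-- The label is a step of `p` inside a method. -/
def Label.isTau [DecidableEq P] (p : P) : Label V Obj P → Bool
  | .tau q => decide (q = p)
  | _ => false

/-- Process `p` is executing a method. -/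
def Config.Active (c : Config V Obj P) (p : P) : Prop :=
  ∃ t k call, c.ctl p = .running t k call

/-- Space in use, if each DurEC object and each DurEC handle occupies `M` words: the DurEC
objects, the DurEC handles, and the fields `op`. -/
noncomputable def Config.space (M : ℕ) (c : Config V Obj P) : ℕ∞ :=
  M * {x : Obj × Cell | c.ec x ≠ none}.encard +
  M * {y : P × Role | c.hnd y.1 ≠ none}.encard +
  {p : P | c.hnd p ≠ none}.encard

/-- Number of DuraCAS objects created. -/
noncomputable def numObjects (H : List (Label V Obj P)) : ℕ :=
  {o : Obj | ∃ v, .newObj o v ∈ H}.ncard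

/-- Number of processes that acquired a handle. -/
noncomputable def numHandles (H : List (Label V Obj P)) : ℕ :=
  {p : P | .newHandle p ∈ H}.ncard

end Correctness

end DuraCAS

/-! `Z` holds the value of the object and `W` has room for one write that waits to be moved to `Z`.
The bits of `Z` and `W` differ exactly while a write is waiting. Sequence numbers increase with
every change, so a successful `ECSC` shows that its cell has not changed since it was read.

The protocol (`Protocol.bits_spec`). A transfer happens only while the bits differ and moves the
current contents of `W`; `W` is changed only while the bits are equal. Each half rests on the other
at earlier times: `W` cannot change under a transfer because the bits differ, and a transfer cannot
slip in under a write because they agree. A CAS keeps the bit of `Z`.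

Helping (`Protocol.exists_transfer`). While a write waits, a complete `transfer-write` without a
transfer must have lost against a CAS. Suppose this happens twice in a row. The second of the two
winning CAS operations read `Z` after the first one had succeeded, and executed its own
`transfer-write` before its `ECSC`. That `transfer-write` met no change of `Z`, so it must have
succeeded: contradiction. Hence a write, or the recovery that follows its crash, is not completed
before the contents it put into `W` are transferred.

Failed CAS (`Protocol.exists_val_ne`). A CAS that loses both rounds saw `Z` change in two disjoint
intervals. A change by a CAS alters the value. If both changes are transfers, the second one carries
a value that was compared with that of `Z` after the first and found to be different. So the value
was not `old` all the time.

Linearization points. A successful CAS takes effect at its `ECSC` on `Z`, and a write that changed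
`W` at its transfer; these operations are the only ones that change the value. Reads, failed CAS
operations, and writes or CAS operations with nothing to change take effect when a suitable value is
in `Z`. Any other write that returns overlaps a transfer (`exists_point`) and is placed just before
the write transferred then, which hides it. Deleting any operations that do not change the value
therefore keeps the sequence legal.

Detectability. The critical handle is used for `ECSC` only at the step that makes an operation
effective, and succeeds at most once per operation (`Succ.unique`). So the detection value rises
across a completed operation exactly if the operation is one of those that change the value, and
`op` still tells its response.

All this is derived from the code by a weakest-precondition predicate `OK`, which records what each
`ECSC` knows about the past when it is invoked (`Guard`) and what a method knows when it returns. An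
invariant for each process (`Trace.inv`) shows that these facts hold in every run, including steps
in which an operation pending since before a crash takes effect. The time bound is a decreasing
measure (`Remaining.step`), and the space bound counts cells and handles. -/

namespace DuraCAS

universe u v w

/-! ### Facts about the past, and weakest preconditions for the code. -/

section Traces

variable {V : Type u} {Obj : Type v} {P : Type w}

/-- The cell on which a process works through its critical handle determines the field `op`. -/
def Cell.tag : Cell → Tag
  | .W => .write
  | .Z => .cas

/-- The response reported by `detect`. -/
def Tag.resp : Tag → Resp V
  | .cas => .bool true
  | .write => .ack

/-- The value of the field `op` set by a write or a CAS. -/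
def Op.tag? : Op V → Option Tag
  | .read => none
  | .write _ => some .write
  | .cas _ _ => some .cas

/-- The DuraCAS object on which a process executes, or has to recover, a method. -/
def Ctl.obj : Ctl V Obj → Option Obj
  | .idle => none
  | .crashed o => some o
  | .running t _ _ => t

/-- The operation pending through a DurEC handle at time `t`. -/
def pend (C : ℕ → Config V Obj P) (p : P) (g : Role) (t : ℕ) : Option (Pending V Obj) :=
  ((C t).hnd p).bind fun h => (h.ec g).pend

/-- The detection value of a DurEC handle at time `t`. -/
def det (C : ℕ → Config V Obj P) (p : P) (g : Role) (t : ℕ) : ℕ :=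
  ((C t).hnd p).elim 0 fun h => (h.ec g).det

/-- The field `op` of a handle at time `t`. -/
def tag (C : ℕ → Config V Obj P) (p : P) (t : ℕ) : Option Tag :=
  ((C t).hnd p).map Handle.op

/-- Process `p` completes no operation and no recovery at the times in `[a, b)`. -/
def Busy (H : List (Label V Obj P)) (p : P) (a b : ℕ) : Prop :=
  ∀ k, a ≤ k → k < b → (∀ r, H[k]? ≠ some (.ret p r)) ∧ H[k]? ≠ some (.recRet p)

/-- The operation that `p` invoked at time `i` is not completed before time `t`. -/
def Open (H : List (Label V Obj P)) (p : P) (i t : ℕ) : Prop :=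
  i < t ∧ Busy H p (i + 1) t

/-- At time `t` a successful `ECSC` of `p` through `g` takes effect. -/
structure Succ (H : List (Label V Obj P)) (C : ℕ → Config V Obj P) (t : ℕ) (p : P) (g : Role)
    (x : Obj × Cell) (s : ℕ) (v : V) (b : Bool) : Prop where
  label : H[t]? = some (.tau p)
  pend : pend C p g t = some (.sc x s v b none)
  effect : ∃ y q, (C t).ec x = some y ∧ y.seq = s ∧ s < q ∧ (C (t + 1)).ec x = some ⟨v, b, q⟩
  frame : ∀ x', x' ≠ x → (C (t + 1)).ec x' = (C t).ec x'
  det_lt : det C p g t < det C p g (t + 1)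
  det_eq : ∀ g', g' ≠ g → det C p g' (t + 1) = det C p g' t

/-- At time `t` an `ECSC` of `p` through `g` takes effect with response `r`. -/
def SCEffect (H : List (Label V Obj P)) (C : ℕ → Config V Obj P) (p : P) (g : Role)
    (x : Obj × Cell) (s : ℕ) (v : V) (b : Bool) (t : ℕ) (r : Bool) : Prop :=
  (r = true ∧ Succ H C t p g x s v b) ∨ (r = false ∧ ∃ y, (C t).ec x = some y ∧ y.seq ≠ s)

/-- A `transfer-write` on `o` was executed in the interval `[a, b]`: the bits it read were equal,
or `Z` changed after it was read. -/
def TransferDone (C : ℕ → Config V Obj P) (o : Obj) (a b : ℕ) : Prop :=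
  ∃ t₀ t₁ z w, a ≤ t₀ ∧ t₀ ≤ t₁ ∧ t₁ ≤ b ∧ (C t₀).ec (o, .Z) = some z ∧
    (C t₁).ec (o, .W) = some w ∧
    (z.bit = w.bit ∨ ∃ t₂ y, t₁ ≤ t₂ ∧ t₂ < b ∧ (C t₂).ec (o, .Z) = some y ∧
      (y.seq ≠ z.seq ∨ ∃ y', (C (t₂ + 1)).ec (o, .Z) = some y' ∧ y.seq < y'.seq))

/-- In `[a, b)` the value of `Z` was read to be `old`, and `Z` changed afterwards. -/
def LostRace (C : ℕ → Config V Obj P) (o : Obj) (old : V) (a b : ℕ) : Prop :=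
  ∃ t₀ t₁ z y, a ≤ t₀ ∧ t₀ ≤ t₁ ∧ t₁ < b ∧ (C t₀).ec (o, .Z) = some z ∧ z.val = old ∧
    (C t₁).ec (o, .Z) = some y ∧ y.seq ≠ z.seq

/-- What is known about the past when `ECSC` is invoked. -/
def Guard (H : List (Label V Obj P)) (C : ℕ → Config V Obj P) (p : P) :
    Role → Obj × Cell → ℕ → V → Bool → ℕ → Prop
  | .casual, (_, .W), _, _, _, _ => False
  | .casual, (o, .Z), s, v, b, t =>
    ∃ t₀ t₁ z w, t₀ ≤ t₁ ∧ t₁ ≤ t ∧ (C t₀).ec (o, .Z) = some z ∧ (C t₁).ec (o, .W) = some w ∧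
      z.seq = s ∧ z.bit ≠ w.bit ∧ v = w.val ∧ b = w.bit
  | .critical, (o, .Z), s, v, b, t =>
    ∃ i old, H[i]? = some (.inv p o (.cas old v)) ∧ Open H p i t ∧
      det C p .critical t = det C p .critical (i + 1) ∧ tag C p t = some .cas ∧ old ≠ v ∧
      ∃ t₀ z, i < t₀ ∧ t₀ ≤ t ∧ (C t₀).ec (o, .Z) = some z ∧ z.val = old ∧ z.seq = s ∧
        z.bit = b ∧ TransferDone C o t₀ t
  | .critical, (o, .W), s, v, b, t =>
    ∃ i, H[i]? = some (.inv p o (.write v)) ∧ Open H p i t ∧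
      det C p .critical t = det C p .critical (i + 1) ∧ tag C p t = some .write ∧
      ∃ t₀ t₁ w z, i < t₀ ∧ t₀ ≤ t₁ ∧ t₁ ≤ t ∧ (C t₀).ec (o, .W) = some w ∧
        (C t₁).ec (o, .Z) = some z ∧ z.val ≠ v ∧ z.bit = w.bit ∧ w.seq = s ∧ b = !w.bit

/-- What is preserved while `p` executes an instruction from time `a` to time `b`, if operations
can be pending only on the cells in `D`. -/
structure Keep (H : List (Label V Obj P)) (C : ℕ → Config V Obj P) (p : P)
    (D : Role → Cell → Prop) (a b : ℕ) : Prop where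
  tag : tag C p b = tag C p a
  busy : Busy H p a b
  det : (∀ c, ¬ D .critical c) → det C p .critical b = det C p .critical a

/-- The DurEC handle `g` is free for an operation on `x`. -/
def Ready (C : ℕ → Config V Obj P) (p : P) (t : Option Obj) (x : Obj × Cell) (g : Role)
    (D : Role → Cell → Prop) (a : ℕ) : Prop :=
  t = some x.1 ∧ (∀ c, ¬ D g c) ∧ (g = .critical → tag C p a = some x.2.tag)

/-- Weakest precondition, at time `a`, of code executed by `p` on the object `t`: operations can
be pending only on the cells in `D`; each `ECSC` satisfies its guard, and `Post` holds in the
end. -/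
def OK (H : List (Label V Obj P)) (C : ℕ → Config V Obj P) (p : P) (t : Option Obj)
    (Post : Out V → ℕ → Prop) : Prog V Obj → (Role → Cell → Prop) → ℕ → Prop
  | .done r, D, a => (∀ g c, ¬ D g c) ∧ Post r a
  | .ecll x g k, D, a => Ready C p t x g D a ∧
      ∀ a' b s, a ≤ a' → a' < b → (C a').ec x = some s → Keep H C p D a b →
        OK H C p t Post (k s) D b
  | .ecsc x g s v b k, D, a => Ready C p t x g D a ∧ Guard H C p g x s v b a ∧
      ∀ a' e r, a ≤ a' → a' < e → SCEffect H C p g x s v b a' r → tag C p e = tag C p a →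
        Busy H p a e →
        (¬ (r = true ∧ g = .critical) → (∀ c, ¬ D .critical c) →
          det C p .critical e = det C p .critical a) →
        OK H C p t Post (k r) D e
  | .ecrecover x g k, D, a => t = some x.1 ∧
      ∀ b, a < b → Keep H C p D a b →
        OK H C p t Post k (fun g' c => D g' c ∧ ¬ (g' = g ∧ c = x.2)) b
  | .ecdetect g k, D, a => g = .critical ∧ (∀ c, ¬ D .critical c) ∧
      ∀ b, a < b → Keep H C p D a b → OK H C p t Post (k (det C p .critical b)) D b
  | .setOp τ k, D, a => (∀ c, ¬ D .critical c) ∧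
      (∃ i o op, H[i]? = some (.inv p o op) ∧ Open H p i a ∧ op.tag? = some τ) ∧
      ∀ b, a < b → tag C p b = some τ → Busy H p a b →
        det C p .critical b = det C p .critical a → OK H C p t Post k D b
  | .getOp k, D, a => ∀ b τ, a < b → tag C p a = some τ → Keep H C p D a b →
      OK H C p t Post (k τ) D b

/-- No operation is pending. -/
def clean : Role → Cell → Prop := fun _ _ => False

/-- What can be pending when `recover` is invoked. -/
def dirty (τ : Tag) : Role → Cell → Prop
  | .casual, _ => True
  | .critical, c => c.tag = τ

/-- What is known about the past when an operation returns. -/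
def OpPost (H : List (Label V Obj P)) (C : ℕ → Config V Obj P) (p : P) (i : ℕ) (o : Obj) :
    Op V → Out V → ℕ → Prop
  | .read, r, t => ∃ t₀ z, i < t₀ ∧ t₀ < t ∧ (C t₀).ec (o, .Z) = some z ∧ r = .resp (.val z.val)
  | .write v, r, t => r = .resp .ack ∧
    ((det C p .critical t = det C p .critical (i + 1) ∧
      ∃ t₀ z, i < t₀ ∧ t₀ < t ∧ (C t₀).ec (o, .Z) = some z ∧ z.val = v) ∨
    ∃ t₀ t₁ t₂ t₃ w z, i < t₀ ∧ t₀ ≤ t₁ ∧ t₁ ≤ t₂ ∧ t₂ ≤ t₃ ∧ t₃ ≤ t ∧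
      (C t₀).ec (o, .W) = some w ∧ (C t₁).ec (o, .Z) = some z ∧
      (z.bit ≠ w.bit ∨ ∃ u r, t₁ ≤ u ∧ u < t₂ ∧
        SCEffect H C p .critical (o, .W) w.seq v (!w.bit) u r) ∧
      det C p .critical t = det C p .critical t₂ ∧
      TransferDone C o t₂ t₃ ∧ TransferDone C o t₃ t)
  | .cas old new, r, t =>
    (r = .resp (.bool true) ∧
      ((old = new ∧ ∃ t₀ z, i < t₀ ∧ t₀ < t ∧ (C t₀).ec (o, .Z) = some z ∧ z.val = old) ∨
        ∃ u s b, i < u ∧ u < t ∧ Succ H C u p .critical (o, .Z) s new b)) ∨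
    (r = .resp (.bool false) ∧ det C p .critical t = det C p .critical (i + 1) ∧
      ((∃ t₀ z, i < t₀ ∧ t₀ < t ∧ (C t₀).ec (o, .Z) = some z ∧ z.val ≠ old) ∨
        ∃ m, i < m ∧ m ≤ t ∧ LostRace C o old (i + 1) m ∧ LostRace C o old m t))

/-- What is known about the past when `recover` returns. -/
def RecPost (C : ℕ → Config V Obj P) (p : P) (o : Obj) (r : Out V) (t : ℕ) : Prop :=
  r = .recovered ∧ (tag C p t = some .write → ∃ t₂ t₃, t₂ ≤ t₃ ∧ t₃ ≤ t ∧
    det C p .critical t = det C p .critical t₂ ∧ TransferDone C o t₂ t₃ ∧ TransferDone C o t₃ t)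

/-- What `detect` returns. -/
def DetPost (C : ℕ → Config V Obj P) (p : P) (r : Out V) (t : ℕ) : Prop :=
  ∃ τ, tag C p t = some τ ∧ r = .detected (det C p .critical t) τ.resp

variable {H : List (Label V Obj P)} {C : ℕ → Config V Obj P} {p : P}

theorem Busy.trans {a b c : ℕ} (h : Busy H p a b) (h' : Busy H p b c) : Busy H p a c :=
  fun k h₁ h₂ => if hk : k < b then h k h₁ hk else h' k (by omega) h₂

theorem Busy.mono {a b a' b' : ℕ} (h : Busy H p a b) (ha : a ≤ a') (hb : b' ≤ b) :
    Busy H p a' b' :=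
  fun k h₁ h₂ => h k (by omega) (by omega)

theorem Busy.refl (a : ℕ) : Busy H p a a := fun k h₁ h₂ => by omega

theorem Open.trans {i a b : ℕ} (h : Open H p i a) (hab : a ≤ b) (h' : Busy H p a b) :
    Open H p i b :=
  ⟨h.1.trans_le hab, h.2.trans h'⟩

theorem Open.of_le {i a b : ℕ} (h : Open H p i b) (ha : i < a) (hab : a ≤ b) : Open H p i a :=
  ⟨ha, h.2.mono le_rfl hab⟩

theorem Keep.refl {D : Role → Cell → Prop} (a : ℕ) : Keep H C p D a a :=
  ⟨rfl, Busy.refl a, fun _ => rfl⟩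

theorem Keep.trans {D : Role → Cell → Prop} {a b c : ℕ} (h : Keep H C p D a b)
    (h' : Keep H C p D b c) : Keep H C p D a c :=
  ⟨h'.tag.trans h.tag, h.busy.trans h'.busy, fun hD => (h'.det hD).trans (h.det hD)⟩

theorem TransferDone.mono {o : Obj} {a b a' b' : ℕ} (h : TransferDone C o a b) (ha : a' ≤ a)
    (hb : b ≤ b') : TransferDone C o a' b' := by
  obtain ⟨t₀, t₁, z, w, h₀, h₁, h₂, hz, hw, h⟩ := h
  refine ⟨t₀, t₁, z, w, ha.trans h₀, h₁, h₂.trans hb, hz, hw, h.imp_right ?_⟩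
  rintro ⟨t₂, y, h₃, h₄, h⟩
  exact ⟨t₂, y, h₃, h₄.trans_le hb, h⟩

theorem LostRace.mono {o : Obj} {old : V} {a b a' b' : ℕ} (h : LostRace C o old a b)
    (ha : a' ≤ a) (hb : b ≤ b') : LostRace C o old a' b' := by
  obtain ⟨t₀, t₁, z, y, h₀, h₁, h₂, h⟩ := h
  exact ⟨t₀, t₁, z, y, ha.trans h₀, h₁, h₂.trans_le hb, h⟩

/-! ### The code satisfies its specification -/

/-- `transfer-write` on `o` followed by `k`. -/
theorem OK.transferWrite {o : Obj} {Post : Out V → ℕ → Prop} {k : Prog V Obj}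
    {D : Role → Cell → Prop} {a : ℕ} (hD : ∀ g c, ¬ D g c)
    (hk : ∀ b, a < b → Keep H C p D a b → TransferDone C o a b → OK H C p (some o) Post k D b) :
    OK H C p (some o) Post (transferWrite o k) D a := by
  refine ⟨⟨rfl, hD _, by simp⟩, fun t₀ b₀ z h₀ h₀' hz k₀ => ⟨⟨rfl, hD _, by simp⟩, ?_⟩⟩
  intro t₁ b₁ w h₁ h₁' hw k₁
  beta_reduce
  by_cases hb : z.bit ≠ w.bit
  · rw [if_pos hb]
    refine ⟨⟨rfl, hD _, by simp⟩, ?_, ?_⟩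
    · exact ⟨t₀, t₁, z, w, by omega, by omega, hz, hw, rfl, hb, rfl, rfl⟩
    · intro t₂ b₂ r h₂ h₂' hr htag hbusy hdet
      refine hk _ (by omega) ((k₀.trans k₁).trans ⟨htag, hbusy, hdet (by simp)⟩) ?_
      -- Success raises the sequence number of `Z` at `t₂`; failure shows that it is no longer the
      -- one read at `t₀`. Either way `Z` changed after it was read.
      rcases hr with ⟨rfl, hr⟩ | ⟨rfl, y, hy, hys⟩
      · obtain ⟨y, q, hy, hys, hq, hy'⟩ := hr.effect
        exact ⟨t₀, t₁, z, w, h₀, by omega, by omega, hz, hw,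
          .inr ⟨t₂, y, by omega, h₂', hy, .inr ⟨_, hy', by simpa [hys] using hq⟩⟩⟩
      · exact ⟨t₀, t₁, z, w, h₀, by omega, by omega, hz, hw,
          .inr ⟨t₂, y, by omega, h₂', hy, .inl hys⟩⟩
  · rw [if_neg hb]
    exact hk _ (by omega) (k₀.trans k₁)
      ⟨t₀, t₁, z, w, h₀, by omega, by omega, hz, hw, .inl (not_not.1 hb)⟩

theorem ok_readCode {i : ℕ} {o : Obj} :
    OK H C p (some o) (OpPost H C p i o .read) (readCode o) clean (i + 1) := by
  refine ⟨⟨rfl, by simp [clean], by simp⟩, fun t₀ b z h₀ h₁ hz _ => ⟨by simp [clean], ?_⟩⟩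
  exact ⟨t₀, z, by omega, h₁, hz, rfl⟩

theorem ok_detectCode {t : Option Obj} {a : ℕ} :
    OK H C p t (DetPost C p) (detectCode : Prog V Obj) clean a := by
  refine ⟨rfl, by simp [clean], fun b _ k₀ b' τ _ hτ k₁ => ?_⟩
  have h1 := k₁.tag
  have h2 := k₁.det (by simp [clean])
  cases τ <;>
  exact ⟨by simp [clean], _, by rw [h1, hτ], by rw [h2]; rfl⟩

/-- An interrupted critical operation can only be on the cell named by `op`, so the three DurEC
recoveries exhaust `dirty τ`. After that both handles are free, `transfer-write` may use the casual
one, and the detection value of the critical one is frozen. -/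
theorem ok_recoverCode {o : Obj} {a : ℕ} {τ : Tag} (hτ : tag C p a = some τ) :
    OK H C p (some o) (RecPost C p o) (recoverCode o : Prog V Obj) (dirty τ) a := by
  refine ⟨rfl, fun b₀ _ k₀ => ⟨rfl, fun b₁ _ k₁ b₂ τ' _ hτ' k₂ => ?_⟩⟩
  have h1 : tag C p b₁ = some τ := by rw [k₁.tag, k₀.tag, hτ]
  obtain rfl : τ = τ' := by rw [h1] at hτ'; simpa using hτ'
  have h2 : tag C p b₂ = some τ := by rw [k₂.tag, h1]
  cases τ with
  | cas =>
    refine ⟨rfl, fun b₃ _ k₃ => ⟨?_, rfl, ?_⟩⟩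
    · rintro (_ | _) (_ | _) <;> simp [dirty, Cell.tag]
    · rw [k₃.tag, h2]; simp
  | write =>
    refine ⟨rfl, fun b₃ _ k₃ => ?_⟩
    have hD : ∀ g c, ¬ (((dirty .write g c ∧ ¬ (g = .casual ∧ c = .W)) ∧
        ¬ (g = .casual ∧ c = .Z)) ∧ ¬ (g = .critical ∧ c = .W)) := by
      rintro (_ | _) (_ | _) <;> simp [dirty, Cell.tag]
    refine OK.transferWrite hD fun b₄ h₄ k₄ d₄ => OK.transferWrite hD fun b₅ h₅ k₅ d₅ => ?_
    exact ⟨hD, rfl, fun _ => ⟨b₃, b₄, h₄.le, h₅.le, by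
      rw [k₅.det (hD _), k₄.det (hD _)], d₄, d₅⟩⟩

variable [DecidableEq V]

theorem ok_writeCode {i : ℕ} {o : Obj} {v : V} (hi : H[i]? = some (.inv p o (.write v))) :
    OK H C p (some o) (OpPost H C p i o (.write v)) (writeCode o v) clean (i + 1) := by
  have hD : ∀ g c, ¬ clean g c := by simp [clean]
  refine ⟨hD _, ⟨i, o, _, hi, ⟨by omega, Busy.refl _⟩, rfl⟩, fun b₀ h₀ ht₀ hb₀ hd₀ => ?_⟩
  refine ⟨⟨rfl, hD _, fun _ => ht₀⟩, fun t₀ b₁ w h₁ h₁' hw k₁ => ?_⟩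
  refine ⟨⟨rfl, hD _, by simp⟩, fun t₁ b₂ z h₂ h₂' hz k₂ => ?_⟩
  have hd₂ : det C p .critical b₂ = det C p .critical (i + 1) := by
    rw [k₂.det (hD _), k₁.det (hD _), hd₀]
  beta_reduce
  by_cases hzv : z.val = v
  · rw [if_pos hzv]
    exact ⟨hD, rfl, .inl ⟨hd₂, t₁, z, by omega, h₂', hz, hzv⟩⟩
  rw [if_neg hzv]
  -- Common tail of the branches with and without `ECSC` on `W`. The detection value does not change
  -- after `b₃`; this will later place a success before the two executions of `transfer-write`.
  have rest : ∀ b₃, b₂ ≤ b₃ → (z.bit ≠ w.bit ∨ ∃ u r, t₁ ≤ u ∧ u < b₃ ∧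
        SCEffect H C p .critical (o, .W) w.seq v (!w.bit) u r) →
      OK H C p (some o) (OpPost H C p i o (.write v))
        (transferWrite o (transferWrite o (.done (.resp .ack)))) clean b₃ := by
    intro b₃ h₃ hu
    refine OK.transferWrite hD fun b₄ h₄ k₄ d₄ => OK.transferWrite hD fun b₅ h₅ k₅ d₅ => ?_
    exact ⟨hD, rfl, .inr ⟨t₀, t₁, b₃, b₄, w, z, by omega, by omega, by omega, h₄.le, h₅.le, hw, hz,
      hu, by rw [k₅.det (hD _), k₄.det (hD _)], d₄, d₅⟩⟩
  by_cases hb : z.bit = w.bit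
  · simp only [if_pos hb]
    have ht₂ : tag C p b₂ = some .write := by rw [k₂.tag, k₁.tag, ht₀]
    refine ⟨⟨rfl, hD _, fun _ => ht₂⟩, ?_, fun u b₃ r h₃ h₃' hr _ _ _ => rest b₃ (by omega)
      (.inr ⟨u, r, by omega, h₃', hr⟩)⟩
    refine ⟨i, hi, ⟨by omega, (hb₀.trans k₁.busy).trans k₂.busy⟩, hd₂, ht₂, t₀, t₁, w, z,
      by omega, by omega, by omega, hw, hz, hzv, hb, rfl, rfl⟩
  · simp only [if_neg hb]
    exact rest b₂ le_rfl (.inl hb)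

/-- `hk` stands for the rest of the loop, reached only after a failed `ECSC`. The failure means that
`Z` has changed since `old` was read, and leaves the detection value as it was at the invocation, as
the guard of the next round requires. -/
theorem ok_casLoop_succ {i n : ℕ} {o : Obj} {old new : V} {a : ℕ}
    (hi : H[i]? = some (.inv p o (.cas old new))) (ho : Open H p i a)
    (ht : tag C p a = some .cas) (hd : det C p .critical a = det C p .critical (i + 1))
    (hk : ∀ b, a < b → Open H p i b → tag C p b = some .cas →
      det C p .critical b = det C p .critical (i + 1) → LostRace C o old a b →
      OK H C p (some o) (OpPost H C p i o (.cas old new)) (casLoop o old new n) clean b) :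
    OK H C p (some o) (OpPost H C p i o (.cas old new)) (casLoop o old new (n + 1)) clean a := by
  have hD : ∀ g c, ¬ clean g c := by simp [clean]
  have hia := ho.1
  refine ⟨⟨rfl, hD _, fun _ => ht⟩, fun t₀ b₀ z h₀ h₀' hz k₀ => ?_⟩
  have hd₀ := (k₀.det (hD _)).trans hd
  beta_reduce
  by_cases hv : z.val ≠ old
  · rw [if_pos hv]
    exact ⟨hD, .inr ⟨rfl, hd₀, .inl ⟨t₀, z, by omega, h₀', hz, hv⟩⟩⟩
  rw [if_neg hv]
  have hv' := not_not.1 hv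
  by_cases hn : old = new
  · rw [if_pos hn]
    exact ⟨hD, .inl ⟨rfl, .inl ⟨hn, t₀, z, by omega, h₀', hz, hv'⟩⟩⟩
  rw [if_neg hn]
  refine OK.transferWrite hD fun b₁ h₁ k₁ d₁ => ?_
  have ht₁ : tag C p b₁ = some .cas := by rw [k₁.tag, k₀.tag, ht]
  have hd₁ := (k₁.det (hD _)).trans hd₀
  have ho₁ : Open H p i b₁ := ho.trans (by omega) (k₀.busy.trans k₁.busy)
  refine ⟨⟨rfl, hD _, fun _ => ht₁⟩, ?_, fun u b₂ r h₂ h₂' hr htag hbusy hdet => ?_⟩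
  · exact ⟨i, old, hi, ho₁, hd₁, ht₁, hn, t₀, z, by omega, by omega, hz, hv', rfl, rfl,
      d₁.mono (by omega) le_rfl⟩
  · rcases hr with ⟨rfl, hr⟩ | ⟨rfl, y, hy, hys⟩
    · exact ⟨hD, .inl ⟨rfl, .inr ⟨u, _, _, by omega, h₂', hr⟩⟩⟩
    · exact hk b₂ (by omega) (ho₁.trans (by omega) hbusy) (htag.trans ht₁)
        ((hdet (by simp) (hD _)).trans hd₁)
        ⟨t₀, u, z, y, h₀, by omega, h₂', hz, hv', hy, hys⟩

theorem ok_casCode {i : ℕ} {o : Obj} {old new : V}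
    (hi : H[i]? = some (.inv p o (.cas old new))) :
    OK H C p (some o) (OpPost H C p i o (.cas old new)) (casCode o old new) clean (i + 1) := by
  have hD : ∀ g c, ¬ clean g c := by simp [clean]
  refine ⟨hD _, ⟨i, o, _, hi, ⟨by omega, Busy.refl _⟩, rfl⟩, fun b₀ h₀ ht₀ hb₀ hd₀ => ?_⟩
  refine ok_casLoop_succ hi ⟨by omega, hb₀⟩ ht₀ hd₀ fun b₁ h₁ ho₁ ht₁ hd₁ r₁ => ?_
  refine ok_casLoop_succ hi ho₁ ht₁ hd₁ fun b₂ h₂ ho₂ ht₂ hd₂ r₂ => ?_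
  -- The two races are lost in consecutive intervals, separated by `b₁`; their disjointness is what
  -- `Protocol.exists_val_ne` needs.
  exact ⟨hD, .inr ⟨rfl, hd₂, .inr ⟨b₁, by omega, by omega, r₁.mono (by omega) le_rfl, r₂⟩⟩⟩

theorem ok_code {i : ℕ} {o : Obj} {op : Op V} (hi : H[i]? = some (.inv p o op)) :
    OK H C p (some o) (OpPost H C p i o op) (op.code o) clean (i + 1) := by
  cases op with
  | read => exact ok_readCode
  | write v => exact ok_writeCode hi
  | cas old new => exact ok_casCode hi

end Traces

/-! ### The invariant of a process, and steps that leave its handle alone. -/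

section Invariant

variable {V : Type u} {Obj : Type v} {P : Type w}

/-- The process that performs a step. -/
def Label.proc : Label V Obj P → Option P
  | .newObj _ _ => none
  | .newHandle p => some p
  | .inv p _ _ => some p
  | .ret p _ => some p
  | .recInv p _ => some p
  | .recRet p => some p
  | .detInv p => some p
  | .detRet p _ _ => some p
  | .crash p => some p
  | .tau p => some p

/-- All operations of `p` pending through `g` at time `t` are on cells in `D`. -/
def Pends (C : ℕ → Config V Obj P) (p : P) (D : Role → Cell → Prop) (t : ℕ) (g : Role) : Prop :=
  ∀ a, pend C p g t = some a → D g a.target.2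

/-- The instruction at the head of the code was reached at time `a` and is still being executed
at time `t`. -/
def Progress (H : List (Label V Obj P)) (C : ℕ → Config V Obj P) (p : P)
    (D : Role → Cell → Prop) (a t : ℕ) : Option ℕ → Prog V Obj → Prop
  | some _, .ecll x g _ => Keep H C p D a t ∧ (∀ g', g' ≠ g → Pends C p D t g') ∧
      ∃ res, pend C p g t = some (.ll x res) ∧
        ∀ s, res = some s → ∃ a', a ≤ a' ∧ a' < t ∧ (C a').ec x = some s
  | some _, .ecsc x g s v b _ => tag C p t = tag C p a ∧ Busy H p a t ∧
      (∀ g', g' ≠ g → Pends C p D t g') ∧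
      ∃ res, pend C p g t = some (.sc x s v b res) ∧
        (∀ r, res = some r → ∃ a', a ≤ a' ∧ a' < t ∧ SCEffect H C p g x s v b a' r) ∧
        (¬ (res = some true ∧ g = .critical) → (∀ c, ¬ D .critical c) →
          det C p .critical t = det C p .critical a)
  | some _, .done _ => False
  | some _, .setOp _ _ => False
  | some _, .getOp _ => False
  | _, _ => Keep H C p D a t ∧ ∀ g, Pends C p D t g

/-- The postcondition of the method that `p` is executing. -/
def Mode (H : List (Label V Obj P)) (C : ℕ → Config V Obj P) (p : P) (t : ℕ) (x : Option Obj)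
    (Post : Out V → ℕ → Prop) : Prop :=
  (∃ i o op, x = some o ∧ H[i]? = some (.inv p o op) ∧ Open H p i t ∧
    Post = OpPost H C p i o op) ∨
  (∃ o, x = some o ∧ Post = RecPost C p o) ∨ (x = none ∧ Post = DetPost C p)

/-- A running method satisfies its precondition. -/
def RunOK (H : List (Label V Obj P)) (C : ℕ → Config V Obj P) (p : P) (t : ℕ) (x : Option Obj)
    (k : Prog V Obj) (call : Option ℕ) : Prop :=
  ∃ D Post a, Mode H C p t x Post ∧ a ≤ t ∧ OK H C p x Post k D a ∧ Progress H C p D a t call k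

/-- A pending `ECSC` that has not taken effect satisfied its guard when it was invoked. -/
def GuardOK (H : List (Label V Obj P)) (C : ℕ → Config V Obj P) (p : P) (t : ℕ) (g : Role)
    (x : Obj × Cell) (s : ℕ) (v : V) (b : Bool) : Prop :=
  ∃ a ≤ t, Guard H C p g x s v b a ∧ Busy H p a t ∧
    (g = .critical → tag C p t = tag C p a ∧ det C p .critical t = det C p .critical a)

/-- The invariant of process `p` at time `t`. -/
structure Inv (H : List (Label V Obj P)) (C : ℕ → Config V Obj P) (t : ℕ) (p : P) : Prop where
  hnd : (C t).ctl p ≠ .idle → (C t).hnd p ≠ none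
  obj : ∀ o, ((C t).ctl p).obj = some o → ∀ c, (C t).ec (o, c) ≠ none
  targets : ∀ g a, pend C p g t = some a → ((C t).ctl p).obj = some a.target.1 ∧
    (g = .critical → tag C p t = some a.target.2.tag)
  opened : ∀ i o op, H[i]? = some (.inv p o op) → Open H p i t → ((C t).ctl p).obj = some o
  guard : ∀ g x s v b, pend C p g t = some (.sc x s v b none) → GuardOK H C p t g x s v b
  run : ∀ x k call, (C t).ctl p = .running x k call → RunOK H C p t x k call

variable {H : List (Label V Obj P)} {C : ℕ → Config V Obj P} {p : P} {t : ℕ}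

theorem pend_of {h : Handle V Obj} (hn : (C t).hnd p = some h) (g : Role) :
    pend C p g t = (h.ec g).pend := by simp [pend, hn]

theorem det_of {h : Handle V Obj} (hn : (C t).hnd p = some h) (g : Role) :
    det C p g t = (h.ec g).det := by simp [det, hn]

theorem tag_of {h : Handle V Obj} (hn : (C t).hnd p = some h) :
    tag C p t = some h.op := by simp [tag, hn]

theorem Mode.next {x : Option Obj} {Post : Out V → ℕ → Prop} (h : Mode H C p t x Post)
    (hb : Busy H p t (t + 1)) : Mode H C p (t + 1) x Post := by
  rcases h with ⟨i, o, op, h₁, h₂, h₃, h₄⟩ | h | h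
  · exact .inl ⟨i, o, op, h₁, h₂, h₃.trans (by omega) hb, h₄⟩
  · exact .inr (.inl h)
  · exact .inr (.inr h)

theorem GuardOK.next {g : Role} {x : Obj × Cell} {s : ℕ} {v : V} {b : Bool}
    (h : GuardOK H C p t g x s v b) (hb : Busy H p t (t + 1))
    (hg : g = .critical → tag C p (t + 1) = tag C p t ∧
      det C p .critical (t + 1) = det C p .critical t) : GuardOK H C p (t + 1) g x s v b := by
  obtain ⟨a, ha, h₁, h₂, h₃⟩ := h
  refine ⟨a, by omega, h₁, h₂.trans hb, fun e => ?_⟩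
  rw [(hg e).1, (hg e).2]
  exact h₃ e

theorem Open.of_succ {i : ℕ} (h : Open H p i (t + 1)) {o : Obj} {op : Op V}
    (hi : H[i]? = some (.inv p o op)) (hl : ∀ o op, H[t]? ≠ some (.inv p o op)) :
    Open H p i t := by
  refine h.of_le ?_ (by omega)
  have := h.1
  rcases (show i < t ∨ i = t by omega) with h | rfl
  · exact h
  · exact absurd hi (hl _ _)

theorem busy_of_label {l : Label V Obj P} (hl : H[t]? = some l) (h₁ : ∀ r, l ≠ .ret p r)
    (h₂ : l ≠ .recRet p) : Busy H p t (t + 1) := by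
  intro k h h'
  obtain rfl : k = t := by omega
  rw [hl]
  exact ⟨fun r e => h₁ r (Option.some.inj e), fun e => h₂ (Option.some.inj e)⟩

/-- The invariant after a step of `p` inside a method, or after a step of another process. -/
theorem Inv.next (I : Inv H C t p) (hb : Busy H p t (t + 1))
    (hl : ∀ o op, H[t]? ≠ some (.inv p o op))
    (hec : ∀ x, (C t).ec x ≠ none → (C (t + 1)).ec x ≠ none)
    (hobj : ((C (t + 1)).ctl p).obj = ((C t).ctl p).obj)
    (hnd : (C (t + 1)).ctl p ≠ .idle → (C (t + 1)).hnd p ≠ none)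
    (htarget : ∀ g a, pend C p g (t + 1) = some a →
      (∃ a₀, pend C p g t = some a₀ ∧ a₀.target = a.target ∧
        (g = .critical → tag C p (t + 1) = tag C p t)) ∨
      (((C t).ctl p).obj = some a.target.1 ∧
        (g = .critical → tag C p (t + 1) = some a.target.2.tag)))
    (hguard : ∀ g x s v b, pend C p g (t + 1) = some (.sc x s v b none) →
      (pend C p g t = some (.sc x s v b none) ∧ (g = .critical → tag C p (t + 1) = tag C p t ∧
        det C p .critical (t + 1) = det C p .critical t)) ∨ GuardOK H C p (t + 1) g x s v b)
    (hrun : ∀ x k call, (C (t + 1)).ctl p = .running x k call →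
      RunOK H C p (t + 1) x k call) : Inv H C (t + 1) p where
  hnd := hnd
  obj o ho c := hec _ (I.obj o (hobj ▸ ho) c)
  targets g a ha := by
    rw [hobj]
    rcases htarget g a ha with ⟨a₀, h₀, e, h⟩ | h
    · rw [← e]
      exact ⟨(I.targets g a₀ h₀).1, fun hg => (h hg).trans ((I.targets g a₀ h₀).2 hg)⟩
    · exact h
  opened i o op hi ho := hobj ▸ I.opened i o op hi (ho.of_succ hi hl)
  guard g x s v b h := by
    rcases hguard g x s v b h with ⟨h₁, h₂⟩ | h
    · exact (I.guard g x s v b h₁).next hb h₂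
    · exact h
  run := hrun

/-- Apart from the handle of `p`, `Progress` speaks only of configurations up to time `t`, so a step
that does not touch this handle cannot invalidate it. -/
theorem Progress.frame {D : Role → Cell → Prop} {a : ℕ} {call : Option ℕ} {k : Prog V Obj}
    (h : Progress H C p D a t call k) (hb : Busy H p t (t + 1))
    (hn : (C (t + 1)).hnd p = (C t).hnd p) : Progress H C p D a (t + 1) call k := by
  have hp : ∀ g, pend C p g (t + 1) = pend C p g t := fun g => by simp [pend, hn]
  have hd : ∀ g, det C p g (t + 1) = det C p g t := fun g => by simp [det, hn]
  have ht : tag C p (t + 1) = tag C p t := by simp [tag, hn]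
  have hP : ∀ g, Pends C p D t g → Pends C p D (t + 1) g := fun g h a ha => h a (hp g ▸ ha)
  have hK : Keep H C p D t (t + 1) := ⟨ht, hb, fun _ => hd _⟩
  have gen : Keep H C p D a t ∧ (∀ g, Pends C p D t g) →
      Keep H C p D a (t + 1) ∧ (∀ g, Pends C p D (t + 1) g) :=
    fun h => ⟨h.1.trans hK, fun g => hP g (h.2 g)⟩
  cases call with
  | none => exact gen h
  | some f =>
    cases k with
    | done r => exact h
    | setOp _ _ => exact h
    | getOp _ => exact h
    | ecrecover _ _ _ => exact gen h
    | ecdetect _ _ => exact gen h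
    | ecll x g k =>
      obtain ⟨h₁, h₂, res, h₃, h₄⟩ := h
      refine ⟨h₁.trans hK, fun g' hg => hP g' (h₂ g' hg), res, (hp g).trans h₃, fun s hs => ?_⟩
      obtain ⟨a', h, h', h''⟩ := h₄ s hs
      exact ⟨a', h, by omega, h''⟩
    | ecsc x g s v b k =>
      obtain ⟨h₁, h₁', h₂, res, h₃, h₄, h₅⟩ := h
      refine ⟨ht.trans h₁, h₁'.trans hb, fun g' hg => hP g' (h₂ g' hg), res, (hp g).trans h₃,
        fun s hs => ?_, fun h h' => (hd _).trans (h₅ h h')⟩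
      obtain ⟨a', h, h', h''⟩ := h₄ s hs
      exact ⟨a', h, by omega, h''⟩

/-- The invariant is preserved if neither the handle nor the control state of `p` changes. -/
theorem Inv.frame (I : Inv H C t p) (hb : Busy H p t (t + 1))
    (hl : ∀ o op, H[t]? ≠ some (.inv p o op))
    (hec : ∀ x, (C t).ec x ≠ none → (C (t + 1)).ec x ≠ none)
    (hn : (C (t + 1)).hnd p = (C t).hnd p) (hc : (C (t + 1)).ctl p = (C t).ctl p) :
    Inv H C (t + 1) p := by
  have hp : ∀ g, pend C p g (t + 1) = pend C p g t := fun g => by simp [pend, hn]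
  have hd : ∀ g, det C p g (t + 1) = det C p g t := fun g => by simp [det, hn]
  have ht : tag C p (t + 1) = tag C p t := by simp [tag, hn]
  refine I.next hb hl hec (by rw [hc]) (by rw [hc, hn]; exact I.hnd) ?_ ?_ ?_
  · exact fun g a ha => .inl ⟨a, hp g ▸ ha, rfl, fun _ => ht⟩
  · exact fun g x s v b h => .inl ⟨hp g ▸ h, fun _ => ⟨ht, hd _⟩⟩
  · intro x k call h
    obtain ⟨D, Post, a, h₁, h₂, h₃, h₄⟩ := I.run x k call (hc ▸ h)
    exact ⟨D, Post, a, h₁.next hb, by omega, h₃, h₄.frame hb hn⟩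

/-- The invariant after a step of `p` that changes only its control state. -/
theorem Inv.advance (I : Inv H C t p) (hl : H[t]? = some (.tau p))
    (hec : ∀ x, (C t).ec x ≠ none → (C (t + 1)).ec x ≠ none)
    (hn : (C (t + 1)).hnd p = (C t).hnd p) {x : Option Obj} {k k' : Prog V Obj}
    {call call' : Option ℕ} (hc : (C t).ctl p = .running x k call)
    (hc' : (C (t + 1)).ctl p = .running x k' call')
    (hrun : ∀ D Post a, a ≤ t → OK H C p x Post k D a → Progress H C p D a (t + 1) call k →
      ∃ a', a' ≤ t + 1 ∧ OK H C p x Post k' D a' ∧ Progress H C p D a' (t + 1) call' k') :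
    Inv H C (t + 1) p := by
  have hb : Busy H p t (t + 1) := busy_of_label hl (by simp) (by simp)
  have hp : ∀ g, pend C p g (t + 1) = pend C p g t := fun g => by simp [pend, hn]
  have hd : ∀ g, det C p g (t + 1) = det C p g t := fun g => by simp [det, hn]
  have ht : tag C p (t + 1) = tag C p t := by simp [tag, hn]
  refine I.next hb (by simp [hl]) hec (by rw [hc, hc']; rfl)
    (fun _ => hn ▸ I.hnd (by simp [hc])) ?_ ?_ ?_
  · exact fun g a ha => .inl ⟨a, hp g ▸ ha, rfl, fun _ => ht⟩
  · exact fun g x s v b h => .inl ⟨hp g ▸ h, fun _ => ⟨ht, hd _⟩⟩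
  · intro y m ca h
    rw [hc'] at h
    cases h
    obtain ⟨D, Post, a, h₁, h₂, h₃, h₄⟩ := I.run _ _ _ hc
    obtain ⟨a', h₅, h₆, h₇⟩ := hrun D Post a h₂ h₃ (h₄.frame hb hn)
    exact ⟨D, Post, a', h₁.next hb, h₅, h₆, h₇⟩

variable [DecidableEq V] [DecidableEq Obj] [DecidableEq P]

/-- A run as a function from times to configurations, constant after the end of the run. -/
structure Trace (T : ℕ) (H : List (Label V Obj P)) (C : ℕ → Config V Obj P) : Prop where
  init : C 0 = Config.init V Obj P
  step : ∀ t l, H[t]? = some l → Step T (C t) l (C (t + 1))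
  stay : ∀ t, H[t]? = none → C (t + 1) = C t

theorem Run.exists_trace {T : ℕ} {H : List (Label V Obj P)} {c : Config V Obj P}
    (hr : Run T H c) : ∃ C, Trace T H C ∧ C H.length = c := by
  induction hr with
  | nil => exact ⟨fun _ => Config.init V Obj P, ⟨rfl, by simp, fun _ _ => rfl⟩, rfl⟩
  | snoc H c c' l hr hs ih =>
    obtain ⟨C, hC, rfl⟩ := ih
    refine ⟨fun t => if t ≤ H.length then C t else c', ⟨by simp [hC.init], ?_, ?_⟩, by simp⟩
    · intro t m hm
      rcases lt_trichotomy t H.length with h | h | h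
      · rw [List.getElem?_append_left h] at hm
        rw [if_pos (by omega), if_pos (by omega)]
        exact hC.step t m hm
      · subst h
        simp only [List.getElem?_concat_length, Option.some.injEq] at hm
        subst hm
        simpa using hs
      · rw [List.getElem?_eq_none (by simp; omega)] at hm
        cases hm
    · intro t ht
      rw [List.getElem?_eq_none_iff, List.length_append, List.length_singleton] at ht
      rw [if_neg (by omega), if_neg (by omega)]

theorem Step.ec_ne_none {T : ℕ} {c c' : Config V Obj P} {l : Label V Obj P}
    (hs : Step T c l c') (x : Obj × Cell) (hx : c.ec x ≠ none) : c'.ec x ≠ none := by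
  cases hs <;> simp only [Config.setCtl, Config.setHnd, Config.setEC] <;> try exact hx
  all_goals
    simp only [Function.update_apply]
    split_ifs <;> simp_all

theorem Step.frame {T : ℕ} {c c' : Config V Obj P} {l : Label V Obj P}
    (hs : Step T c l c') {p : P} (hp : l.proc ≠ some p) :
    c'.hnd p = c.hnd p ∧ c'.ctl p = c.ctl p := by
  cases hs with
  | finish q t r hc =>
    have : p ≠ q := by rintro rfl; cases r <;> exact hp rfl
    simp [Config.setCtl, this]
  | _ =>
    simp only [Label.proc, ne_eq, Option.some.injEq] at hp
    simp [Config.setCtl, Config.setHnd, Config.setEC, @eq_comm P p, hp]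

end Invariant

/-! ### Steps that change a DurEC handle. -/

section Preservation

set_option linter.unusedSectionVars false

variable {V : Type u} {Obj : Type v} {P : Type w}
  {H : List (Label V Obj P)} {C : ℕ → Config V Obj P} {p : P} {t : ℕ}

theorem Progress.keep {D : Role → Cell → Prop} {a : ℕ} {k : Prog V Obj}
    (h : Progress H C p D a t none k) : Keep H C p D a t ∧ ∀ g, Pends C p D t g := by
  cases k <;> exact h

theorem Progress.free {D : Role → Cell → Prop} {a : ℕ} {k : Prog V Obj}
    (h : Progress H C p D a t none k) {g : Role} (hg : ∀ c, ¬ D g c) : pend C p g t = none := by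
  cases hp : pend C p g t with
  | none => rfl
  | some a => exact absurd (h.keep.2 g a hp) (hg _)

theorem Progress.of_keep {D : Role → Cell → Prop} {a : ℕ} {k : Prog V Obj}
    (h : Keep H C p D a t) (h' : ∀ g, Pends C p D t g) : Progress H C p D a t none k := by
  cases k <;> exact ⟨h, h'⟩

theorem Pends.of_eq {D : Role → Cell → Prop} {a : ℕ} {g : Role} (h : Pends C p D t g)
    (he : pend C p g a = pend C p g t) : Pends C p D a g := fun _ hb => h _ (he ▸ hb)

variable [DecidableEq V] [DecidableEq Obj] [DecidableEq P]

theorem Handle.setEC_ec (h : Handle V Obj) (g : Role) (a : ECHandle V Obj) (g' : Role) :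
    (h.setEC g a).ec g' = if g' = g then a else h.ec g' := by
  simp [Handle.setEC, Function.update_apply]

/-- The data of a step in which an operation pending through `g` takes effect. -/
structure Effect (H : List (Label V Obj P)) (C : ℕ → Config V Obj P) (p : P) (t : ℕ)
    (h : Handle V Obj) (g : Role) (d : ℕ) (a a' : Pending V Obj) : Prop where
  label : H[t]? = some (.tau p)
  before : (C t).hnd p = some h
  after : (C (t + 1)).hnd p = some (h.setEC g ⟨d, some a'⟩)
  pend : (h.ec g).pend = some a
  target : a'.target = a.target
  ll : ∀ x res, a = .ll x res →
    ∃ s, a' = .ll x (some s) ∧ (C t).ec x = some s ∧ d = (h.ec g).det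
  sc : ∀ x s v b res, a = .sc x s v b res → res = none ∧ ∃ r, a' = .sc x s v b (some r) ∧
    SCEffect H C p g x s v b t r ∧ (r = false → d = (h.ec g).det)

namespace Effect

variable {h : Handle V Obj} {g : Role} {d : ℕ} {a a' : Pending V Obj}

theorem pend_self (E : Effect H C p t h g d a a') : DuraCAS.pend C p g (t + 1) = some a' := by
  rw [pend_of E.after, Handle.setEC_ec, if_pos rfl]

theorem pend_other (E : Effect H C p t h g d a a') {g' : Role} (hg : g' ≠ g) :
    DuraCAS.pend C p g' (t + 1) = DuraCAS.pend C p g' t := by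
  rw [pend_of E.after, pend_of E.before, Handle.setEC_ec, if_neg hg]

theorem det_other (E : Effect H C p t h g d a a') {g' : Role} (hg : g' ≠ g) :
    det C p g' (t + 1) = det C p g' t := by
  rw [det_of E.after, det_of E.before, Handle.setEC_ec, if_neg hg]

theorem det_self (E : Effect H C p t h g d a a') (hd : d = (h.ec g).det) :
    det C p g (t + 1) = det C p g t := by
  rw [det_of E.after, det_of E.before, Handle.setEC_ec, if_pos rfl, hd]

theorem tag_eq (E : Effect H C p t h g d a a') : tag C p (t + 1) = tag C p t := by
  rw [tag_of E.after, tag_of E.before]; rfl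

theorem busy (E : Effect H C p t h g d a a') : Busy H p t (t + 1) :=
  busy_of_label E.label (by simp) (by simp)

theorem pends (E : Effect H C p t h g d a a') {D : Role → Cell → Prop} {g' : Role}
    (hP : Pends C p D t g') : Pends C p D (t + 1) g' := by
  intro b hb
  by_cases hg : g' = g
  · subst hg
    obtain rfl : a' = b := by rw [E.pend_self] at hb; simpa using hb
    rw [E.target]
    exact hP a ((pend_of E.before _).trans E.pend)
  · exact hP b (E.pend_other hg ▸ hb)

/-- If the critical operation that takes effect is accounted for by `D`, the detection clause of
`Keep` is vacuous. Otherwise `d` has to be the old detection value. -/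
theorem keep (E : Effect H C p t h g d a a') {D : Role → Cell → Prop}
    (hg : g = .critical → d = (h.ec g).det ∨ Pends C p D t .critical) :
    Keep H C p D t (t + 1) := by
  refine ⟨E.tag_eq, E.busy, fun hD => ?_⟩
  by_cases h' : g = .critical
  · subst h'
    rcases hg rfl with hd | hP
    · exact E.det_self hd
    · exact absurd (hP a ((pend_of E.before _).trans E.pend)) (hD _)
  · exact E.det_other (Ne.symm h')

/-- The operation that takes effect is either that of the current instruction, whose response is
then justified by time `t` itself, or one left over from before a crash, which `D` accounts for. -/
theorem progress (E : Effect H C p t h g d a a') {D : Role → Cell → Prop} {a₀ : ℕ}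
    (ha₀ : a₀ ≤ t) {call : Option ℕ} {k : Prog V Obj} (hP : Progress H C p D a₀ t call k) :
    Progress H C p D a₀ (t + 1) call k := by
  have gen : Keep H C p D a₀ t ∧ (∀ g, Pends C p D t g) →
      Keep H C p D a₀ (t + 1) ∧ (∀ g, Pends C p D (t + 1) g) :=
    fun h => ⟨h.1.trans (E.keep fun _ => .inr (h.2 _)), fun g => E.pends (h.2 g)⟩
  have ha := (pend_of E.before g).trans E.pend
  cases call with
  | none => exact gen hP
  | some f =>
    cases k with
    | done r => exact hP
    | setOp _ _ => exact hP
    | getOp _ => exact hP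
    | ecrecover _ _ _ => exact gen hP
    | ecdetect _ _ => exact gen hP
    | ecll x g₀ k =>
      obtain ⟨h₁, h₂, res, h₃, h₄⟩ := hP
      by_cases hg : g = g₀
      · subst hg
        rw [ha, Option.some.injEq] at h₃
        obtain ⟨s, rfl, hs, hd⟩ := E.ll _ _ h₃
        refine ⟨h₁.trans (E.keep fun _ => .inl hd), fun g' hg => E.pends (h₂ g' hg), _,
          E.pend_self, fun s' hs' => ⟨t, ha₀, by omega, ?_⟩⟩
        rw [hs, hs']
      · refine ⟨h₁.trans (E.keep fun e => .inr (h₂ _ (e ▸ hg))), fun g' hg => E.pends (h₂ g' hg),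
          res, (E.pend_other (Ne.symm hg)).trans h₃, fun s hs => ?_⟩
        obtain ⟨a', h, h', h''⟩ := h₄ s hs
        exact ⟨a', h, by omega, h''⟩
    | ecsc x g₀ s v b k =>
      obtain ⟨h₁, h₁', h₂, res, h₃, h₄, h₅⟩ := hP
      by_cases hg : g = g₀
      · subst hg
        rw [ha, Option.some.injEq] at h₃
        obtain ⟨hres, r, rfl, hr, hd⟩ := E.sc _ _ _ _ _ h₃
        refine ⟨E.tag_eq.trans h₁, h₁'.trans E.busy, fun g' hg => E.pends (h₂ g' hg), _,
          E.pend_self, fun s' hs' => ⟨t, ha₀, by omega, ?_⟩, fun h h' => ?_⟩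
        · cases hs'; exact hr
        · have h6 : det C p .critical t = det C p .critical a₀ := by
            refine h₅ ?_ h'
            rintro ⟨rfl, rfl⟩
            cases hres
          rw [← h6]
          by_cases hc : g = .critical
          · subst hc
            refine E.det_self (hd ?_)
            simpa using h
          · exact E.det_other (Ne.symm hc)
      · have hK := E.keep (D := D) fun e => .inr (h₂ _ (e ▸ hg))
        refine ⟨E.tag_eq.trans h₁, h₁'.trans E.busy, fun g' hg => E.pends (h₂ g' hg),
          res, (E.pend_other (Ne.symm hg)).trans h₃, fun s hs => ?_,
          fun h h' => (hK.det h').trans (h₅ h h')⟩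
        obtain ⟨a', h, h', h''⟩ := h₄ s hs
        exact ⟨a', h, by omega, h''⟩

theorem inv (E : Effect H C p t h g d a a') (I : Inv H C t p)
    (hec : ∀ x, (C t).ec x ≠ none → (C (t + 1)).ec x ≠ none)
    (hc : (C (t + 1)).ctl p = (C t).ctl p) : Inv H C (t + 1) p := by
  have ha := (pend_of E.before g).trans E.pend
  refine I.next E.busy (by simp [E.label]) hec (by rw [hc]) (by simp [E.after]) ?_ ?_ ?_
  · intro g' b hb
    by_cases hg : g' = g
    · subst hg
      obtain rfl : a' = b := by rw [E.pend_self] at hb; simpa using hb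
      exact .inl ⟨a, ha, E.target.symm, fun _ => E.tag_eq⟩
    · exact .inl ⟨b, E.pend_other hg ▸ hb, rfl, fun _ => E.tag_eq⟩
  · intro g' x s v b hp
    by_cases hg : g' = g
    · subst hg
      rw [E.pend_self, Option.some.injEq] at hp
      exfalso
      cases a with
      | ll x' res =>
        obtain ⟨s, h₁, -⟩ := E.ll _ _ rfl
        rw [h₁] at hp
        cases hp
      | sc x' s' v' b' res =>
        obtain ⟨-, r, h₁, -⟩ := E.sc _ _ _ _ _ rfl
        rw [h₁] at hp
        cases hp
    · refine .inl ⟨E.pend_other hg ▸ hp, fun e => ⟨E.tag_eq, ?_⟩⟩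
      subst e
      exact E.det_other hg
  · intro x k call hk
    obtain ⟨D, Post, a₀, h₁, h₂, h₃, h₄⟩ := I.run x k call (hc ▸ hk)
    exact ⟨D, Post, a₀, h₁.next E.busy, by omega, h₃, E.progress h₂ h₄⟩

end Effect

/-- The invariant after a step of `p` in which the operation pending through `g` and the control
state change. -/
theorem Inv.setPend (I : Inv H C t p) (hl : H[t]? = some (.tau p))
    (hec : ∀ x, (C t).ec x ≠ none → (C (t + 1)).ec x ≠ none) {h : Handle V Obj} {g : Role}
    {a : Option (Pending V Obj)} (hn : (C t).hnd p = some h)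
    (hn' : (C (t + 1)).hnd p = some (h.setPend g a)) {x : Option Obj} {k k' : Prog V Obj}
    {call call' : Option ℕ} (hc : (C t).ctl p = .running x k call)
    (hc' : (C (t + 1)).ctl p = .running x k' call')
    (ha : ∀ b, a = some b → (h.ec g).pend = some b ∨ (x = some b.target.1 ∧
      (g = .critical → tag C p t = some b.target.2.tag) ∧
      ∀ y s v e, b = .sc y s v e none → GuardOK H C p t g y s v e))
    (hrun : Busy H p t (t + 1) → pend C p g (t + 1) = a →
      (∀ g', g' ≠ g → pend C p g' (t + 1) = pend C p g' t) →
      (∀ g', det C p g' (t + 1) = det C p g' t) → tag C p (t + 1) = tag C p t →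
      ∀ D Post a₀, a₀ ≤ t → OK H C p x Post k D a₀ → Progress H C p D a₀ t call k →
        ∃ D' a₁, a₁ ≤ t + 1 ∧ OK H C p x Post k' D' a₁ ∧
          Progress H C p D' a₁ (t + 1) call' k') :
    Inv H C (t + 1) p := by
  have hb : Busy H p t (t + 1) := busy_of_label hl (by simp) (by simp)
  have hp : pend C p g (t + 1) = a := by
    rw [pend_of hn', Handle.setPend, Handle.setEC_ec, if_pos rfl]
  have hp' : ∀ g', g' ≠ g → pend C p g' (t + 1) = pend C p g' t := fun g' hg => by
    rw [pend_of hn', pend_of hn, Handle.setPend, Handle.setEC_ec, if_neg hg]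
  have hd : ∀ g', det C p g' (t + 1) = det C p g' t := fun g' => by
    rw [det_of hn', det_of hn, Handle.setPend, Handle.setEC_ec]
    split_ifs with e
    · rw [e]
    · rfl
  have ht : tag C p (t + 1) = tag C p t := by rw [tag_of hn', tag_of hn]; rfl
  refine I.next hb (by simp [hl]) hec (by rw [hc, hc']; rfl) (by simp [hn']) ?_ ?_ ?_
  · intro g' b hg'
    by_cases hg : g' = g
    · subst hg
      rw [hp] at hg'
      rcases ha b hg' with h₁ | ⟨h₁, h₂, -⟩
      · exact .inl ⟨b, (pend_of hn _).trans h₁, rfl, fun _ => ht⟩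
      · exact .inr ⟨by rw [hc]; exact h₁, by rw [ht]; exact h₂⟩
    · exact .inl ⟨b, hp' _ hg ▸ hg', rfl, fun _ => ht⟩
  · intro g' y s v b hg'
    by_cases hg : g' = g
    · subst hg
      rw [hp] at hg'
      rcases ha _ hg' with h₁ | ⟨-, -, h₃⟩
      · exact .inl ⟨(pend_of hn _).trans h₁, fun _ => ⟨ht, hd _⟩⟩
      · exact .inr ((h₃ _ _ _ _ rfl).next hb fun _ => ⟨ht, hd _⟩)
    · exact .inl ⟨hp' _ hg ▸ hg', fun _ => ⟨ht, hd _⟩⟩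
  · intro y m ca hy
    rw [hc'] at hy
    cases hy
    obtain ⟨D, Post, a₀, h₁, h₂, h₃, h₄⟩ := I.run _ _ _ hc
    obtain ⟨D', a₁, h₅, h₆, h₇⟩ := hrun hb hp hp' hd ht D Post a₀ h₂ h₃ h₄
    exact ⟨D', Post, a₁, h₁.next hb, h₅, h₆, h₇⟩

end Preservation

/-! ### The invariant holds throughout every run. -/

section InvariantHolds

set_option linter.unusedSectionVars false

variable {V : Type u} {Obj : Type v} {P : Type w}
  {H : List (Label V Obj P)} {C : ℕ → Config V Obj P} {p : P} {t : ℕ}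
  [DecidableEq V] [DecidableEq Obj] [DecidableEq P]

theorem Inv.pend_eq_none (I : Inv H C t p) (hc : ((C t).ctl p).obj = none) (g : Role) :
    pend C p g t = none := by
  cases h : pend C p g t with
  | none => rfl
  | some a =>
    have := (I.targets g a h).1
    rw [hc] at this
    cases this

theorem Inv.ctl_of_hnd (I : Inv H C t p) (hn : (C t).hnd p = none) : (C t).ctl p = .idle := by
  by_contra h
  exact I.hnd h hn

/-- The invariant after the invocation of a method. -/
theorem Inv.start (I : Inv H C t p) {l : Label V Obj P} (hl : H[t]? = some l)
    (hl₁ : ∀ r, l ≠ .ret p r) (hl₂ : l ≠ .recRet p)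
    (hec : ∀ x, (C t).ec x ≠ none → (C (t + 1)).ec x ≠ none)
    (hn : (C (t + 1)).hnd p = (C t).hnd p) (hh : (C t).hnd p ≠ none) {x : Option Obj}
    {k : Prog V Obj} (hc' : (C (t + 1)).ctl p = .running x k none)
    (hx : ∀ o, x = some o → ∀ c, (C t).ec (o, c) ≠ none)
    (hc : ((C t).ctl p).obj = none ∨ ((C t).ctl p).obj = x)
    (hinv : ∀ o op, l = .inv p o op → x = some o)
    {D : Role → Cell → Prop} {Post : Out V → ℕ → Prop} (hm : Mode H C p (t + 1) x Post)
    (hok : OK H C p x Post k D (t + 1)) (hD : ∀ g, Pends C p D t g) : Inv H C (t + 1) p := by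
  have hb : Busy H p t (t + 1) := busy_of_label hl hl₁ hl₂
  have hp : ∀ g, pend C p g (t + 1) = pend C p g t := fun g => by simp [pend, hn]
  have hd : ∀ g, det C p g (t + 1) = det C p g t := fun g => by simp [det, hn]
  have ht : tag C p (t + 1) = tag C p t := by simp [tag, hn]
  refine ⟨fun _ => hn ▸ hh, ?_, ?_, ?_, ?_, ?_⟩
  · rw [hc']
    exact fun o ho c => hec _ (hx o ho c)
  · intro g a ha
    rw [hp] at ha
    obtain ⟨h₁, h₂⟩ := I.targets g a ha
    rw [hc', ht]
    refine ⟨?_, h₂⟩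
    rcases hc with h | h
    · rw [h₁] at h; cases h
    · exact h.symm.trans h₁
  · intro i o op hi ho
    rw [hc']
    rcases (show i < t ∨ i = t by have := ho.1; omega) with h | rfl
    · have h₁ := I.opened i o op hi (ho.of_le h (by omega))
      rcases hc with h | h
      · rw [h₁] at h; cases h
      · exact h.symm.trans h₁
    · rw [hl, Option.some.injEq] at hi
      exact hinv _ _ hi
  · intro g y s v b h
    exact (I.guard g y s v b (hp g ▸ h)).next hb fun _ => ⟨ht, hd _⟩
  · intro y m ca hy
    rw [hc'] at hy
    cases hy
    exact ⟨D, Post, t + 1, hm, le_rfl, hok, Progress.of_keep (Keep.refl _)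
      fun g => (hD g).of_eq (hp g)⟩

/-- `OK` at `done` forces `D` to be empty, so nothing is pending any more. No operation stays open
either: a response or a finished recovery closes it, and `detect` runs on no object, whereas an open
operation binds its process to one. -/
theorem Inv.finish (I : Inv H C t p) {r : Out V} (hl : H[t]? = some (r.label p))
    (hn : (C (t + 1)).hnd p = (C t).hnd p) {x : Option Obj}
    (hc : (C t).ctl p = .running x (.done r) none) (hc' : (C (t + 1)).ctl p = .idle) :
    Inv H C (t + 1) p := by
  obtain ⟨D, Post, a, h₁, h₂, ⟨h₃, h₃'⟩, h₄⟩ := I.run _ _ _ hc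
  have hp : ∀ g, pend C p g (t + 1) = none := fun g => by
    have : pend C p g (t + 1) = pend C p g t := by simp [pend, hn]
    rw [this]
    exact h₄.free (h₃ g)
  refine ⟨by simp [hc'], by simp [hc', Ctl.obj], by simp [hp], ?_, by simp [hp], by simp [hc']⟩
  intro i o op hi ho
  exfalso
  have ho' : Open H p i t := ho.of_succ hi (by rw [hl]; cases r <;> simp [Out.label])
  have h₅ := ho.2 t ho'.1 (by omega)
  rw [hl] at h₅
  cases r with
  | resp r => exact h₅.1 r rfl
  | recovered => exact h₅.2 rfl
  | detected d r =>
    have h₆ := I.opened i o op hi ho'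
    rw [hc] at h₆
    rcases h₁ with ⟨i, o, op, -, -, -, rfl⟩ | ⟨o, -, rfl⟩ | ⟨rfl, rfl⟩
    · cases op <;> simp [OpPost] at h₃'
    · simp [RecPost] at h₃'
    · cases h₆

/-- The invariant ties `op` only to what is pending through the critical handle, and `OK` demands
that this handle be free when `op` is overwritten. -/
theorem Inv.setOp (I : Inv H C t p) (hl : H[t]? = some (.tau p))
    (hec : ∀ x, (C t).ec x ≠ none → (C (t + 1)).ec x ≠ none) {h : Handle V Obj} {τ : Tag}
    (hn : (C t).hnd p = some h) (hn' : (C (t + 1)).hnd p = some { h with op := τ })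
    {x : Option Obj} {k : Prog V Obj} (hc : (C t).ctl p = .running x (.setOp τ k) none)
    (hc' : (C (t + 1)).ctl p = .running x k none) : Inv H C (t + 1) p := by
  have hb : Busy H p t (t + 1) := busy_of_label hl (by simp) (by simp)
  have hp : ∀ g, pend C p g (t + 1) = pend C p g t := fun g => by
    rw [pend_of hn', pend_of hn]
  have hd : ∀ g, det C p g (t + 1) = det C p g t := fun g => by
    rw [det_of hn', det_of hn]
  have ht : tag C p (t + 1) = some τ := tag_of hn'
  obtain ⟨D, Post, a, h₁, h₂, ⟨h₃, -, h₃'⟩, h₄⟩ := I.run _ _ _ hc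
  have hp' : pend C p .critical t = none := h₄.free h₃
  have hg : ∀ {g b}, pend C p g t = some b → g ≠ .critical := by
    rintro g b hb rfl
    rw [hp'] at hb
    cases hb
  refine I.next hb (by simp [hl]) hec (by rw [hc, hc']; rfl) (by simp [hn']) ?_ ?_ ?_
  · intro g b hb
    rw [hp] at hb
    exact .inl ⟨b, hb, rfl, fun e => absurd e (hg hb)⟩
  · intro g y s v b hb
    rw [hp] at hb
    exact .inl ⟨hb, fun e => absurd e (hg hb)⟩
  · intro y m ca hy
    rw [hc'] at hy
    cases hy
    exact ⟨D, Post, t + 1, h₁.next hb, le_rfl,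
      h₃' _ (by omega) ht (h₄.keep.1.busy.trans hb) ((hd _).trans (h₄.keep.1.det h₃)),
      Progress.of_keep (Keep.refl _) fun g => (h₄.keep.2 g).of_eq (hp g)⟩

/-- The invariant is preserved by the steps of `p` itself. -/
theorem Inv.step {T : ℕ} (I : Inv H C t p) {l : Label V Obj P} (hl : H[t]? = some l)
    (hs : Step T (C t) l (C (t + 1))) (hproc : l.proc = some p) : Inv H C (t + 1) p := by
  have hec := hs.ec_ne_none
  generalize hC : C (t + 1) = c' at hs
  cases hs with
  | newObj o v w₀ sW sZ fresh => simp [Label.proc] at hproc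
  | newHandle q d τ fresh =>
    obtain rfl : q = p := by simpa [Label.proc] using hproc
    have hc := I.ctl_of_hnd fresh
    have hc' : (C (t + 1)).ctl q = .idle := by simp [hC, Config.setHnd, hc]
    have hp : ∀ g, pend C q g (t + 1) = none := by simp [pend, hC, Config.setHnd]
    refine ⟨by simp [hc'], by simp [hc', Ctl.obj], by simp [hp], ?_, by simp [hp], by simp [hc']⟩
    intro i o op hi ho
    have := I.opened i o op hi (ho.of_succ hi (by simp [hl]))
    rw [hc] at this
    cases this
  | inv q o op idle hh ho =>
    obtain rfl : q = p := by simpa [Label.proc] using hproc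
    refine I.start hl (by simp) (by simp) hec (by simp [hC, Config.setCtl]) hh (x := some o)
      (k := op.code o) (by simp [hC, Config.setCtl]) (by rintro _ ⟨⟩; exact ho)
      (.inl (by simp [idle, Ctl.obj])) (by rintro _ _ ⟨⟩; rfl)
      (.inl ⟨t, o, op, rfl, hl, ⟨by omega, Busy.refl _⟩, rfl⟩) (ok_code hl) ?_
    intro g a ha
    rw [I.pend_eq_none (by simp [idle, Ctl.obj])] at ha
    cases ha
  | recInv q o ready hh ho =>
    obtain rfl : q = p := by simpa [Label.proc] using hproc
    obtain ⟨h, hn⟩ := Option.ne_none_iff_exists'.1 hh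
    have hn' : (C (t + 1)).hnd q = (C t).hnd q := by simp [hC, Config.setCtl]
    refine I.start hl (by simp) (by simp) hec hn' hh (x := some o)
      (k := recoverCode o) (by simp [hC, Config.setCtl]) (by rintro _ ⟨⟩; exact ho)
      ?_ (by simp) (.inr (.inl ⟨o, rfl, rfl⟩))
      (ok_recoverCode (τ := h.op) (tag_of (hn'.trans hn))) ?_
    · rcases ready with h | h <;> simp [h, Ctl.obj]
    -- An operation left pending through the critical handle is on the cell that `op` names. This is
    -- the reason for the clause `targets` of the invariant and for the form of `dirty`.
    · intro g a ha
      have h₁ := (I.targets g a ha).2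
      rw [tag_of hn] at h₁
      cases g with
      | critical => simpa [dirty, eq_comm] using h₁
      | casual => trivial
  | detInv q idle hh =>
    obtain rfl : q = p := by simpa [Label.proc] using hproc
    refine I.start hl (by simp) (by simp) hec (by simp [hC, Config.setCtl]) hh (x := none)
      (k := detectCode) (by simp [hC, Config.setCtl]) (by simp)
      (.inl (by simp [idle, Ctl.obj])) (by simp) (.inr (.inr ⟨rfl, rfl⟩)) ok_detectCode ?_
    intro g a ha
    rw [I.pend_eq_none (by simp [idle, Ctl.obj])] at ha
    cases ha
  | finish q x r hc =>
    obtain rfl : q = p := by cases r <;> simpa [Label.proc, Out.label] using hproc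
    exact I.finish hl (by simp [hC, Config.setCtl]) hc (by simp [hC, Config.setCtl])
  | crash q =>
    obtain rfl : q = p := by simpa [Label.proc] using hproc
    have hn : (C (t + 1)).hnd q = (C t).hnd q := by simp [hC, Config.setCtl]
    have hc' : (C (t + 1)).ctl q = ((C t).ctl q).crash := by simp [hC, Config.setCtl]
    have hp : ∀ g, pend C q g (t + 1) = pend C q g t := fun g => by simp [pend, hn]
    have hd : ∀ g, det C q g (t + 1) = det C q g t := fun g => by simp [det, hn]
    have ht : tag C q (t + 1) = tag C q t := by simp [tag, hn]
    refine I.next (busy_of_label hl (by simp) (by simp)) (by simp [hl]) hec ?_ ?_ ?_ ?_ ?_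
    · rw [hc']
      rcases (C t).ctl q with _ | _ | ⟨_ | _, _, _⟩ <;> rfl
    · rw [hc', hn]
      intro h
      refine I.hnd fun e => h ?_
      rw [e]; rfl
    · exact fun g a ha => .inl ⟨a, hp g ▸ ha, rfl, fun _ => ht⟩
    · exact fun g x s v b h => .inl ⟨hp g ▸ h, fun _ => ⟨ht, hd _⟩⟩
    · intro x k call h
      rw [hc'] at h
      rcases hk : (C t).ctl q with _ | _ | ⟨_ | _, _, _⟩ <;> rw [hk] at h <;> cases h
  | setOp q x a k h hc hh =>
    obtain rfl : q = p := by simpa [Label.proc] using hproc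
    exact I.setOp hl hec hh (by simp [hC, Config.setCtl, Config.setHnd]) hc
      (by simp [hC, Config.setCtl])
  | getOp q x k h hc hh =>
    obtain rfl : q = p := by simpa [Label.proc] using hproc
    refine I.advance hl hec (by simp [hC, Config.setCtl]) hc (k' := k h.op) (call' := none)
      (by simp [hC, Config.setCtl]) ?_
    intro D Post a h₂ h₃ h₄
    have h₅ : tag C q a = some h.op := by
      rw [← h₄.keep.1.tag]
      exact tag_of (by simp [hC, Config.setCtl, hh])
    exact ⟨t + 1, le_rfl, h₃ (t + 1) _ (by omega) h₅ h₄.keep.1,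
      Progress.of_keep (Keep.refl _) h₄.keep.2⟩
  | work q x k f hc =>
    obtain rfl : q = p := by simpa [Label.proc] using hproc
    refine I.advance hl hec (by simp [hC, Config.setCtl]) hc (k' := k) (call' := some f)
      (by simp [hC, Config.setCtl]) ?_
    intro D Post a h₂ h₃ h₄
    exact ⟨a, by omega, h₃, by cases k <;> exact h₄⟩
  | llInv q x y g k h hc hh free =>
    obtain rfl : q = p := by simpa [Label.proc] using hproc
    obtain ⟨D, Post, a, h₁, h₂, ⟨⟨h₃, h₃', h₃''⟩, -⟩, h₄⟩ := I.run _ _ _ hc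
    refine I.setPend hl hec hh (g := g) (a := some (.ll y none))
      (by simp [hC, Config.setCtl, Config.setHnd]) hc (k' := .ecll y g k) (call' := some T)
      (by simp [hC, Config.setCtl]) ?_ ?_
    · rintro b ⟨⟩
      exact .inr ⟨h₃, fun e => h₄.keep.1.tag.trans (h₃'' e), by simp⟩
    · intro hb hp hp' hd ht D Post a h₂ h₃ h₄
      exact ⟨D, a, by omega, h₃, h₄.keep.1.trans ⟨ht, hb, fun _ => hd _⟩,
        fun g' hg => (h₄.keep.2 g').of_eq (hp' g' hg), none, hp, by simp⟩
  | llEffect q x g h s hh hp hs =>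
    obtain rfl : q = p := by simpa [Label.proc] using hproc
    refine Effect.inv (h := h) (g := g) (d := (h.ec g).det) (a := .ll x none)
      (a' := .ll x (some s)) ⟨hl, hh, ?_, hp, rfl, ?_, by simp⟩ I hec ?_
    · simp [hC, Config.setHnd, Handle.setPend]
    · rintro _ _ ⟨⟩
      exact ⟨s, rfl, hs, rfl⟩
    · simp [hC, Config.setHnd]
  | llRet q x y g k f h s hc hh hp =>
    obtain rfl : q = p := by simpa [Label.proc] using hproc
    refine I.setPend hl hec hh (g := g) (a := none)
      (by simp [hC, Config.setCtl, Config.setHnd]) hc (k' := k s) (call' := none)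
      (by simp [hC, Config.setCtl]) (by simp) ?_
    intro hb hp₀ hp' hd ht D Post a h₂ h₃ h₄
    obtain ⟨h₅, h₆, res, h₇, h₈⟩ := h₄
    rw [pend_of hh, hp, Option.some.injEq] at h₇
    cases h₇
    obtain ⟨a', h₉, h₁₀, h₁₁⟩ := h₈ s rfl
    refine ⟨D, t + 1, le_rfl, h₃.2 a' (t + 1) s h₉ (by omega) h₁₁
      (h₅.trans ⟨ht, hb, fun _ => hd _⟩), Progress.of_keep (Keep.refl _) fun g' => ?_⟩
    by_cases hg : g' = g
    · subst hg
      intro b hb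
      rw [hp₀] at hb
      cases hb
    · exact (h₆ g' hg).of_eq (hp' g' hg)
  | scInv q x y g s v b k h hc hh free =>
    obtain rfl : q = p := by simpa [Label.proc] using hproc
    obtain ⟨D, Post, a, h₁, h₂, ⟨⟨h₃, h₃', h₃''⟩, hG, -⟩, h₄⟩ := I.run _ _ _ hc
    refine I.setPend hl hec hh (g := g) (a := some (.sc y s v b none))
      (by simp [hC, Config.setCtl, Config.setHnd]) hc (k' := .ecsc y g s v b k) (call' := some T)
      (by simp [hC, Config.setCtl]) ?_ ?_
    · rintro b ⟨⟩
      refine .inr ⟨h₃, fun e => h₄.keep.1.tag.trans (h₃'' e), ?_⟩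
      rintro _ _ _ _ ⟨⟩
      exact ⟨a, h₂, hG, h₄.keep.1.busy, fun e => ⟨h₄.keep.1.tag, h₄.keep.1.det (e ▸ h₃')⟩⟩
    · intro hb hp hp' hd ht D Post a h₂ h₃ h₄
      have hK := h₄.keep.1.trans ⟨ht, hb, fun _ => hd _⟩
      exact ⟨D, a, by omega, h₃, hK.tag, hK.busy,
        fun g' hg => (h₄.keep.2 g').of_eq (hp' g' hg), none, hp, by simp, fun _ => hK.det⟩
  | scSuccess q x g s v b h y seq' det' hh hp hy hseq hseq' hdet' =>
    obtain rfl : q = p := by simpa [Label.proc] using hproc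
    have hn' : (C (t + 1)).hnd q = some (h.setEC g ⟨det', some (.sc x s v b (some true))⟩) := by
      simp [hC, Config.setHnd]
    refine Effect.inv (h := h) (g := g) (d := det') (a := .sc x s v b none)
      (a' := .sc x s v b (some true)) ⟨hl, hh, hn', hp, rfl, by simp, ?_⟩ I hec ?_
    · rintro _ _ _ _ _ ⟨⟩
      refine ⟨rfl, true, rfl, .inl ⟨rfl, hl, (pend_of hh _).trans hp,
        ⟨y, seq', hy, hseq, hseq ▸ hseq', ?_⟩, ?_, ?_, ?_⟩, by simp⟩
      · simp [hC, Config.setHnd, Config.setEC]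
      · intro x' hx
        simp [hC, Config.setHnd, Config.setEC, hx]
      · rw [det_of hh, det_of hn', Handle.setEC_ec, if_pos rfl]
        exact hdet'
      · intro g' hg
        rw [det_of hh, det_of hn', Handle.setEC_ec, if_neg hg]
    · simp [hC, Config.setHnd, Config.setEC]
  | scFailure q x g s v b h y hh hp hy hseq =>
    obtain rfl : q = p := by simpa [Label.proc] using hproc
    refine Effect.inv (h := h) (g := g) (d := (h.ec g).det) (a := .sc x s v b none)
      (a' := .sc x s v b (some false)) ⟨hl, hh, ?_, hp, rfl, by simp, ?_⟩ I hec ?_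
    · simp [hC, Config.setHnd, Handle.setPend]
    · rintro _ _ _ _ _ ⟨⟩
      exact ⟨rfl, false, rfl, .inr ⟨rfl, y, hy, hseq⟩, fun _ => rfl⟩
    · simp [hC, Config.setHnd]
  | scRet q x y g s v b k f h r hc hh hp =>
    obtain rfl : q = p := by simpa [Label.proc] using hproc
    refine I.setPend hl hec hh (g := g) (a := none)
      (by simp [hC, Config.setCtl, Config.setHnd]) hc (k' := k r) (call' := none)
      (by simp [hC, Config.setCtl]) (by simp) ?_
    intro hb hp₀ hp' hd ht D Post a h₂ h₃ h₄
    obtain ⟨h₅, h₅', h₆, res, h₇, h₈, h₉⟩ := h₄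
    rw [pend_of hh, hp, Option.some.injEq] at h₇
    cases h₇
    obtain ⟨a', h₁₀, h₁₁, h₁₂⟩ := h₈ r rfl
    refine ⟨D, t + 1, le_rfl, h₃.2.2 a' (t + 1) r h₁₀ (by omega) h₁₂ (ht.trans h₅)
      (h₅'.trans hb) ?_, Progress.of_keep (Keep.refl _) fun g' => ?_⟩
    · intro hr hD
      rw [hd]
      refine h₉ ?_ hD
      simpa using hr
    by_cases hg : g' = g
    · subst hg
      intro b hb
      rw [hp₀] at hb
      cases hb
    · exact (h₆ g' hg).of_eq (hp' g' hg)
  | ecrecoverInv q x y g k hc =>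
    obtain rfl : q = p := by simpa [Label.proc] using hproc
    refine I.advance hl hec (by simp [hC, Config.setCtl]) hc (k' := .ecrecover y g k)
      (call' := some T) (by simp [hC, Config.setCtl]) ?_
    intro D Post a h₂ h₃ h₄
    exact ⟨a, by omega, h₃, h₄⟩
  | ecrecoverRet q x y g k f h hc hh =>
    obtain rfl : q = p := by simpa [Label.proc] using hproc
    refine I.setPend hl hec hh (g := g)
      (a := (h.ec g).pend.filter fun a => a.target ≠ y)
      (by simp [hC, Config.setCtl, Config.setHnd]) hc (k' := k) (call' := none)
      (by simp [hC, Config.setCtl]) ?_ ?_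
    · intro b hb
      rw [Option.filter_eq_some_iff] at hb
      exact .inl hb.1
    · intro hb hp₀ hp' hd ht D Post a h₂ h₃ h₄
      refine ⟨_, t + 1, le_rfl, h₃.2 (t + 1) (by omega) (h₄.1.trans ⟨ht, hb, fun _ => hd _⟩),
        Progress.of_keep (Keep.refl _) fun g' b hb' => ?_⟩
      by_cases hg : g' = g
      · subst hg
        rw [hp₀, Option.filter_eq_some_iff] at hb'
        have hb₀ := (pend_of hh g').trans hb'.1
        -- The filter removes only an operation on `y`. Whatever is pending belongs to the object of
        -- the running method, so equality of the cells already gives equality with `y`.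
        refine ⟨h₄.2 g' b hb₀, fun e => ?_⟩
        have h₅ := (I.targets g' b hb₀).1
        rw [hc] at h₅
        have h₆ := h₃.1.symm.trans h₅
        simp only [Option.some.injEq] at h₆
        have h₇ := hb'.2
        simp only [ne_eq, decide_eq_true_eq] at h₇
        exact h₇ (Prod.ext h₆.symm e.2)
      · rw [hp' g' hg] at hb'
        exact ⟨h₄.2 g' b hb', fun e => hg e.1⟩
  | ecdetectInv q x g k h hc hh free =>
    obtain rfl : q = p := by simpa [Label.proc] using hproc
    refine I.advance hl hec (by simp [hC, Config.setCtl]) hc (k' := .ecdetect g k)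
      (call' := some T) (by simp [hC, Config.setCtl]) ?_
    intro D Post a h₂ h₃ h₄
    exact ⟨a, by omega, h₃, h₄⟩
  | ecdetectRet q x g k f h hc hh =>
    obtain rfl : q = p := by simpa [Label.proc] using hproc
    refine I.advance hl hec (by simp [hC, Config.setCtl]) hc (k' := k (h.ec g).det)
      (call' := none) (by simp [hC, Config.setCtl]) ?_
    rintro D Post a h₂ ⟨rfl, h₃, h₃'⟩ h₄
    have h₅ : det C q .critical (t + 1) = (h.ec .critical).det :=
      det_of (by simp [hC, Config.setCtl, hh]) _
    refine ⟨t + 1, le_rfl, ?_, Progress.of_keep (Keep.refl _) h₄.2⟩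
    rw [← h₅]
    exact h₃' (t + 1) (by omega) h₄.1

theorem Trace.inv {T : ℕ} (tr : Trace T H C) (t : ℕ) (p : P) : Inv H C t p := by
  induction t with
  | zero =>
    refine ⟨?_, ?_, ?_, ?_, ?_, ?_⟩ <;> simp [tr.init, Config.init, pend, Open, Ctl.obj]
  | succ t ih =>
    cases hl : H[t]? with
    | none =>
      have hC := tr.stay t hl
      exact ih.frame (fun k h h' => by simp [show k = t by omega, hl]) (by simp [hl])
        (by simp [hC]) (by rw [hC]) (by rw [hC])
    | some l =>
      have hs := tr.step t l hl
      by_cases hp : l.proc = some p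
      · exact ih.step hl hs hp
      · obtain ⟨h₁, h₂⟩ := hs.frame hp
        refine ih.frame (busy_of_label hl ?_ ?_) ?_ hs.ec_ne_none h₁ h₂
        · rintro r rfl; exact hp rfl
        · rintro rfl; exact hp rfl
        · rintro o op h
          rw [hl, Option.some.injEq] at h
          subst h; exact hp rfl

end InvariantHolds

/-! ### The protocol of the cells `Z` and `W`, abstracted from processes. -/

section Protocol

variable {V : Type u}

/-- A complete `transfer-write` in `[a, b]`, if `z` and `w` are the states of `Z` and `W`. -/
def Done (z w : ℕ → ECState V) (a b : ℕ) : Prop :=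
  ∃ t₀ t₁, a ≤ t₀ ∧ t₀ ≤ t₁ ∧ t₁ ≤ b ∧
    ((z t₀).bit = (w t₁).bit ∨ ∃ t₂, t₁ ≤ t₂ ∧ t₂ < b ∧
      ((z t₂).seq ≠ (z t₀).seq ∨ (z t₂).seq < (z (t₂ + 1)).seq))

/-- The protocol followed by the states `z` and `w` of the cells `Z` and `W` of an object created
at time `c₀`; at the times in `tr` a write is transferred to `Z`, at the times in `cs` a CAS
changes `Z`, and at the times in `wr` a write changes `W`. -/
structure Protocol (z w : ℕ → ECState V) (c₀ : ℕ) (tr cs wr : ℕ → Prop) : Prop where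
  bits : (z c₀).bit = (w c₀).bit
  z_step : ∀ t, c₀ ≤ t → z (t + 1) = z t ∨ tr t ∨ cs t
  w_step : ∀ t, c₀ ≤ t → w (t + 1) = w t ∨ wr t
  tr_spec : ∀ t, c₀ ≤ t → tr t → w (t + 1) = w t ∧ (z t).seq < (z (t + 1)).seq ∧
    ∃ t₀ t₁, c₀ ≤ t₀ ∧ t₀ ≤ t₁ ∧ t₁ ≤ t ∧ (z t₀).seq = (z t).seq ∧ (z t₀).bit ≠ (w t₁).bit ∧
      (z (t + 1)).val = (w t₁).val ∧ (z (t + 1)).bit = (w t₁).bit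
  cs_spec : ∀ t, c₀ ≤ t → cs t → w (t + 1) = w t ∧ (z t).seq < (z (t + 1)).seq ∧
    ∃ t₀, c₀ ≤ t₀ ∧ t₀ ≤ t ∧ (z t₀).seq = (z t).seq ∧ (z (t + 1)).bit = (z t₀).bit ∧
      (z (t + 1)).val ≠ (z t₀).val ∧ Done z w t₀ t
  wr_spec : ∀ t, c₀ ≤ t → wr t → z (t + 1) = z t ∧ (w t).seq < (w (t + 1)).seq ∧
    ∃ t₀ t₁, c₀ ≤ t₀ ∧ t₀ ≤ t₁ ∧ t₁ ≤ t ∧ (w t₀).seq = (w t).seq ∧ (z t₁).bit = (w t₀).bit ∧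
      (z t₁).val ≠ (w (t + 1)).val ∧ (w (t + 1)).bit = !(w t₀).bit

/-- A sequence of states whose sequence numbers increase at every change. -/
theorem const_of_seq_eq {z : ℕ → ECState V} {c₀ : ℕ}
    (h : ∀ t, c₀ ≤ t → z (t + 1) = z t ∨ (z t).seq < (z (t + 1)).seq) {a b : ℕ} (ha : c₀ ≤ a)
    (hab : a ≤ b) : (z a).seq ≤ (z b).seq ∧
      ((z a).seq = (z b).seq → ∀ u, a ≤ u → u ≤ b → z u = z a) := by
  induction b, hab using Nat.le_induction with
  | base => exact ⟨le_rfl, fun _ u h h' => by rw [le_antisymm h h']⟩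
  | succ b hb ih =>
    rcases h b (by omega) with e | e
    · rw [e]
      refine ⟨ih.1, fun h₁ u h₂ h₃ => ?_⟩
      rcases (show u ≤ b ∨ u = b + 1 by omega) with h₄ | rfl
      · exact ih.2 h₁ u h₂ h₄
      · rw [e]; exact ih.2 h₁ b hb le_rfl
    · exact ⟨by omega, fun h₁ => by omega⟩

namespace Protocol

variable {z w : ℕ → ECState V} {c₀ : ℕ} {tr cs wr : ℕ → Prop} (hP : Protocol z w c₀ tr cs wr)

include hP

theorem z_lt {t : ℕ} (ht : c₀ ≤ t) (h : tr t ∨ cs t) : (z t).seq < (z (t + 1)).seq :=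
  h.elim (fun h => (hP.tr_spec t ht h).2.1) fun h => (hP.cs_spec t ht h).2.1

/-- Sequence numbers grow at each change and never return, so equal numbers at the ends exclude
changes in between: there is no ABA problem. -/
theorem z_const {a b : ℕ} (ha : c₀ ≤ a) (hab : a ≤ b) (h : (z a).seq = (z b).seq) :
    ∀ u, a ≤ u → u ≤ b → z u = z a :=
  (const_of_seq_eq (z := z) (fun t ht => (hP.z_step t ht).imp_right fun h => hP.z_lt ht h) ha hab).2 h

theorem w_const {a b : ℕ} (ha : c₀ ≤ a) (hab : a ≤ b) (h : (w a).seq = (w b).seq) :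
    ∀ u, a ≤ u → u ≤ b → w u = w a :=
  (const_of_seq_eq (z := w) (fun t ht => (hP.w_step t ht).imp_right fun h => (hP.wr_spec t ht h).2.1)
    ha hab).2 h

/-- The bit that is installed was read from a state of `Z` that is still current when the `ECSC`
succeeds. -/
theorem cs_bit {t : ℕ} (ht : c₀ ≤ t) (h : cs t) : (z (t + 1)).bit = (z t).bit := by
  obtain ⟨-, -, t₀, h₁, h₂, h₃, h₄, -⟩ := hP.cs_spec t ht h
  rw [h₄, hP.z_const h₁ h₂ h₃ t h₂ le_rfl]

theorem cs_val {t : ℕ} (ht : c₀ ≤ t) (h : cs t) : (z (t + 1)).val ≠ (z t).val := by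
  obtain ⟨-, -, t₀, h₁, h₂, h₃, -, h₄, -⟩ := hP.cs_spec t ht h
  rwa [hP.z_const h₁ h₂ h₃ t h₂ le_rfl]

/-- A change of `Z` in `[a, b)`. -/
theorem exists_z_change {a b : ℕ} (ha : c₀ ≤ a) (hab : a ≤ b) (h : (z b).seq ≠ (z a).seq) :
    ∃ u, a ≤ u ∧ u < b ∧ (tr u ∨ cs u) := by
  induction b, hab using Nat.le_induction with
  | base => exact absurd rfl h
  | succ b hb ih =>
    rcases hP.z_step b (by omega) with e | e
    · rw [e] at h
      obtain ⟨u, h₁, h₂, h₃⟩ := ih h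
      exact ⟨u, h₁, by omega, h₃⟩
    · exact ⟨b, hb, by omega, e⟩

theorem exists_w_change {a b : ℕ} (ha : c₀ ≤ a) (hab : a ≤ b) (h : (w b).seq ≠ (w a).seq) :
    ∃ u, a ≤ u ∧ u < b ∧ wr u := by
  induction b, hab using Nat.le_induction with
  | base => exact absurd rfl h
  | succ b hb ih =>
    rcases hP.w_step b (by omega) with e | e
    · rw [e] at h
      obtain ⟨u, h₁, h₂, h₃⟩ := ih h
      exact ⟨u, h₁, by omega, h₃⟩
    · exact ⟨b, hb, by omega, e⟩

/-- A transfer moves the current contents of `W` and makes the bits equal; `W` is changed only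
if the bits are equal and no transfer happened since the value of `Z` was compared. -/
theorem bits_spec (t : ℕ) (ht : c₀ ≤ t) :
    (tr t → (z t).bit ≠ (w t).bit ∧ (z (t + 1)).val = (w t).val ∧
      (z (t + 1)).bit = (w (t + 1)).bit) ∧
    (wr t → (z t).bit = (w t).bit ∧ (z (t + 1)).bit ≠ (w (t + 1)).bit ∧
      ∃ t₁, c₀ ≤ t₁ ∧ t₁ ≤ t ∧ (z t₁).val ≠ (w (t + 1)).val ∧ ∀ u, t₁ ≤ u → u < t → ¬ tr u) := by
  -- The two claims need each other at earlier times, hence a joint strong induction.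
  induction t using Nat.strong_induction_on with
  | _ t ih =>
    constructor
    · intro h
      obtain ⟨hw, -, t₀, t₁, h₀, h₁, h₂, hs, hb, hv, hb'⟩ := hP.tr_spec t ht h
      have hz := hP.z_const h₀ (h₁.trans h₂) hs
      -- By induction, `W` can be written only while the bits are equal; but `Z` is constant since
      -- `t₀` and its bit differs from the one read in `W` at `t₁`.
      have key : ∀ u, t₁ ≤ u → u ≤ t → w u = w t₁ := by
        intro u hu
        induction u, hu using Nat.le_induction with
        | base => exact fun _ => rfl
        | succ u hu ihu =>
          intro hut
          rcases hP.w_step u (by omega) with e | e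
          · rw [e]; exact ihu (by omega)
          · have h₃ := ((ih u (by omega) (by omega)).2 e).1
            rw [hz u (by omega) (by omega), ihu (by omega)] at h₃
            exact absurd h₃ hb
      rw [hw, key t h₂ le_rfl, hz t (by omega) le_rfl]
      exact ⟨hb, hv, hb'⟩
    · intro h
      obtain ⟨hz, -, t₀, t₁, h₀, h₁, h₂, hs, hb, hv, hb'⟩ := hP.wr_spec t ht h
      have hw := hP.w_const h₀ (h₁.trans h₂) hs
      -- `W` is constant since `t₀`. A CAS keeps the bit of `Z` and, by induction, a transfer needs
      -- different bits, so the equality found at `t₁` persists and no transfer intervenes.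
      have key : ∀ u, t₁ ≤ u → u ≤ t → (z u).bit = (w t₀).bit ∧ ∀ s, t₁ ≤ s → s < u → ¬ tr s := by
        intro u hu
        induction u, hu using Nat.le_induction with
        | base => exact fun _ => ⟨hb, fun s h h' => by omega⟩
        | succ u hu ihu =>
          intro hut
          obtain ⟨i₁, i₂⟩ := ihu (by omega)
          have hn : ¬ tr u := fun e => by
            have h₃ := ((ih u (by omega) (by omega)).1 e).1
            rw [hw u (by omega) (by omega)] at h₃
            exact h₃ i₁
          refine ⟨?_, fun s h h' => ?_⟩
          · rcases hP.z_step u (by omega) with e | e | e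
            · rw [e]; exact i₁
            · exact absurd e hn
            · rw [hP.cs_bit (by omega) e]; exact i₁
          · rcases (show s < u ∨ s = u by omega) with h₃ | rfl
            · exact i₂ s h h₃
            · exact hn
      obtain ⟨k₁, k₂⟩ := key t h₂ le_rfl
      refine ⟨?_, ?_, t₁, by omega, h₂, hv, k₂⟩
      · rw [hw t (by omega) le_rfl, k₁]
      · rw [hz, hb', k₁]
        cases (w t₀).bit <;> simp

theorem tr_bit {t : ℕ} (ht : c₀ ≤ t) (h : tr t) : (z t).bit ≠ (w t).bit :=
  ((hP.bits_spec t ht).1 h).1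

theorem tr_val {t : ℕ} (ht : c₀ ≤ t) (h : tr t) : (z (t + 1)).val = (w t).val :=
  ((hP.bits_spec t ht).1 h).2.1

theorem tr_bit_after {t : ℕ} (ht : c₀ ≤ t) (h : tr t) : (z (t + 1)).bit = (w (t + 1)).bit :=
  ((hP.bits_spec t ht).1 h).2.2

theorem wr_bit {t : ℕ} (ht : c₀ ≤ t) (h : wr t) : (z t).bit = (w t).bit :=
  ((hP.bits_spec t ht).2 h).1

theorem wr_bit_after {t : ℕ} (ht : c₀ ≤ t) (h : wr t) : (z (t + 1)).bit ≠ (w (t + 1)).bit :=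
  ((hP.bits_spec t ht).2 h).2.1

theorem z_bit_of_not_tr {t : ℕ} (ht : c₀ ≤ t) (h : ¬ tr t) : (z (t + 1)).bit = (z t).bit := by
  rcases hP.z_step t ht with e | e | e
  · rw [e]
  · exact absurd e h
  · exact hP.cs_bit ht e

theorem w_of_not_wr {t : ℕ} (ht : c₀ ≤ t) (h : ¬ wr t) : w (t + 1) = w t :=
  (hP.w_step t ht).resolve_right h

theorem z_bit_const {a b : ℕ} (ha : c₀ ≤ a) (hab : a ≤ b) (h : ∀ u, a ≤ u → u < b → ¬ tr u) :
    (z b).bit = (z a).bit := by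
  induction b, hab using Nat.le_induction with
  | base => rfl
  | succ b hb ih =>
    rw [hP.z_bit_of_not_tr (by omega) (h b hb (by omega))]
    exact ih fun u h₁ h₂ => h u h₁ (by omega)

theorem w_const_of_not_wr {a b : ℕ} (ha : c₀ ≤ a) (hab : a ≤ b)
    (h : ∀ u, a ≤ u → u < b → ¬ wr u) : w b = w a := by
  induction b, hab using Nat.le_induction with
  | base => rfl
  | succ b hb ih =>
    rw [hP.w_of_not_wr (by omega) (h b hb (by omega))]
    exact ih fun u h₁ h₂ => h u h₁ (by omega)

/-- As long as `W` does not change, equal bits stay equal. -/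
theorem not_tr_of_eq {a b : ℕ} (ha : c₀ ≤ a) (hab : a ≤ b) (h : (z a).bit = (w a).bit)
    (hw : ∀ u, a ≤ u → u < b → ¬ wr u) : (z b).bit = (w b).bit := by
  induction b, hab using Nat.le_induction with
  | base => exact h
  | succ b hb ih =>
    have e := ih fun u h₁ h₂ => hw u h₁ (by omega)
    rw [hP.w_of_not_wr (by omega) (hw b hb (by omega)), hP.z_bit_of_not_tr (by omega), e]
    exact fun ht => hP.tr_bit (by omega) ht e

/-- If the bits differ, they stay different and `W` does not change until a transfer. -/
theorem differ_or_transfer {a b : ℕ} (ha : c₀ ≤ a) (hab : a ≤ b) (h : (z a).bit ≠ (w a).bit) :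
    (∃ t, a ≤ t ∧ t < b ∧ tr t ∧ ∀ u, a ≤ u → u < t → ¬ wr u) ∨
    ((z b).bit ≠ (w b).bit ∧ ∀ u, a ≤ u → u < b → ¬ wr u) := by
  induction b, hab using Nat.le_induction with
  | base => exact .inr ⟨h, fun u h₁ h₂ => by omega⟩
  | succ b hb ih =>
    rcases ih with ⟨t, h₁, h₂, h₃⟩ | ⟨h₁, h₂⟩
    · exact .inl ⟨t, h₁, by omega, h₃⟩
    · by_cases ht : tr b
      · exact .inl ⟨b, hb, by omega, ht, h₂⟩
      · have hw : ¬ wr b := fun e => h₁ (hP.wr_bit (by omega) e)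
        refine .inr ⟨?_, fun u h₃ h₄ => ?_⟩
        · rwa [hP.z_bit_of_not_tr (by omega) ht, hP.w_of_not_wr (by omega) hw]
        · rcases (show u < b ∨ u = b by omega) with h₅ | rfl
          · exact h₂ u h₃ h₅
          · exact hw

/-- If the bits differ, then `W` was written since the last transfer, after its new value was
compared with `Z`. -/
theorem exists_write {t : ℕ} (ht : c₀ ≤ t) (h : (z t).bit ≠ (w t).bit) :
    ∃ s, c₀ ≤ s ∧ s < t ∧ wr s ∧ (∀ u, s < u → u < t → ¬ wr u) ∧
      ∃ t₁, c₀ ≤ t₁ ∧ t₁ ≤ s ∧ (z t₁).val ≠ (w t).val ∧ ∀ u, t₁ ≤ u → u < t → ¬ tr u := by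
  induction t, ht using Nat.le_induction with
  | base => exact absurd hP.bits h
  | succ t ht ih =>
    have hn : ¬ tr t := fun e => h (hP.tr_bit_after ht e)
    by_cases hw : wr t
    · obtain ⟨-, -, t₁, h₁, h₂, h₃, h₄⟩ := (hP.bits_spec t ht).2 hw
      refine ⟨t, ht, by omega, hw, fun u _ _ => by omega, t₁, h₁, h₂, h₃, fun u h₅ h₆ => ?_⟩
      rcases (show u < t ∨ u = t by omega) with h₇ | rfl
      · exact h₄ u h₅ h₇
      · exact hn
    · rw [hP.z_bit_of_not_tr ht hn, hP.w_of_not_wr ht hw] at h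
      obtain ⟨s, h₁, h₂, h₃, h₄, t₁, h₅, h₆, h₇, h₈⟩ := ih h
      refine ⟨s, h₁, by omega, h₃, fun u k₁ k₂ => ?_, t₁, h₅, h₆, ?_, fun u k₁ k₂ => ?_⟩
      · rcases (show u < t ∨ u = t by omega) with k₃ | rfl
        · exact h₄ u k₁ k₃
        · exact hw
      · rwa [hP.w_of_not_wr ht hw]
      · rcases (show u < t ∨ u = t by omega) with k₃ | rfl
        · exact h₈ u k₁ k₃
        · exact hn

/-- A `transfer-write` executed while the bits differ and no transfer takes place loses against a
CAS. -/
theorem exists_cs_of_done {a b s e : ℕ} (ha : c₀ ≤ a) (h : (z a).bit ≠ (w a).bit)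
    (hn : ∀ t, a ≤ t → t < b → ¬ tr t) (has : a ≤ s) (heb : e ≤ b) (hd : Done z w s e) :
    ∃ u, s ≤ u ∧ u < e ∧ cs u := by
  obtain ⟨t₀, t₁, h₀, h₁, h₂, hd⟩ := hd
  -- While the bits differ and nothing is transferred, `W` is frozen, so the two reads of
  -- `transfer-write` compare as if they were simultaneous.
  have hw : w t₁ = w t₀ := by
    have := hP.differ_or_transfer ha (show a ≤ t₁ by omega) h
    rcases this with ⟨t, k₁, k₂, k₃, -⟩ | ⟨-, k⟩
    · exact absurd k₃ (hn t k₁ (by omega))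
    · exact hP.w_const_of_not_wr (by omega) h₁ fun u k₁ k₂ => k u (by omega) k₂
  have hb : (z t₀).bit ≠ (w t₀).bit := by
    rcases hP.differ_or_transfer ha (show a ≤ t₀ by omega) h with ⟨t, k₁, k₂, k₃, -⟩ | ⟨k, -⟩
    · exact absurd k₃ (hn t k₁ (by omega))
    · exact k
  have conv : ∀ u, a ≤ u → u < b → tr u ∨ cs u → cs u := fun u k₁ k₂ k =>
    k.resolve_left (hn u k₁ k₂)
  rcases hd with hd | ⟨t₂, h₃, h₄, hd | hd⟩
  · rw [hw] at hd
    exact absurd hd hb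
  · obtain ⟨u, k₁, k₂, k₃⟩ := hP.exists_z_change (by omega) (h₁.trans h₃) hd
    exact ⟨u, by omega, by omega, conv u (by omega) (by omega) k₃⟩
  · have : z (t₂ + 1) ≠ z t₂ := fun k => by rw [k] at hd; exact lt_irrefl _ hd
    exact ⟨t₂, by omega, h₄, conv t₂ (by omega) (by omega)
      ((hP.z_step t₂ (by omega)).resolve_left this)⟩

/-- Two complete executions of `transfer-write` guarantee a transfer. -/
theorem exists_transfer {a b s e : ℕ} (ha : c₀ ≤ a) (h : (z a).bit ≠ (w a).bit) (has : a ≤ s)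
    (hse : s ≤ e) (heb : e ≤ b) (hd : Done z w s e) (hd' : Done z w e b) :
    ∃ t, a ≤ t ∧ t < b ∧ tr t := by
  -- Without a transfer both executions lose against swaps, at `u < u'`. The swap at `u'` read `Z`
  -- at `t₀`, after `u`, and executed a complete `transfer-write` since then. This one must have
  -- lost against a swap in `[t₀, u')`, where `Z` is constant.
  by_contra hn
  push Not at hn
  obtain ⟨u, h₁, h₂, h₃⟩ := hP.exists_cs_of_done ha h hn has heb hd
  obtain ⟨u', h₁', h₂', h₃'⟩ := hP.exists_cs_of_done ha h hn (has.trans hse) le_rfl hd'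
  obtain ⟨-, -, t₀, k₀, k₁, k₂, -, -, k₃⟩ := hP.cs_spec u' (by omega) h₃'
  have hz := hP.z_const k₀ k₁ k₂
  have hlt : ∀ x, t₀ ≤ x → x < u' → ¬ cs x := fun x l₁ l₂ l => by
    have := hP.z_lt (show c₀ ≤ x by omega) (.inr l)
    rw [hz x l₁ (by omega), hz (x + 1) (by omega) (by omega)] at this
    exact lt_irrefl _ this
  have hu : u < t₀ := by
    by_contra hu
    exact hlt u (by omega) (by omega) h₃
  obtain ⟨x, l₁, l₂, l₃⟩ :=
    hP.exists_cs_of_done ha h hn (show a ≤ t₀ by omega) (show u' ≤ b by omega) k₃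
  exact hlt x l₁ l₂ l₃

/-- If `Z` changed in two disjoint intervals, then its value was not `old` all the time. -/
theorem exists_val_ne {old : V} {a b c d : ℕ} (ha : c₀ ≤ a) (hab : a ≤ b) (hbc : b < c)
    (hcd : c ≤ d) (h : (z b).seq ≠ (z a).seq) (h' : (z d).seq ≠ (z c).seq) :
    ∃ t, a ≤ t ∧ t ≤ d ∧ (z t).val ≠ old := by
  have ne : ∀ s t, a ≤ s → s ≤ d → a ≤ t → t ≤ d → (z s).val ≠ (z t).val →
      ∃ t, a ≤ t ∧ t ≤ d ∧ (z t).val ≠ old := by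
    intro s t h₁ h₂ h₃ h₄ h₅
    by_cases hs : (z s).val = old
    · exact ⟨t, h₃, h₄, fun ht => h₅ (hs.trans ht.symm)⟩
    · exact ⟨s, h₁, h₂, hs⟩
  obtain ⟨u, h₁, h₂, h₃⟩ := hP.exists_z_change ha hab h
  obtain ⟨u', h₁', h₂', h₃'⟩ := hP.exists_z_change (by omega) hcd h'
  -- A swap changes the value, so `old` cannot be the value both before and after it; this settles
  -- all cases except that of two transfers.
  rcases h₃ with h₃ | h₃
  swap
  · exact ne (u + 1) u (by omega) (by omega) (by omega) (by omega) (hP.cs_val (by omega) h₃)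
  rcases h₃' with h₃' | h₃'
  swap
  · exact ne (u' + 1) u' (by omega) (by omega) (by omega) (by omega) (hP.cs_val (by omega) h₃')
  -- The value transferred at `u'` was compared with `Z` at `t₁` and differed. No transfer lies
  -- between this comparison and `u'`, so `t₁` comes after the transfer at `u` and inside the
  -- interval.
  obtain ⟨s, -, hs, -, -, t₁, -, k₁, k₂, k₃⟩ := hP.exists_write (by omega)
    (hP.tr_bit (by omega) h₃')
  have hu : u < t₁ := by
    by_contra hu
    exact k₃ u (by omega) (by omega) h₃
  rw [← hP.tr_val (by omega) h₃'] at k₂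
  exact ne t₁ (u' + 1) (by omega) (by omega) (by omega) (by omega) k₂

end Protocol

end Protocol

/-! ### Attribution of changes to operations in progress. -/

section Histories

set_option linter.unusedSectionVars false

variable {V : Type u} {Obj : Type v} {P : Type w}
  [DecidableEq V] [DecidableEq Obj] [DecidableEq P]

theorem Handle.setPend_det (h : Handle V Obj) (g : Role) (a : Option (Pending V Obj)) (g' : Role) :
    ((h.setPend g a).ec g').det = (h.ec g').det := by
  rw [Handle.setPend, Handle.setEC_ec]
  split_ifs with e
  · rw [e]
  · rfl

variable {T : ℕ} {H : List (Label V Obj P)} {C : ℕ → Config V Obj P}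

theorem Trace.ec_ne_none (tr : Trace T H C) {x : Obj × Cell} {a b : ℕ} (hab : a ≤ b)
    (h : (C a).ec x ≠ none) : (C b).ec x ≠ none := by
  induction b, hab using Nat.le_induction with
  | base => exact h
  | succ b _ ih =>
    cases hl : H[b]? with
    | none => rwa [tr.stay b hl]
    | some l => exact (tr.step b l hl).ec_ne_none x ih

theorem Step.hnd_ne_none {c c' : Config V Obj P} {l : Label V Obj P}
    (hs : Step T c l c') (p : P) (hp : c.hnd p ≠ none) : c'.hnd p ≠ none := by
  cases hs <;> simp only [Config.setCtl, Config.setHnd, Config.setEC] <;> try exact hp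
  all_goals
    simp only [Function.update_apply]
    split_ifs <;> simp_all

theorem Trace.hnd_ne_none (tr : Trace T H C) {p : P} {a b : ℕ} (hab : a ≤ b)
    (h : (C a).hnd p ≠ none) : (C b).hnd p ≠ none := by
  induction b, hab using Nat.le_induction with
  | base => exact h
  | succ b _ ih =>
    cases hl : H[b]? with
    | none => rwa [tr.stay b hl]
    | some l => exact (tr.step b l hl).hnd_ne_none p ih

/-- Existing DurEC objects and detection values change only by a successful `ECSC`. -/
theorem Trace.change (tr : Trace T H C) (t : ℕ) :
    (∃ p g x s v b, Succ H C t p g x s v b) ∨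
    ((∀ x y, (C t).ec x = some y → (C (t + 1)).ec x = some y) ∧
      ∀ p g, (C t).hnd p ≠ none → det C p g (t + 1) = det C p g t) := by
  cases hl : H[t]? with
  | none => exact .inr (by simp [det, tr.stay t hl])
  | some l =>
    have hs := tr.step t l hl
    generalize hC : C (t + 1) = c' at hs
    cases hs with
    | scSuccess q x g s v b h y seq' det' hh hp hy hseq hseq' hdet' =>
      have hn' : (C (t + 1)).hnd q = some (h.setEC g ⟨det', some (.sc x s v b (some true))⟩) := by
        simp [hC, Config.setHnd]
      refine .inl ⟨q, g, x, s, v, b, hl, (pend_of hh _).trans hp,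
        ⟨y, seq', hy, hseq, hseq ▸ hseq', ?_⟩, ?_, ?_, ?_⟩
      · simp [hC, Config.setHnd, Config.setEC]
      · intro x' hx
        simp [hC, Config.setHnd, Config.setEC, hx]
      · rw [det_of hh, det_of hn', Handle.setEC_ec, if_pos rfl]
        exact hdet'
      · intro g' hg
        rw [det_of hh, det_of hn', Handle.setEC_ec, if_neg hg]
    | newObj o v w₀ sW sZ fresh =>
      refine .inr ⟨fun x y hx => ?_, by simp [det, hC, Config.setEC]⟩
      have : x.1 ≠ o := by
        rintro rfl
        rw [fresh x.2] at hx
        cases hx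
      have h₁ : x ≠ (o, .W) := fun e => this (by rw [e])
      have h₂ : x ≠ (o, .Z) := fun e => this (by rw [e])
      simpa [hC, Config.setEC, h₁, h₂] using hx
    | newHandle q d τ fresh =>
      refine .inr ⟨by simp [Config.setHnd], fun p g hp => ?_⟩
      have : p ≠ q := by rintro rfl; exact hp fresh
      simp [det, hC, Config.setHnd, this]
    | _ =>
      refine .inr ⟨by simp [Config.setCtl, Config.setHnd], fun p g _ => ?_⟩
      simp only [det, hC, Config.setCtl, Config.setHnd, Function.update_apply]
      try split_ifs with e
      all_goals first | rfl | (subst e; simp [Handle.setPend_det, *])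

/-- A missing handle counts as detection value 0, so acquiring one cannot lower it. -/
theorem Trace.det_le (tr : Trace T H C) (p : P) (g : Role) {a b : ℕ} (hab : a ≤ b) :
    det C p g a ≤ det C p g b := by
  induction b, hab using Nat.le_induction with
  | base => exact le_rfl
  | succ b _ ih =>
    refine ih.trans ?_
    by_cases hn : (C b).hnd p = none
    · simp [det, hn]
    rcases tr.change b with ⟨q, g', x, s, v, e, h⟩ | h
    · by_cases hq : p = q
      · subst hq
        by_cases hg : g = g'
        · subst hg; exact h.det_lt.le
        · exact (h.det_eq g hg).ge
      · have := (tr.step b _ h.label).frame (p := p) (by simpa [Label.proc] using Ne.symm hq)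
        simp [det, this.1]
    · exact (h.2 p g hn).ge

/-- If a detection value increased, then an `ECSC` succeeded. -/
theorem Trace.exists_succ (tr : Trace T H C) {p : P} {g : Role} {a b : ℕ} (hab : a ≤ b)
    (hn : (C a).hnd p ≠ none) (hd : det C p g a < det C p g b) :
    ∃ t x s v e, a ≤ t ∧ t < b ∧ Succ H C t p g x s v e := by
  induction b, hab using Nat.le_induction with
  | base => exact absurd hd (lt_irrefl _)
  | succ b hb ih =>
    by_cases h : det C p g a < det C p g b
    · obtain ⟨t, x, s, v, e, h₁, h₂, h₃⟩ := ih h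
      exact ⟨t, x, s, v, e, h₁, by omega, h₃⟩
    · rcases tr.change b with ⟨q, g', x, s, v, e, h'⟩ | h'
      · by_cases hq : p = q
        · subst hq
          by_cases hg : g = g'
          · subst hg; exact ⟨b, x, s, v, e, hb, by omega, h'⟩
          · rw [h'.det_eq g hg] at hd
            exact absurd hd h
        · have := (tr.step b _ h'.label).frame (p := p) (by simpa [Label.proc] using Ne.symm hq)
          rw [show det C p g (b + 1) = det C p g b by simp [det, this.1]] at hd
          exact absurd hd h
      · rw [h'.2 p g (tr.hnd_ne_none hb hn)] at hd
        exact absurd hd h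

/-- The field `op` is changed only by an operation that is in progress. -/
theorem Trace.tag_change (tr : Trace T H C) {p : P} {t : ℕ} (hn : (C t).hnd p ≠ none)
    (h : tag C p (t + 1) ≠ tag C p t) :
    ∃ i o op, H[i]? = some (.inv p o op) ∧ Open H p i t ∧ tag C p (t + 1) = op.tag? := by
  have I := tr.inv t p
  cases hl : H[t]? with
  | none => exact absurd (by simp [tag, tr.stay t hl]) h
  | some l =>
    have hs := tr.step t l hl
    generalize hC : C (t + 1) = c' at hs
    cases hs with
    | setOp q x a k h' hc hh =>
      by_cases hq : p = q
      · subst hq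
        obtain ⟨D, Post, a₀, h₁, h₂, ⟨h₃, ⟨i, o, op, h₄, h₅, h₆⟩, h₃'⟩, h₇⟩ := I.run _ _ _ hc
        refine ⟨i, o, op, h₄, h₅.trans h₂ h₇.keep.1.busy, ?_⟩
        rw [h₆]
        exact tag_of (h := { h' with op := a }) (by simp [hC, Config.setCtl, Config.setHnd])
      · exact absurd (by simp [tag, hC, Config.setCtl, Config.setHnd, hq]) h
    | newHandle q d τ fresh =>
      have : p ≠ q := by rintro rfl; exact hn fresh
      exact absurd (by simp [tag, hC, Config.setHnd, this]) h
    | _ =>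
      refine absurd ?_ h
      simp only [tag, hC, Config.setCtl, Config.setHnd, Config.setEC, Function.update_apply]
      try split_ifs with e
      all_goals first | rfl | (subst e; simp [Handle.setPend, Handle.setEC, *])

/-- A process has at most one operation in progress. -/
theorem Trace.open_unique (tr : Trace T H C) {p : P} {i j t : ℕ} {o o' : Obj} {op op' : Op V}
    (hi : H[i]? = some (.inv p o op)) (hj : H[j]? = some (.inv p o' op')) (h : Open H p i t)
    (h' : Open H p j t) : i = j := by
  -- An invocation requires an idle process, while an open operation binds its process to an object.
  have key : ∀ {i j : ℕ} {o o' : Obj} {op op' : Op V}, H[i]? = some (.inv p o op) →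
      H[j]? = some (.inv p o' op') → Open H p i t → Open H p j t → ¬ i < j := by
    intro i j o o' op op' hi hj h h' hij
    have h₁ := (tr.inv j p).opened i o op hi (h.of_le hij h'.1.le)
    have hs := tr.step j _ hj
    generalize C (j + 1) = c' at hs
    generalize C j = c at hs h₁
    generalize hl : Label.inv p o' op' = l at hs
    cases hs with
    | inv q o op idle hh ho =>
      cases hl
      rw [idle] at h₁
      cases h₁
    | finish q x r hc => cases r <;> cases hl
    | _ => cases hl
  have h₁ := key hi hj h h'
  have h₂ := key hj hi h' h
  omega

theorem Succ.guardOK (tr : Trace T H C) {t : ℕ} {p : P} {g : Role} {x : Obj × Cell} {s : ℕ} {v : V}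
    {b : Bool} (h : Succ H C t p g x s v b) : GuardOK H C p t g x s v b :=
  (tr.inv t p).guard g x s v b h.pend

/-- A successful `ECSC` through the critical handle belongs to an operation in progress. -/
theorem Succ.exists_open (tr : Trace T H C) {t : ℕ} {p : P} {o : Obj} {c : Cell} {s : ℕ} {v : V}
    {b : Bool} (h : Succ H C t p .critical (o, c) s v b) :
    ∃ i op, H[i]? = some (.inv p o op) ∧ Open H p i t ∧
      det C p .critical t = det C p .critical (i + 1) ∧ tag C p t = some c.tag ∧
      op.tag? = some c.tag ∧ (c = .W → op = .write v) := by
  obtain ⟨a, ha, hG, hb, hK⟩ := h.guardOK tr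
  obtain ⟨ht, hd⟩ := hK rfl
  rw [ht, hd]
  cases c with
  | W =>
    obtain ⟨i, h₁, h₂, h₃, h₄, -⟩ := hG
    exact ⟨i, _, h₁, h₂.trans ha hb, h₃, h₄, rfl, fun _ => rfl⟩
  | Z =>
    obtain ⟨i, old, h₁, h₂, h₃, h₄, -⟩ := hG
    exact ⟨i, _, h₁, h₂.trans ha hb, h₃, h₄, rfl, by simp⟩

/-- No operation succeeds twice through the critical handle. -/
theorem Succ.unique (tr : Trace T H C) {t t' i : ℕ} {p : P} {o : Obj} {op : Op V} {x x' : Obj × Cell}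
    {s s' : ℕ} {v v' : V} {b b' : Bool} (h : Succ H C t p .critical x s v b)
    (h' : Succ H C t' p .critical x' s' v' b') (hi : H[i]? = some (.inv p o op))
    (ho : Open H p i t) (ho' : Open H p i t') : t = t' := by
  -- The guard of the later success says that the detection value is still the one from right after
  -- the invocation, but the earlier success has raised it.
  have key : ∀ {t t' : ℕ} {x x' : Obj × Cell} {s s' : ℕ} {v v' : V} {b b' : Bool},
      Succ H C t p .critical x s v b → Succ H C t' p .critical x' s' v' b' →
      Open H p i t → Open H p i t' → ¬ t < t' := by
    intro t t' x x' s s' v v' b b' h h' ho ho' hlt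
    obtain ⟨o', c⟩ := x'
    obtain ⟨j, op', h₁, h₂, h₃, -⟩ := h'.exists_open tr
    obtain rfl := tr.open_unique h₁ hi h₂ ho'
    have h₄ := h.det_lt
    have h₅ := tr.det_le p .critical (show t + 1 ≤ t' by omega)
    have h₆ := tr.det_le p .critical (show j + 1 ≤ t by have := ho.1; omega)
    omega
  have h₁ := key h h' ho ho'
  have h₂ := key h' h ho' ho
  omega

end Histories

/-! ### The cells of one object, and guarantees at the return of a method. -/

section Objects

set_option linter.unusedSectionVars false

variable {V : Type u} {Obj : Type v} {P : Type w}

/-- The state of a DurEC object at time `t`, with initial value `v` before its creation. -/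
def cellState (C : ℕ → Config V Obj P) (x : Obj × Cell) (v : V) (t : ℕ) : ECState V :=
  ((C t).ec x).getD ⟨v, false, 0⟩

/-- At time `t` a write is transferred to `Z`. -/
def Transfers (H : List (Label V Obj P)) (C : ℕ → Config V Obj P) (o : Obj) (t : ℕ) : Prop :=
  ∃ p s v b, Succ H C t p .casual (o, .Z) s v b

/-- At time `t` a CAS changes `Z`. -/
def Swaps (H : List (Label V Obj P)) (C : ℕ → Config V Obj P) (o : Obj) (t : ℕ) : Prop :=
  ∃ p s v b, Succ H C t p .critical (o, .Z) s v b

/-- At time `t` a write changes `W`. -/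
def Writes (H : List (Label V Obj P)) (C : ℕ → Config V Obj P) (o : Obj) (t : ℕ) : Prop :=
  ∃ p s v b, Succ H C t p .critical (o, .W) s v b

variable {T : ℕ} {H : List (Label V Obj P)} {C : ℕ → Config V Obj P} {o : Obj} {v : V} {n : ℕ}

theorem cellState_of {x : Obj × Cell} {t : ℕ} {y : ECState V} (h : (C t).ec x = some y) :
    cellState C x v t = y := by simp [cellState, h]

theorem TransferDone.done {a b : ℕ} (h : TransferDone C o a b) :
    Done (cellState C (o, .Z) v) (cellState C (o, .W) v) a b := by
  obtain ⟨t₀, t₁, z, w, h₀, h₁, h₂, hz, hw, h⟩ := h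
  refine ⟨t₀, t₁, h₀, h₁, h₂, ?_⟩
  rw [cellState_of hz, cellState_of hw]
  refine h.imp_right ?_
  rintro ⟨t₂, y, h₃, h₄, hy, h⟩
  refine ⟨t₂, h₃, h₄, ?_⟩
  rw [cellState_of hy]
  refine h.imp_right ?_
  rintro ⟨y', hy', h⟩
  rwa [cellState_of hy']

variable [DecidableEq V] [DecidableEq Obj] [DecidableEq P]

theorem Trace.created (tr : Trace T H C) (hn : H[n]? = some (.newObj o v)) :
    (∀ c, (C n).ec (o, c) = none) ∧ (∃ s, (C (n + 1)).ec (o, .Z) = some ⟨v, false, s⟩) ∧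
      ∃ w s, (C (n + 1)).ec (o, .W) = some ⟨w, false, s⟩ := by
  have hs := tr.step n _ hn
  generalize hC : C (n + 1) = c' at hs
  generalize hl : Label.newObj o v = l at hs
  cases hs with
  | newObj o v w₀ sW sZ fresh =>
    cases hl
    exact ⟨fresh, ⟨sZ, by simp [Config.setEC]⟩, w₀, sW, by simp [Config.setEC]⟩
  | finish q x r hc => cases r <;> cases hl
  | _ => cases hl

theorem Trace.le_of_ec (tr : Trace T H C) (hn : H[n]? = some (.newObj o v)) {t : ℕ} {c : Cell}
    {y : ECState V} (h : (C t).ec (o, c) = some y) : n + 1 ≤ t := by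
  by_contra hlt
  exact tr.ec_ne_none (show t ≤ n by omega) (by simp [h]) ((tr.created hn).1 c)

theorem Trace.ec_eq (tr : Trace T H C) (hn : H[n]? = some (.newObj o v)) {t : ℕ} (c : Cell)
    (ht : n + 1 ≤ t) : (C t).ec (o, c) = some (cellState C (o, c) v t) := by
  have h : (C t).ec (o, c) ≠ none := by
    refine tr.ec_ne_none ht ?_
    obtain ⟨-, ⟨s, hz⟩, w, s', hw⟩ := tr.created hn
    cases c with
    | W => simp [hw]
    | Z => simp [hz]
  obtain ⟨y, hy⟩ := Option.ne_none_iff_exists'.1 h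
  rw [hy, cellState_of hy]

/-- The default in `cellState` makes the value defined and equal to `v` from time 0 on, so that the
linearization can start at time 0 instead of the creation. -/
theorem Trace.val_of_le (tr : Trace T H C) (hn : H[n]? = some (.newObj o v)) {t : ℕ}
    (ht : t ≤ n + 1) : (cellState C (o, .Z) v t).val = v := by
  rcases (show t ≤ n ∨ t = n + 1 by omega) with h | rfl
  · have : (C t).ec (o, .Z) = none := by
      by_contra hne
      obtain ⟨y, hy⟩ := Option.ne_none_iff_exists'.1 hne
      have := tr.le_of_ec hn hy
      omega
    simp [cellState, this]
  · obtain ⟨s, hs⟩ := (tr.created hn).2.1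
    rw [cellState_of hs]

theorem Trace.ec_step (tr : Trace T H C) {x : Obj × Cell} {y : ECState V} {t : ℕ}
    (h : (C t).ec x = some y) :
    (C (t + 1)).ec x = some y ∨ ∃ p g s v b, Succ H C t p g x s v b := by
  rcases tr.change t with ⟨p, g, x', s, v, b, h'⟩ | h'
  · by_cases hx : x = x'
    · subst hx
      exact .inr ⟨p, g, s, v, b, h'⟩
    · rw [h'.frame x hx]
      exact .inl h
  · exact .inl (h'.1 x y h)

theorem Succ.cellState_eq {t : ℕ} {p : P} {g : Role} {x : Obj × Cell} {s : ℕ} {v v' : V} {b : Bool}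
    (h : Succ H C t p g x s v b) : (cellState C x v' t).seq = s ∧
      s < (cellState C x v' (t + 1)).seq ∧ (cellState C x v' (t + 1)).val = v ∧
      (cellState C x v' (t + 1)).bit = b := by
  obtain ⟨y, q, h₁, h₂, h₃, h₄⟩ := h.effect
  rw [cellState_of h₁, cellState_of h₄]
  exact ⟨h₂, h₃, rfl, rfl⟩

theorem Succ.cellState_frame {t : ℕ} {p : P} {g : Role} {x x' : Obj × Cell} {s : ℕ} {v v' : V}
    {b : Bool} (h : Succ H C t p g x s v b) (hx : x' ≠ x) :
    cellState C x' v' (t + 1) = cellState C x' v' t := by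
  rw [cellState, h.frame x' hx, cellState]

/-- The cells of a DuraCAS object follow the protocol. -/
theorem Trace.protocol (tr : Trace T H C) (hn : H[n]? = some (.newObj o v)) :
    Protocol (cellState C (o, .Z) v) (cellState C (o, .W) v) (n + 1) (Transfers H C o)
      (Swaps H C o) (Writes H C o) where
  bits := by
    obtain ⟨-, ⟨s, hz⟩, w, s', hw⟩ := tr.created hn
    rw [cellState_of hz, cellState_of hw]
  z_step t ht := by
    rcases tr.ec_step (tr.ec_eq hn .Z ht) with h | ⟨p, g, s, v, b, h⟩
    · exact .inl (cellState_of h)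
    · cases g with
      | casual => exact .inr (.inl ⟨p, s, v, b, h⟩)
      | critical => exact .inr (.inr ⟨p, s, v, b, h⟩)
  w_step t ht := by
    rcases tr.ec_step (tr.ec_eq hn .W ht) with h | ⟨p, g, s, v, b, h⟩
    · exact .inl (cellState_of h)
    · cases g with
      | casual =>
        obtain ⟨a, -, hG, -⟩ := h.guardOK tr
        exact hG.elim
      | critical => exact .inr ⟨p, s, v, b, h⟩
  tr_spec := by
    rintro t ht ⟨p, s, x, b, h⟩
    obtain ⟨a, ha, ⟨t₀, t₁, z, w, h₀, h₁, hz, hw, hs, hb, hv, hb'⟩, -⟩ := h.guardOK tr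
    obtain ⟨e₁, e₂, e₃, e₄⟩ := h.cellState_eq (v' := v)
    refine ⟨h.cellState_frame (by simp), e₁ ▸ e₂, t₀, t₁, tr.le_of_ec hn hz, h₀,
      h₁.trans ha, ?_⟩
    rw [e₁, e₃, e₄, cellState_of hz, cellState_of hw]
    exact ⟨hs, hb, hv, hb'⟩
  cs_spec := by
    rintro t ht ⟨p, s, x, b, h⟩
    obtain ⟨a, ha, ⟨i, old, -, -, -, -, hne, t₀, z, h₀, h₁, hz, hv, hs, hb, hd⟩, -⟩ := h.guardOK tr
    obtain ⟨e₁, e₂, e₃, e₄⟩ := h.cellState_eq (v' := v)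
    refine ⟨h.cellState_frame (by simp), e₁ ▸ e₂, t₀, tr.le_of_ec hn hz, h₁.trans ha,
      ?_⟩
    rw [e₁, e₃, e₄, cellState_of hz]
    exact ⟨hs, hb.symm, hv ▸ hne.symm, (hd.mono le_rfl ha).done⟩
  wr_spec := by
    rintro t ht ⟨p, s, x, b, h⟩
    obtain ⟨a, ha, ⟨i, -, -, -, -, t₀, t₁, w, z, h₀, h₁, h₂, hw, hz, hv, hb, hs, hb'⟩, -⟩ :=
      h.guardOK tr
    obtain ⟨e₁, e₂, e₃, e₄⟩ := h.cellState_eq (v' := v)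
    refine ⟨h.cellState_frame (by simp), e₁ ▸ e₂, t₀, t₁, tr.le_of_ec hn hw, h₁,
      h₂.trans ha, ?_⟩
    rw [e₁, e₃, e₄, cellState_of hz, cellState_of hw]
    exact ⟨hs, hb, hv, hb'⟩

/-! ### What is known when a method returns -/

theorem Trace.finish_inv (tr : Trace T H C) {j : ℕ} {p : P} {r : Out V}
    (hj : H[j]? = some (r.label p)) :
    ∃ x, (C j).ctl p = .running x (.done r) none := by
  have hs := tr.step j _ hj
  generalize C (j + 1) = c' at hs
  generalize C j = c at hs ⊢
  generalize hl : r.label p = l at hs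
  cases hs with
  | finish q x r' hc =>
    have : q = p ∧ r' = r := by cases r <;> cases r' <;> simp_all [Out.label]
    obtain ⟨rfl, rfl⟩ := this
    exact ⟨x, hc⟩
  | _ => cases r <;> cases hl

/-- `a` is the time when `done` was reached. Nothing is pending from then on, so the detection value
cannot move before the return at `j`. -/
theorem Trace.ret_spec (tr : Trace T H C) {i j : ℕ} {p : P} {r : Resp V} {op : Op V}
    (hj : H[j]? = some (.ret p r)) (hi : H[i]? = some (.inv p o op)) (ho : Open H p i j) :
    ∃ a ≤ j, OpPost H C p i o op (.resp r) a ∧ det C p .critical j = det C p .critical a := by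
  obtain ⟨x, hc⟩ := tr.finish_inv (r := .resp r) hj
  obtain ⟨D, Post, a, h₁, h₂, ⟨h₃, h₃'⟩, h₄⟩ := (tr.inv j p).run _ _ _ hc
  have hd := h₄.keep.1.det (h₃ _)
  rcases h₁ with ⟨i', o', op', -, hi', ho', rfl⟩ | ⟨o, -, rfl⟩ | ⟨rfl, rfl⟩
  · obtain rfl := tr.open_unique hi hi' ho ho'
    rw [hi, Option.some.injEq] at hi'
    cases hi'
    exact ⟨a, h₂, h₃', hd⟩
  · simp [RecPost] at h₃'
  · simp [DetPost] at h₃'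

/-- An open operation binds its process to `o`, so the recovery that closes it was executed on `o`.
-/
theorem Trace.recRet_spec (tr : Trace T H C) {i j : ℕ} {p : P} {op : Op V}
    (hj : H[j]? = some (.recRet p)) (hi : H[i]? = some (.inv p o op)) (ho : Open H p i j) :
    ∃ a ≤ j, RecPost C p o (.recovered : Out V) a ∧
      det C p .critical j = det C p .critical a ∧ tag C p j = tag C p a := by
  obtain ⟨x, hc⟩ := tr.finish_inv (r := .recovered) hj
  obtain ⟨D, Post, a, h₁, h₂, ⟨h₃, h₃'⟩, h₄⟩ := (tr.inv j p).run _ _ _ hc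
  have hd := h₄.keep.1.det (h₃ _)
  have hx := (tr.inv j p).opened i o op hi ho
  rw [hc] at hx
  rcases h₁ with ⟨i', o', op', -, hi', ho', rfl⟩ | ⟨o', rfl, rfl⟩ | ⟨rfl, rfl⟩
  · cases op' <;> simp [OpPost] at h₃'
  · cases hx
    exact ⟨a, h₂, h₃', hd, h₄.keep.1.tag⟩
  · cases hx

/-- `detect` runs on no object, whereas an open operation would bind the process to one; hence the
last conjunct. -/
theorem Trace.detRet_spec (tr : Trace T H C) {j d : ℕ} {p : P} {r : Resp V}
    (hj : H[j]? = some (.detRet p d r)) :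
    d = det C p .critical j ∧ (∃ τ, tag C p j = some τ ∧ r = τ.resp) ∧ (C j).hnd p ≠ none ∧
      ∀ i o op, H[i]? = some (.inv p o op) → ¬ Open H p i j := by
  obtain ⟨x, hc⟩ := tr.finish_inv (r := .detected d r) hj
  obtain ⟨D, Post, a, h₁, h₂, ⟨h₃, h₃'⟩, h₄⟩ := (tr.inv j p).run _ _ _ hc
  rcases h₁ with ⟨i', o', op', -, hi', ho', rfl⟩ | ⟨o', rfl, rfl⟩ | ⟨rfl, rfl⟩
  · cases op' <;> simp [OpPost] at h₃'
  · simp [RecPost] at h₃'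
  · obtain ⟨τ, h₅, h₆⟩ := h₃'
    cases h₆
    refine ⟨(h₄.keep.1.det (h₃ _)).symm, ⟨τ, h₄.keep.1.tag.trans h₅, rfl⟩,
      (tr.inv j p).hnd (by simp [hc]), fun i o op hi ho => ?_⟩
    have := (tr.inv j p).opened i o op hi ho
    rw [hc] at this
    cases this

/-- The field `op` does not change as long as no other operation is invoked. -/
theorem Trace.tag_const (tr : Trace T H C) {p : P} {i a b : ℕ} {op : Op V} (hab : a ≤ b)
    (hi : H[i]? = some (.inv p o op)) (ht : tag C p a = op.tag?) (hn : (C a).hnd p ≠ none)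
    (h : ∀ k i' o' op', a ≤ k → k < b → H[i']? = some (.inv p o' op') → Open H p i' k → i' = i) :
    tag C p b = op.tag? := by
  induction b, hab using Nat.le_induction with
  | base => exact ht
  | succ b hb ih =>
    have ih := ih fun k i' o' op' h₁ h₂ => h k i' o' op' h₁ (by omega)
    by_contra hne
    obtain ⟨i', o', op', h₁, h₂, h₃⟩ := tr.tag_change (tr.hnd_ne_none hb hn)
      (show tag C p (b + 1) ≠ tag C p b by rw [ih]; exact hne)
    obtain rfl := h b i' o' op' hb (by omega) h₁ h₂
    rw [hi, Option.some.injEq] at h₁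
    cases h₁
    exact hne h₃

end Objects

/-! ### Linearization points. -/

section LinearizationPoints

set_option linter.unusedSectionVars false

variable {V : Type u} {Obj : Type v} {P : Type w}

theorem Completes.isOpen {H : List (Label V Obj P)} {p : P} {i j : ℕ} {out : Option (Resp V)}
    (h : Completes H p i j out) : Open H p i j :=
  ⟨h.2.1, fun k h₁ h₂ => h.2.2.2 k (by omega) h₂⟩

/-- An operation in progress at time `t`, if a step inside a method is done at time `t`, is
completed only later. -/
theorem Completes.lt {H : List (Label V Obj P)} {p : P} {i j t : ℕ} {out : Option (Resp V)}
    (h : Completes H p i j out) (ho : Open H p i t) (ht : H[t]? = some (.tau p)) : t < j := by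
  obtain ⟨-, h₁, h₂, -⟩ := h
  by_contra hlt
  rcases (show j < t ∨ j = t by omega) with h₃ | rfl
  · obtain ⟨h₄, h₅⟩ := ho.2 j (by omega) h₃
    rcases h₂ with ⟨r, h₂, -⟩ | ⟨h₂, -⟩
    · exact h₄ r h₂
    · exact h₅ h₂
  · rw [ht] at h₂
    simp at h₂

/-- The operation invoked at time `i` on `o` changes the value of `o` at time `t`: it is a CAS
that succeeds, or a write that is transferred. -/
inductive MainAt (H : List (Label V Obj P)) (C : ℕ → Config V Obj P) (o : Obj) (i t : ℕ) :
    Op V → Resp V → Prop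
  | cas (p : P) (old new : V) (s : ℕ) (b : Bool) (hi : H[i]? = some (.inv p o (.cas old new)))
      (ho : Open H p i t) (hs : Succ H C t p .critical (o, .Z) s new b) :
      MainAt H C o i t (.cas old new) (.bool true)
  | write (p : P) (v : V) (u s : ℕ) (b : Bool) (hi : H[i]? = some (.inv p o (.write v)))
      (ho : Open H p i u) (hs : Succ H C u p .critical (o, .W) s v b) (hu : u < t)
      (ht : Transfers H C o t) (hw : ∀ k, u < k → k < t → ¬ Writes H C o k) :
      MainAt H C o i t (.write v) .ack

variable {T : ℕ} {H : List (Label V Obj P)} {C : ℕ → Config V Obj P} {o : Obj} {v : V} {n : ℕ}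

theorem MainAt.exists_succ {i t : ℕ} {op : Op V} {r : Resp V} (h : MainAt H C o i t op r) :
    ∃ p u c s v b, H[i]? = some (.inv p o op) ∧ Open H p i u ∧
      Succ H C u p .critical (o, c) s v b ∧ u ≤ t ∧ r = c.tag.resp := by
  cases h with
  | cas p old new s b hi ho hs => exact ⟨p, t, .Z, s, new, b, hi, ho, hs, le_rfl, rfl⟩
  | write p v u s b hi ho hs hu ht hw => exact ⟨p, u, .W, s, v, b, hi, ho, hs, hu.le, rfl⟩

theorem MainAt.inv {i t : ℕ} {op : Op V} {r : Resp V} (h : MainAt H C o i t op r) :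
    ∃ p, H[i]? = some (.inv p o op) := by
  obtain ⟨p, -, -, -, -, -, h, -⟩ := h.exists_succ
  exact ⟨p, h⟩

theorem MainAt.lt {i t : ℕ} {op : Op V} {r : Resp V} (h : MainAt H C o i t op r) : i < t := by
  obtain ⟨p, u, c, s, v, b, -, h₁, -, h₂, -⟩ := h.exists_succ
  exact h₁.1.trans_le h₂

theorem Succ.le_of_created {t : ℕ} {p : P} {g : Role} {c : Cell} {s : ℕ} {x : V} {b : Bool}
    [DecidableEq V] [DecidableEq Obj] [DecidableEq P] (tr : Trace T H C)
    (hn : H[n]? = some (.newObj o v)) (h : Succ H C t p g (o, c) s x b) : n + 1 ≤ t := by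
  obtain ⟨y, q, h, -⟩ := h.effect
  exact tr.le_of_ec hn h

theorem Transfers.le_of_created {t : ℕ}
    [DecidableEq V] [DecidableEq Obj] [DecidableEq P] (tr : Trace T H C)
    (hn : H[n]? = some (.newObj o v)) (h : Transfers H C o t) : n + 1 ≤ t := by
  obtain ⟨p, s, x, b, h⟩ := h
  exact h.le_of_created tr hn

variable [DecidableEq V] [DecidableEq Obj] [DecidableEq P]

/-- For a CAS, success of the `ECSC` means that `Z` is still in the state in which `old` was read.
For a write, the transfer moves the current contents of `W`, which nobody has changed since `u`. -/
theorem MainAt.apply (tr : Trace T H C) (hn : H[n]? = some (.newObj o v)) {i t : ℕ} {op : Op V}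
    {r : Resp V} (h : MainAt H C o i t op r) :
    op.apply (cellState C (o, .Z) v t).val = ((cellState C (o, .Z) v (t + 1)).val, r) := by
  have hP := tr.protocol hn
  cases h with
  | cas p old new s b hi ho hs =>
    obtain ⟨e₁, e₂, e₃, e₄⟩ := hs.cellState_eq (v' := v)
    obtain ⟨a, ha, ⟨i', old', hi', ho', -, -, hne, t₀, z, h₀, h₁, hz, hv, hsq, -, -⟩, hb, -⟩ :=
      hs.guardOK tr
    obtain rfl := tr.open_unique hi hi' ho (ho'.trans ha hb)
    rw [hi, Option.some.injEq] at hi'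
    cases hi'
    have h₂ := hP.z_const (tr.le_of_ec hn hz) (h₁.trans ha)
      (by rw [cellState_of hz, e₁, hsq]) t (h₁.trans ha) le_rfl
    rw [h₂, cellState_of hz, hv, e₃]
    simp [Op.apply]
  | write p x u s b hi ho hs hu ht hw =>
    have hun := hs.le_of_created tr hn
    rw [hP.tr_val (by omega) ht, hP.w_const_of_not_wr (show n + 1 ≤ u + 1 by omega)
      (show u + 1 ≤ t by omega) fun k h₁ h₂ => hw k (by omega) h₂,
      (hs.cellState_eq (v' := v)).2.2.1]
    rfl

/-- The bits differ at a transfer, so `W` was written before it; the last such write is the one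
transferred. -/
theorem exists_mainAt_of_transfers (tr : Trace T H C) (hn : H[n]? = some (.newObj o v)) {t : ℕ}
    (h : Transfers H C o t) : ∃ i x, MainAt H C o i t (.write x) .ack := by
  have hP := tr.protocol hn
  have ht := h.le_of_created tr hn
  obtain ⟨u, h₁, h₂, ⟨p, s, x, b, h₃⟩, h₄, -⟩ := hP.exists_write ht (hP.tr_bit ht h)
  obtain ⟨i, op, h₅, h₆, -, -, -, h₇⟩ := h₃.exists_open tr
  obtain rfl := h₇ rfl
  exact ⟨i, x, .write p x u s b h₅ h₆ h₃ h₂ h h₄⟩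

theorem exists_mainAt_of_swaps (tr : Trace T H C) {t : ℕ}
    (h : Swaps H C o t) : ∃ i op r, MainAt H C o i t op r := by
  obtain ⟨p, s, x, b, h⟩ := h
  obtain ⟨a, ha, ⟨i, old, hi, ho, -⟩, hb, -⟩ := h.guardOK tr
  exact ⟨i, _, _, .cas p old x s b hi (ho.trans ha hb) h⟩

/-- The value of an object changes only at the time of an operation. -/
theorem val_eq_of_not_mainAt (tr : Trace T H C) (hn : H[n]? = some (.newObj o v)) {t : ℕ}
    (h : ∀ i op r, ¬ MainAt H C o i t op r) :
    (cellState C (o, .Z) v (t + 1)).val = (cellState C (o, .Z) v t).val := by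
  rcases (show t < n + 1 ∨ n + 1 ≤ t by omega) with ht | ht
  · rw [tr.val_of_le hn (by omega), tr.val_of_le hn (by omega)]
  · rcases (tr.protocol hn).z_step t ht with e | e | e
    · rw [e]
    · obtain ⟨i, x, hm⟩ := exists_mainAt_of_transfers tr hn e
      exact absurd hm (h _ _ _)
    · obtain ⟨i, op, r, hm⟩ := exists_mainAt_of_swaps tr e
      exact absurd hm (h _ _ _)

/-- One step raises the detection value of a single DurEC handle, so it cannot be a success through
both handles of its process. -/
theorem Transfers.not_swaps {t : ℕ} (h : Transfers H C o t) : ¬ Swaps H C o t := by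
  rintro ⟨p', s', x', b', h'⟩
  obtain ⟨p, s, x, b, h⟩ := h
  have := h.label.symm.trans h'.label
  simp only [Option.some.injEq, Label.tau.injEq] at this
  subst this
  have h₁ := h.det_lt
  rw [h'.det_eq .casual (by simp)] at h₁
  exact lt_irrefl _ h₁

/-- A step belongs to one process, and a process has at most one open operation. For a transfer,
this is applied to the last change of `W` before it. -/
theorem MainAt.unique_op (tr : Trace T H C) {i i' t : ℕ} {op op' : Op V} {r r' : Resp V}
    (h : MainAt H C o i t op r) (h' : MainAt H C o i' t op' r') : i = i' := by
  have label : ∀ {p p' : P} {t : ℕ}, H[t]? = some (.tau p) → H[t]? = some (.tau p') → p = p' := by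
    intro p p' t h h'
    rw [h] at h'
    simpa using h'
  cases h with
  | cas p old new s b hi ho hs =>
    cases h' with
    | cas p' old' new' s' b' hi' ho' hs' =>
      obtain rfl := label hs.label hs'.label
      exact tr.open_unique hi hi' ho ho'
    | write p' x' u' s' b' hi' ho' hs' hu' ht' hw' =>
      exact absurd ⟨p, s, new, b, hs⟩ ht'.not_swaps
  | write p x u s b hi ho hs hu ht hw =>
    cases h' with
    | cas p' old' new' s' b' hi' ho' hs' =>
      exact absurd ⟨p', s', new', b', hs'⟩ ht.not_swaps
    | write p' x' u' s' b' hi' ho' hs' hu' ht' hw' =>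
      obtain rfl : u = u' := by
        by_contra hne
        rcases lt_or_gt_of_ne hne with hlt | hlt
        · exact hw u' hlt hu' ⟨p', s', x', b', hs'⟩
        · exact hw' u hlt hu ⟨p, s, x, b, hs⟩
      obtain rfl := label hs.label hs'.label
      exact tr.open_unique hi hi' ho ho'

/-- A write is transferred only once. -/
theorem transfer_unique (tr : Trace T H C) (hn : H[n]? = some (.newObj o v)) {u t t' : ℕ}
    (hu : Writes H C o u) (h : u < t) (h' : u < t') (ht : Transfers H C o t)
    (ht' : Transfers H C o t') (hw : ∀ k, u < k → k < t → ¬ Writes H C o k)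
    (hw' : ∀ k, u < k → k < t' → ¬ Writes H C o k) : t = t' := by
  have hP := tr.protocol hn
  have hun : n + 1 ≤ u := by
    obtain ⟨p, s, x, b, hs⟩ := hu
    exact hs.le_of_created tr hn
  -- A transfer makes the bits equal, and they stay so until `W` is written again; a second transfer
  -- would need different bits.
  have key : ∀ t t', u < t → u < t' → Transfers H C o t → Transfers H C o t' →
      (∀ k, u < k → k < t' → ¬ Writes H C o k) → ¬ t < t' := by
    intro t t' h₁ h₂ h₃ h₄ h₅ hlt
    exact hP.tr_bit (by omega) h₄ (hP.not_tr_of_eq (show n + 1 ≤ t + 1 by omega) hlt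
      (hP.tr_bit_after (by omega) h₃) fun k k₁ k₂ => h₅ k (by omega) k₂)
  have h₁ := key t t' h h' ht ht' hw'
  have h₂ := key t' t h' h ht' ht hw
  omega

theorem MainAt.unique (tr : Trace T H C) (hn : H[n]? = some (.newObj o v)) {i t t' : ℕ}
    {op op' : Op V} {r r' : Resp V} (h : MainAt H C o i t op r) (h' : MainAt H C o i t' op' r') :
    t = t' ∧ op = op' ∧ r = r' := by
  cases h with
  | cas p old new s b hi ho hs =>
    cases h' with
    | cas p' old' new' s' b' hi' ho' hs' =>
      rw [hi, Option.some.injEq] at hi'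
      cases hi'
      exact ⟨hs.unique tr hs' hi ho ho', rfl, rfl⟩
    | write p' x' u' s' b' hi' ho' hs' hu' ht' hw' =>
      rw [hi, Option.some.injEq] at hi'
      cases hi'
  | write p x u s b hi ho hs hu ht hw =>
    cases h' with
    | cas p' old' new' s' b' hi' ho' hs' =>
      rw [hi, Option.some.injEq] at hi'
      cases hi'
    | write p' x' u' s' b' hi' ho' hs' hu' ht' hw' =>
      rw [hi, Option.some.injEq] at hi'
      cases hi'
      obtain rfl := hs.unique tr hs' hi ho ho'
      exact ⟨transfer_unique tr hn ⟨p, s, x, b, hs⟩ hu hu' ht ht' hw hw', rfl, rfl⟩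

/-- A write that changed `W` is transferred before it is completed. -/
theorem exists_transfer_of_succ (tr : Trace T H C) (hn : H[n]? = some (.newObj o v))
    {i j u s : ℕ} {p : P} {x : V} {b : Bool} {out : Option (Resp V)}
    (hi : H[i]? = some (.inv p o (.write x))) (ho : Open H p i u)
    (hs : Succ H C u p .critical (o, .W) s x b) (hc : Completes H p i j out) :
    ∃ t, u < t ∧ t < j ∧ Transfers H C o t ∧ ∀ k, u < k → k < t → ¬ Writes H C o k := by
  have hP := tr.protocol hn
  have huj := hc.lt ho hs.label
  have hun := hs.le_of_created tr hn
  have hdj := tr.det_le p .critical (show u + 1 ≤ j by omega)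
  have hdi := tr.det_le p .critical (show i + 1 ≤ u by have := ho.1; omega)
  have hdu := hs.det_lt
  obtain ⟨a, t₂, t₃, haj, h₁, h₂, hd, d₁, d₂⟩ : ∃ a t₂ t₃, a ≤ j ∧ t₂ ≤ t₃ ∧ t₃ ≤ a ∧
      det C p .critical j = det C p .critical t₂ ∧ TransferDone C o t₂ t₃ ∧
      TransferDone C o t₃ a := by
    rcases hc.2.2.1 with ⟨r, hj, -⟩ | ⟨hj, -⟩
    · obtain ⟨a, haj, ⟨-, hpost⟩, hd⟩ := tr.ret_spec hj hi hc.isOpen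
      rcases hpost with ⟨hd', -⟩ | ⟨t₀, t₁, t₂, t₃, w, z, -, -, -, h₁, h₂, -, -, -, hd', d₁, d₂⟩
      · omega
      · exact ⟨a, t₂, t₃, haj, h₁, h₂, hd.trans hd', d₁, d₂⟩
    · obtain ⟨a, haj, ⟨-, hpost⟩, hd, ht⟩ := tr.recRet_spec hj hi hc.isOpen
      -- The recovery branches on `op`. Only an open operation of `p` changes this field, and until
      -- `j` the write itself is the only one.
      have htag : tag C p j = some .write := by
        obtain ⟨i', op, h₁, h₂, -, h₃, -⟩ := hs.exists_open tr
        refine tr.tag_const huj.le hi h₃ ?_ fun k i' o' op' k₁ k₂ k₃ k₄ => ?_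
        · intro e
          simp [tag, e] at h₃
        · exact tr.open_unique k₃ hi k₄ (hc.isOpen.of_le (by have := ho.1; omega) (by omega))
      obtain ⟨t₂, t₃, h₁, h₂, hd', d₁, d₂⟩ := hpost (ht ▸ htag)
      exact ⟨a, t₂, t₃, haj, h₁, h₂, hd.trans hd', d₁, d₂⟩
  -- The detection value rises at `u` but is the same at `t₂` and at `j`, so both executions of
  -- `transfer-write` start after the change of `W`.
  have hut : u < t₂ := by
    by_contra hlt
    have := tr.det_le p .critical (show t₂ ≤ u by omega)
    omega
  have hb := hP.wr_bit_after hun ⟨p, s, x, b, hs⟩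
  obtain ⟨t', k₁, k₂, k₃⟩ := hP.exists_transfer (show n + 1 ≤ u + 1 by omega) hb hut h₁ h₂
    d₁.done d₂.done
  -- The transfer at `t'` need not carry this write; the wanted one precedes any further change of
  -- `W`.
  rcases hP.differ_or_transfer (show n + 1 ≤ u + 1 by omega) (show u + 1 ≤ t' + 1 by omega) hb with
    ⟨t, l₁, l₂, l₃, l₄⟩ | ⟨l, -⟩
  · exact ⟨t, l₁, by omega, l₃, fun k m₁ m₂ => l₄ k m₁ m₂⟩
  · exact absurd (hP.tr_bit_after (by omega) k₃) l

/-- For a write, some transfer of it is forced before completion, and by `transfer_unique` it is the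
one recorded in `MainAt`. -/
theorem MainAt.lt_of_completes (tr : Trace T H C) (hn : H[n]? = some (.newObj o v)) {i j t : ℕ}
    {p : P} {op : Op V} {r : Resp V} {out : Option (Resp V)} (h : MainAt H C o i t op r)
    (hc : Completes H p i j out) : t < j := by
  obtain ⟨o', op', hi'⟩ := hc.1
  cases h with
  | cas p' old new s b hi ho hs =>
    rw [hi, Option.some.injEq] at hi'
    cases hi'
    exact hc.lt ho hs.label
  | write p' x u s b hi ho hs hu ht hw =>
    rw [hi, Option.some.injEq] at hi'
    cases hi'
    obtain ⟨t', h₁, h₂, h₃, h₄⟩ := exists_transfer_of_succ tr hn hi ho hs hc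
    rwa [transfer_unique tr hn ⟨p, s, x, b, hs⟩ hu h₁ ht h₃ hw h₄]

/-- The critical success lies between invocation and completion. Consequently an operation with
unchanged detection value is not of this kind and may be deleted. -/
theorem MainAt.det_lt (tr : Trace T H C) {i j t : ℕ}
    {p : P} {op : Op V} {r : Resp V} {out : Option (Resp V)} (h : MainAt H C o i t op r)
    (hc : Completes H p i j out) : det C p .critical (i + 1) < det C p .critical j := by
  obtain ⟨o', op', hi'⟩ := hc.1
  obtain ⟨p', u, c, s, v, b, hi, ho, hs, -, -⟩ := h.exists_succ
  rw [hi, Option.some.injEq] at hi'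
  cases hi'
  have huj := hc.lt ho hs.label
  have h₁ := tr.det_le p .critical (show u + 1 ≤ j by omega)
  have h₂ := tr.det_le p .critical (show i + 1 ≤ u by have := ho.1; omega)
  have h₃ := hs.det_lt
  omega

/-- An operation that succeeded through its critical handle takes effect before it is completed. -/
theorem exists_mainAt_of_succ (tr : Trace T H C) (hn : H[n]? = some (.newObj o v))
    {i j u s : ℕ} {p : P} {c : Cell} {x : V} {b : Bool} {out : Option (Resp V)} {op : Op V}
    (hi : H[i]? = some (.inv p o op)) (ho : Open H p i u)
    (hs : Succ H C u p .critical (o, c) s x b) (hc : Completes H p i j out) :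
    ∃ t, MainAt H C o i t op c.tag.resp := by
  cases c with
  | Z =>
    obtain ⟨a, ha, ⟨i', old, hi', ho', -⟩, hb, -⟩ := hs.guardOK tr
    obtain rfl := tr.open_unique hi hi' ho (ho'.trans ha hb)
    rw [hi, Option.some.injEq] at hi'
    cases hi'
    exact ⟨u, .cas p old x s b hi ho hs⟩
  | W =>
    obtain ⟨a, ha, ⟨i', hi', ho', -⟩, hb, -⟩ := hs.guardOK tr
    obtain rfl := tr.open_unique hi hi' ho (ho'.trans ha hb)
    rw [hi, Option.some.injEq] at hi'
    cases hi'
    obtain ⟨t, h₁, -, h₃, h₄⟩ := exists_transfer_of_succ tr hn hi ho hs hc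
    exact ⟨t, .write p x u s b hi ho hs h₁ h₃ h₄⟩

/-- The response of an operation that took effect. -/
theorem MainAt.resp_eq (tr : Trace T H C) {i j t : ℕ} {p : P}
    {op : Op V} {r r' : Resp V} (h : MainAt H C o i t op r) (hc : Completes H p i j (some r')) :
    r' = r := by
  have hd := h.det_lt tr hc
  obtain ⟨o', op', hi'⟩ := hc.1
  obtain ⟨p', hi⟩ := h.inv
  rw [hi, Option.some.injEq] at hi'
  cases hi'
  rcases hc.2.2.1 with ⟨r', hj, e⟩ | ⟨-, e⟩
  swap
  · cases e
  cases e
  obtain ⟨a, haj, hpost, hd'⟩ := tr.ret_spec hj hi hc.isOpen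
  cases h with
  | cas p' old new s b hi ho hs =>
    -- A CAS returns false only with its detection value unchanged, contrary to `hd`.
    rcases hpost with ⟨e, -⟩ | ⟨-, e, -⟩
    · simpa using e
    · omega
  | write p' x u s b hi ho hs hu ht hw =>
    simpa using hpost.1

/-- The operation invoked at time `i` on `o` takes effect at time `t` without changing the
value. -/
def PlainAt (H : List (Label V Obj P)) (C : ℕ → Config V Obj P) (o : Obj) (v : V) (i t : ℕ)
    (op : Op V) (r : Resp V) : Prop :=
  ∃ p j, H[i]? = some (.inv p o op) ∧ Completes H p i j (some r) ∧ i < t ∧ t ≤ j ∧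
    op.apply (cellState C (o, .Z) v t).val = ((cellState C (o, .Z) v t).val, r)

/-- The write invoked at time `i` on `o` is overwritten at once by a write that is transferred at
time `t`. -/
def OverAt (H : List (Label V Obj P)) (C : ℕ → Config V Obj P) (o : Obj) (i t : ℕ)
    (op : Op V) (r : Resp V) : Prop :=
  ∃ p j x, H[i]? = some (.inv p o op) ∧ Completes H p i j (some r) ∧ i < t ∧ t ≤ j ∧
    op = .write x ∧ r = .ack ∧ Transfers H C o t

/-- Each operation that returns takes effect while it is in progress. -/
theorem exists_point (tr : Trace T H C) (hn : H[n]? = some (.newObj o v)) {i j : ℕ} {p : P}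
    {op : Op V} {r : Resp V} (hi : H[i]? = some (.inv p o op))
    (hc : Completes H p i j (some r)) :
    ∃ t, MainAt H C o i t op r ∨ PlainAt H C o v i t op r ∨ OverAt H C o i t op r := by
  have hP := tr.protocol hn
  rcases hc.2.2.1 with ⟨r', hj, e⟩ | ⟨-, e⟩
  swap
  · cases e
  cases e
  obtain ⟨a, haj, hpost, -⟩ := tr.ret_spec hj hi hc.isOpen
  cases op with
  | read =>
    obtain ⟨t₀, z, h₁, h₂, hz, h₃⟩ := hpost
    refine ⟨t₀, .inr (.inl ⟨p, j, hi, hc, h₁, by omega, ?_⟩)⟩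
    rw [cellState_of hz]
    cases h₃
    rfl
  | cas old new =>
    rcases hpost with ⟨e, ⟨rfl, t₀, z, h₁, h₂, hz, h₃⟩ | ⟨u, s, b, h₁, h₂, hs⟩⟩ |
      ⟨e, -, ⟨t₀, z, h₁, h₂, hz, h₃⟩ | ⟨m, h₁, h₂, l, l'⟩⟩ <;> cases e
    · refine ⟨t₀, .inr (.inl ⟨p, j, hi, hc, h₁, by omega, ?_⟩)⟩
      simp [cellState_of hz, Op.apply, h₃]
    · exact ⟨u, .inl (.cas p old new s b hi (hc.isOpen.of_le h₁ (by omega)) hs)⟩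
    · refine ⟨t₀, .inr (.inl ⟨p, j, hi, hc, h₁, by omega, ?_⟩)⟩
      simp [cellState_of hz, Op.apply, h₃]
    · obtain ⟨t₀, t₁, z, y, k₀, k₁, k₂, hz, -, hy, hne⟩ := l
      obtain ⟨t₀', t₁', z', y', k₀', k₁', k₂', hz', -, hy', hne'⟩ := l'
      obtain ⟨t, m₁, m₂, m₃⟩ := hP.exists_val_ne (old := old) (tr.le_of_ec hn hz) k₁
        (show t₁ < t₀' by omega) k₁' (by rwa [cellState_of hz, cellState_of hy])
        (by rwa [cellState_of hz', cellState_of hy'])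
      refine ⟨t, .inr (.inl ⟨p, j, hi, hc, by omega, by omega, ?_⟩)⟩
      simp [Op.apply, m₃]
  | write x =>
    obtain ⟨e, ⟨-, t₀, z, h₁, h₂, hz, h₃⟩ | ⟨t₀, t₁, t₂, t₃, w, z, h₁, h₂, h₃, h₄, h₅, hw, hz, h₆,
      -, d₁, d₂⟩⟩ := hpost <;> cases e
    · refine ⟨t₀, .inr (.inl ⟨p, j, hi, hc, h₁, by omega, ?_⟩)⟩
      simp [cellState_of hz, Op.apply, h₃]
    · have overwritten : ∀ t, i < t → t ≤ j → Transfers H C o t →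
          ∃ t, MainAt H C o i t (.write x) .ack ∨ PlainAt H C o v i t (.write x) .ack ∨
            OverAt H C o i t (.write x) .ack := fun t k₁ k₂ k₃ =>
        ⟨t, .inr (.inr ⟨p, j, x, hi, hc, k₁, k₂, rfl, rfl, k₃⟩)⟩
      have hc₀ := tr.le_of_ec hn hw
      -- If the bits differ at some time before the two executions of `transfer-write`, these force
      -- a transfer before the return, and this write can be placed just before the one transferred.
      have help : ∀ t, i < t → n + 1 ≤ t → t ≤ t₂ →
          (cellState C (o, .Z) v t).bit ≠ (cellState C (o, .W) v t).bit →
          ∃ t, MainAt H C o i t (.write x) .ack ∨ PlainAt H C o v i t (.write x) .ack ∨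
            OverAt H C o i t (.write x) .ack := fun t k₁ k₂ k₃ k₄ => by
        obtain ⟨t', l₁, l₂, l₃⟩ := hP.exists_transfer k₂ k₄ k₃ h₄ h₅ d₁.done d₂.done
        exact overwritten t' (by omega) (by omega) l₃
      rcases h₆ with h₆ | ⟨u, r, k₁, k₂, ⟨rfl, hs⟩ | ⟨rfl, y, hy, hne⟩⟩
      -- The bits were read at different times. If they agreed at `t₀`, the bit of `Z` changed
      -- before `t₁`, which only a transfer does.
      · by_cases hb : (cellState C (o, .Z) v t₀).bit = (cellState C (o, .W) v t₀).bit
        · by_cases ht : ∃ t, t₀ ≤ t ∧ t < t₁ ∧ Transfers H C o t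
          · obtain ⟨t, k₁, k₂, k₃⟩ := ht
            exact overwritten t (by omega) (by omega) k₃
          · push Not at ht
            have := hP.z_bit_const hc₀ h₂ ht
            rw [cellState_of hz, hb, cellState_of hw] at this
            exact absurd this h₆
        · exact help t₀ h₁ hc₀ (by omega) hb
      · obtain ⟨t, ht⟩ := exists_mainAt_of_succ tr hn hi
          (hc.isOpen.of_le (show i < u by omega) (by omega)) hs hc
        exact ⟨t, .inl ht⟩
      -- A failed `ECSC` on `W` lost against another write, immediately after which the bits differ.
      · obtain ⟨t, l₁, l₂, l₃⟩ := hP.exists_w_change hc₀ (show t₀ ≤ u by omega)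
          (by rwa [cellState_of hw, cellState_of hy])
        exact help (t + 1) (by omega) (by omega) (by omega) (hP.wr_bit_after (by omega) l₃)

end LinearizationPoints

/-! ### A sequential execution from points and kinds. -/

section Linearization

variable {V : Type u}

/-- How an operation takes effect: without changing the value, immediately before it is
overwritten, or by changing the value. -/
inductive Kind : Type
  | plain
  | overwritten
  | main
  deriving DecidableEq

/-- The order of the operations that take effect at the same time. -/
def Kind.rank : Kind → ℕ
  | .plain => 0
  | .overwritten => 1
  | .main => 2

/-- The operations of kind `κ` that take effect at time `t`, if `L` assigns to each operation its
time, its kind, and its response. -/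
def group (L : ℕ → Option (ℕ × Kind × Op V × Resp V)) (N t : ℕ) (κ : Kind) : List (Entry V) :=
  (List.range N).filterMap fun i => (L i).bind fun a =>
    if a.1 = t ∧ a.2.1 = κ then some ⟨i, a.2.2.1, a.2.2.2⟩ else none

/-- The operations that take effect at time `t`. -/
def slot (L : ℕ → Option (ℕ × Kind × Op V × Resp V)) (N t : ℕ) : List (Entry V) :=
  group L N t .plain ++ (group L N t .overwritten ++ group L N t .main)

/-- The operations in the order in which they take effect. -/
def linearize (L : ℕ → Option (ℕ × Kind × Op V × Resp V)) (N m : ℕ) : List (Entry V) :=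
  (List.range m).flatMap (slot L N)

/-- The position of an entry in the linearization. -/
def key (L : ℕ → Option (ℕ × Kind × Op V × Resp V)) (e : Entry V) : ℕ :=
  (L e.id).elim 0 fun a => 3 * a.1 + a.2.1.rank

variable {L : ℕ → Option (ℕ × Kind × Op V × Resp V)} {N t : ℕ}

theorem mem_group {κ : Kind} {e : Entry V} :
    e ∈ group L N t κ ↔ e.id < N ∧ L e.id = some (t, κ, e.op, e.resp) := by
  simp only [group, List.mem_filterMap, List.mem_range, Option.bind_eq_some_iff]
  constructor
  · rintro ⟨i, hi, ⟨t', κ', op, r⟩, ha, h⟩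
    split_ifs at h with hc
    · obtain ⟨rfl, rfl⟩ := hc
      cases h
      exact ⟨hi, ha⟩
  · rintro ⟨hi, ha⟩
    exact ⟨e.id, hi, _, ha, by simp⟩

theorem mem_slot {e : Entry V} :
    e ∈ slot L N t ↔ ∃ κ, e.id < N ∧ L e.id = some (t, κ, e.op, e.resp) := by
  simp only [slot, List.mem_append, mem_group]
  constructor
  · rintro (h | h | h) <;> exact ⟨_, h⟩
  · rintro ⟨_ | _ | _, h⟩ <;> simp [h]

theorem mem_linearize {m : ℕ} {e : Entry V} :
    e ∈ linearize L N m ↔ ∃ t < m, ∃ κ, e.id < N ∧ L e.id = some (t, κ, e.op, e.resp) := by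
  simp [linearize, mem_slot]

theorem key_of {κ : Kind} {op : Op V} {r : Resp V} {e : Entry V}
    (h : L e.id = some (t, κ, op, r)) : key L e = 3 * t + κ.rank := by
  simp [key, h]

theorem Kind.rank_lt (κ : Kind) : κ.rank < 3 := by cases κ <;> simp [Kind.rank]

theorem group_pairwise (κ : Kind) : (group L N t κ).Pairwise fun a b => a.id < b.id := by
  refine List.Pairwise.filterMap _ ?_ (List.pairwise_lt_range (n := N))
  intro i j hij a ha b hb
  simp only [Option.bind_eq_some_iff] at ha hb
  obtain ⟨x, -, ha⟩ := ha
  obtain ⟨y, -, hb⟩ := hb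
  split_ifs at ha
  split_ifs at hb
  cases ha
  cases hb
  exact hij

/-- The linearization is ordered by `key`, then by the time of invocation. -/
theorem linearize_pairwise (m : ℕ) : (linearize L N m).Pairwise fun a b =>
    key L a < key L b ∨ (key L a = key L b ∧ a.id < b.id) := by
  rw [linearize, List.pairwise_flatMap]
  constructor
  · intro t _
    have hg : ∀ κ, (group L N t κ).Pairwise fun a b =>
        key L a < key L b ∨ (key L a = key L b ∧ a.id < b.id) := by
      intro κ
      refine (group_pairwise κ).imp_of_mem fun ha hb h => .inr ⟨?_, h⟩
      rw [key_of (mem_group.1 ha).2, key_of (mem_group.1 hb).2]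
    have hlt : ∀ κ κ' : Kind, κ.rank < κ'.rank → ∀ a ∈ group L N t κ, ∀ b ∈ group L N t κ',
        key L a < key L b ∨ (key L a = key L b ∧ a.id < b.id) := by
      intro κ κ' h a ha b hb
      rw [key_of (mem_group.1 ha).2, key_of (mem_group.1 hb).2]
      exact .inl (by omega)
    rw [slot, List.pairwise_append, List.pairwise_append]
    refine ⟨hg _, ⟨hg _, hg _, hlt _ _ (by simp [Kind.rank])⟩, fun a ha b hb => ?_⟩
    rcases List.mem_append.1 hb with hb | hb
    · exact hlt _ _ (by simp [Kind.rank]) a ha b hb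
    · exact hlt _ _ (by simp [Kind.rank]) a ha b hb
  · refine (List.pairwise_lt_range (n := m)).imp fun {t t'} h a ha b hb => ?_
    obtain ⟨κ, -, ha⟩ := mem_slot.1 ha
    obtain ⟨κ', -, hb⟩ := mem_slot.1 hb
    rw [key_of ha, key_of hb]
    have := κ.rank_lt
    exact .inl (by omega)

theorem linearize_nodup (m : ℕ) : ((linearize L N m).map Entry.id).Nodup := by
  rw [List.Nodup, List.pairwise_map]
  refine (linearize_pairwise m).imp fun {a b} h e => ?_
  have : key L a = key L b := by rw [key, key, e]
  omega

variable [DecidableEq V]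

/-- The value after a sequential execution from `s`. -/
def after (s : V) (S : List (Entry V)) : V :=
  S.foldl (fun s e => (e.op.apply s).1) s

theorem legal_append {s : V} {A B : List (Entry V)} :
    Legal s (A ++ B) ↔ Legal s A ∧ Legal (after s A) B := by
  induction A generalizing s with
  | nil => simp [Legal, after]
  | cons e A ih => simp [Legal, ih, after, and_assoc]

theorem after_append {s : V} {A B : List (Entry V)} :
    after s (A ++ B) = after (after s A) B := by
  simp [after]

theorem legal_of_apply {s : V} {A : List (Entry V)} (h : ∀ e ∈ A, e.op.apply s = (s, e.resp)) :
    Legal s A ∧ after s A = s := by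
  induction A with
  | nil => simp [Legal, after]
  | cons e A ih =>
    have h₁ := h e (by simp)
    have h₂ := ih fun e he => h e (by simp [he])
    simp only [Legal, h₁, true_and]
    exact ⟨h₂.1, by simpa [after, h₁] using h₂.2⟩

theorem legal_of_write {s : V} {A : List (Entry V)}
    (h : ∀ e ∈ A, ∃ x, e.op = .write x ∧ e.resp = .ack) : Legal s A := by
  induction A generalizing s with
  | nil => trivial
  | cons e A ih =>
    obtain ⟨x, h₁, h₂⟩ := h e (by simp)
    exact ⟨by simp [h₁, h₂, Op.apply], ih fun e he => h e (by simp [he])⟩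

/-- The assignment `L` is consistent with the values `val` of the object. -/
structure Consistent (L : ℕ → Option (ℕ × Kind × Op V × Resp V)) (N : ℕ) (val : ℕ → V) :
    Prop where
  bound : ∀ i t κ op r, L i = some (t, κ, op, r) → i < N
  plain : ∀ i t op r, L i = some (t, .plain, op, r) → op.apply (val t) = (val t, r)
  overwritten : ∀ i t op r, L i = some (t, .overwritten, op, r) →
    (∃ x, op = .write x ∧ r = .ack) ∧ ∃ i' x, L i' = some (t, .main, .write x, .ack)
  main : ∀ i t op r, L i = some (t, .main, op, r) → op.apply (val t) = (val (t + 1), r)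
  main_unique : ∀ i i' t op op' r r', L i = some (t, .main, op, r) →
    L i' = some (t, .main, op', r') → i = i'
  change : ∀ t, (∀ i op r, L i ≠ some (t, .main, op, r)) → val (t + 1) = val t

theorem eq_singleton_of_forall_eq {α : Type*} {l : List α} {a : α} (hl : l.Nodup)
    (ha : a ∈ l) (h : ∀ b ∈ l, b = a) : l = [a] := by
  have := List.eq_replicate_iff.2 ⟨rfl, h⟩
  rw [this, List.nodup_replicate] at hl
  have h₁ : l.length ≠ 0 := by
    intro h₀
    rw [List.length_eq_zero_iff] at h₀
    simp [h₀] at ha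
  rw [this, show l.length = 1 by omega]
  rfl

namespace Consistent

variable {val : ℕ → V} (hL : Consistent L N val) {A : Finset ℕ}
  (hA : ∀ i ∈ A, ∀ t op r, L i ≠ some (t, .main, op, r))

include hL hA

/-- Plain entries see and keep `val t`. Overwritten entries are writes, legal in every state, and
exist only if the main entry is a write, which ignores the state they leave. So only the main entry
matters for `val (t + 1)`, and `A` contains no main entries. -/
theorem slot_legal (t : ℕ) :
    Legal (val t) ((slot L N t).filter fun e => e.id ∉ A) ∧
      after (val t) ((slot L N t).filter fun e => e.id ∉ A) = val (t + 1) := by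
  have hp := legal_of_apply (s := val t)
    (A := (group L N t .plain).filter fun e => e.id ∉ A) fun e he =>
      hL.plain _ _ _ _ (mem_group.1 (List.mem_of_mem_filter he)).2
  have hmain : (group L N t .main).filter (fun e => e.id ∉ A) = group L N t .main := by
    rw [List.filter_eq_self]
    intro e he
    simp only [decide_eq_true_eq]
    exact fun h => hA _ h _ _ _ (mem_group.1 he).2
  rw [slot, List.filter_append, List.filter_append, hmain, legal_append, legal_append,
    after_append, after_append, hp.2]
  refine (and_assoc.trans (and_congr_right fun _ => Iff.rfl)).2 ⟨hp.1, ?_⟩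
  by_cases h : ∃ i op r, L i = some (t, .main, op, r)
  · obtain ⟨i, op, r, hi⟩ := h
    have hm : group L N t .main = [⟨i, op, r⟩] := by
      refine eq_singleton_of_forall_eq ?_ (mem_group.2 ⟨hL.bound _ _ _ _ _ hi, hi⟩) ?_
      · exact (group_pairwise _).imp fun h e => by rw [e] at h; exact lt_irrefl _ h
      · rintro ⟨i', op', r'⟩ he
        have he := (mem_group.1 he).2
        obtain rfl := hL.main_unique _ _ _ _ _ _ _ hi he
        simp only [hi, Option.some.injEq, Prod.mk.injEq, true_and] at he
        rw [he.1, he.2]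
    rw [hm]
    by_cases ho : group L N t .overwritten = []
    · have := hL.main _ _ _ _ hi
      simp [ho, Legal, after, this]
    · obtain ⟨e, he⟩ := List.exists_mem_of_ne_nil _ ho
      obtain ⟨-, i', x, hi'⟩ := hL.overwritten _ _ _ _ (mem_group.1 he).2
      obtain rfl := hL.main_unique _ _ _ _ _ _ _ hi hi'
      simp only [hi, Option.some.injEq, Prod.mk.injEq, true_and] at hi'
      obtain ⟨rfl, rfl⟩ := hi'
      have hx := hL.main _ _ _ _ hi
      simp only [Op.apply, Prod.mk.injEq, and_true] at hx
      refine ⟨⟨legal_of_write fun e he => ?_, ?_⟩, ?_⟩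
      · exact (hL.overwritten _ _ _ _ (mem_group.1 (List.mem_of_mem_filter he)).2).1
      · simp [Legal, Op.apply]
      · simp [after, Op.apply, hx]
  · push Not at h
    have hm : group L N t .main = [] := by
      rw [List.eq_nil_iff_forall_not_mem]
      exact fun e he => h _ _ _ (mem_group.1 he).2
    have ho : group L N t .overwritten = [] := by
      rw [List.eq_nil_iff_forall_not_mem]
      intro e he
      obtain ⟨-, i', x, hi'⟩ := hL.overwritten _ _ _ _ (mem_group.1 he).2
      exact h _ _ _ hi'
    simp [hm, ho, Legal, after, hL.change t h]

/-- The linearization stays legal if operations that do not change the value are deleted. -/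
theorem legal (m : ℕ) :
    Legal (val 0) ((linearize L N m).filter fun e => e.id ∉ A) ∧
      after (val 0) ((linearize L N m).filter fun e => e.id ∉ A) = val m := by
  induction m with
  | zero => simp [linearize, Legal, after]
  | succ m ih =>
    have h : linearize L N (m + 1) = linearize L N m ++ slot L N m := by
      simp [linearize, List.range_succ]
    rw [h, List.filter_append, legal_append, after_append, ih.2]
    exact ⟨⟨ih.1, (hL.slot_legal hA m).1⟩, (hL.slot_legal hA m).2⟩

end Consistent

end Linearization

/-! ### Durable linearizability and detectability. -/

section Correctness

set_option linter.unusedSectionVars false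

variable {V : Type u} {Obj : Type v} {P : Type w}
  {T : ℕ} {H : List (Label V Obj P)} {C : ℕ → Config V Obj P} {o : Obj} {v : V} {n : ℕ}

theorem Completes.unique {p : P} {i j j' : ℕ} {out out' : Option (Resp V)}
    (h : Completes H p i j out) (h' : Completes H p i j' out') : j = j' ∧ out = out' := by
  have key : ∀ {j j' : ℕ} {out out' : Option (Resp V)}, Completes H p i j out →
      Completes H p i j' out' → ¬ j < j' := by
    rintro j j' out out' ⟨-, h₁, h₂, -⟩ ⟨-, -, -, h₃⟩ hlt
    obtain ⟨h₄, h₅⟩ := h₃ j h₁ hlt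
    rcases h₂ with ⟨r, h₂, -⟩ | ⟨h₂, -⟩
    · exact h₄ r h₂
    · exact h₅ h₂
  have h₁ := key h h'
  have h₂ := key h' h
  obtain rfl : j = j' := by omega
  refine ⟨rfl, ?_⟩
  rcases h.2.2.1 with ⟨r, h₃, rfl⟩ | ⟨h₃, rfl⟩ <;>
    rcases h'.2.2.1 with ⟨r', h₄, rfl⟩ | ⟨h₄, rfl⟩ <;> rw [h₃] at h₄ <;> simp_all

variable [DecidableEq V] [DecidableEq Obj] [DecidableEq P]

theorem Step.ec_created {c c' : Config V Obj P} {l : Label V Obj P} (hs : Step T c l c')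
    {x : Obj × Cell} (h : c.ec x = none) (h' : c'.ec x ≠ none) : ∃ v, l = .newObj x.1 v := by
  cases hs with
  | newObj o v w₀ sW sZ fresh =>
    refine ⟨v, ?_⟩
    by_contra hne
    have hx : x.1 ≠ o := fun e => hne (by rw [e])
    have h₁ : x ≠ (o, .W) := fun e => hx (by rw [e])
    have h₂ : x ≠ (o, .Z) := fun e => hx (by rw [e])
    simp [Config.setEC, h₁, h₂, h] at h'
  | scSuccess q x' g s v b h'' y seq' det' hh hp hy hseq hseq' hdet' =>
    have hx : x ≠ x' := by
      rintro rfl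
      rw [hy] at h
      cases h
    simp [Config.setEC, Config.setHnd, hx, h] at h'
  | _ => exact absurd h h'

theorem Trace.exists_newObj (tr : Trace T H C) {t : ℕ} {x : Obj × Cell} (h : (C t).ec x ≠ none) :
    ∃ (n : ℕ) (v : V), H[n]? = some (.newObj x.1 v) := by
  induction t with
  | zero => simp [tr.init, Config.init] at h
  | succ t ih =>
    by_cases h' : (C t).ec x = none
    · cases hl : H[t]? with
      | none => exact absurd h' (tr.stay t hl ▸ h)
      | some l =>
        obtain ⟨v, rfl⟩ := (tr.step t l hl).ec_created h' h
        exact ⟨t, v, hl⟩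
    · exact ih h'

theorem Trace.exists_newObj_of_inv (tr : Trace T H C) {i : ℕ} {p : P} {op : Op V}
    (hi : H[i]? = some (.inv p o op)) : ∃ (n : ℕ) (v : V), H[n]? = some (.newObj o v) := by
  have h := (tr.inv (i + 1) p).opened i o op hi ⟨by omega, Busy.refl _⟩
  exact tr.exists_newObj (x := (o, .Z)) ((tr.inv (i + 1) p).obj o h .Z)

theorem Trace.newObj_unique (tr : Trace T H C) (hn : H[n]? = some (.newObj o v)) {v' : V}
    (h : Label.newObj o v' ∈ H) : v' = v := by
  obtain ⟨m, hm⟩ := List.mem_iff_getElem?.1 h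
  obtain ⟨s, hs⟩ := (tr.created hm).2.1
  obtain ⟨s', hs'⟩ := (tr.created hn).2.1
  have h₁ := tr.le_of_ec hn hs
  have h₂ := tr.le_of_ec hm hs'
  obtain rfl : m = n := by omega
  rw [hm] at hn
  simpa using hn

/-- The point at which each operation on an object takes effect. -/
theorem exists_assignment (tr : Trace T H C) (hn : H[n]? = some (.newObj o v)) :
    ∃ L : ℕ → Option (ℕ × Kind × Op V × Resp V), ∀ i,
      (∀ t op r, MainAt H C o i t op r ↔ L i = some (t, .main, op, r)) ∧
      (∀ t op r, L i = some (t, .plain, op, r) → PlainAt H C o v i t op r) ∧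
      (∀ t op r, L i = some (t, .overwritten, op, r) → OverAt H C o i t op r) ∧
      ∀ p j op r, H[i]? = some (.inv p o op) → Completes H p i j (some r) →
        ∃ t κ, L i = some (t, κ, op, r) := by
  refine (Classical.skolem (p := fun i (a : Option (ℕ × Kind × Op V × Resp V)) =>
      (∀ t op r, MainAt H C o i t op r ↔ a = some (t, .main, op, r)) ∧
      (∀ t op r, a = some (t, .plain, op, r) → PlainAt H C o v i t op r) ∧
      (∀ t op r, a = some (t, .overwritten, op, r) → OverAt H C o i t op r) ∧
      ∀ p j op r, H[i]? = some (.inv p o op) → Completes H p i j (some r) →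
        ∃ t κ, a = some (t, κ, op, r))).1 fun i => ?_
  -- Operations that change the value take precedence and are all recorded, even if they crashed or
  -- never complete, because others may have seen their effect.
  by_cases hm : ∃ t op r, MainAt H C o i t op r
  · obtain ⟨t, op, r, h⟩ := hm
    refine ⟨some (t, .main, op, r), fun t' op' r' => ⟨fun h' => ?_, ?_⟩, by simp, by simp, ?_⟩
    · obtain ⟨rfl, rfl, rfl⟩ := h.unique tr hn h'
      rfl
    · rintro ⟨⟩
      exact h
    · intro p j op' r' hi hc
      obtain rfl := h.resp_eq tr hc
      obtain ⟨p', hi'⟩ := h.inv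
      rw [hi, Option.some.injEq] at hi'
      cases hi'
      exact ⟨t, _, rfl⟩
  push Not at hm
  by_cases hret : ∃ p j op r, H[i]? = some (.inv p o op) ∧ Completes H p i j (some r)
  · obtain ⟨p, j, op, r, hi, hc⟩ := hret
    have hr : ∀ p' j' op' r', H[i]? = some (.inv p' o op') → Completes H p' i j' (some r') →
        op = op' ∧ r = r' := by
      intro p' j' op' r' hi' hc'
      rw [hi, Option.some.injEq] at hi'
      cases hi'
      exact ⟨rfl, Option.some.inj (hc.unique hc').2⟩
    obtain ⟨t, h | h | h⟩ := exists_point tr hn hi hc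
    · exact absurd h (hm _ _ _)
    · refine ⟨some (t, .plain, op, r), fun t' op' r' => ⟨fun h' => absurd h' (hm _ _ _), by simp⟩,
        ?_, by simp, ?_⟩
      · rintro _ _ _ ⟨⟩
        exact h
      · intro p' j' op' r' hi' hc'
        obtain ⟨rfl, rfl⟩ := hr p' j' op' r' hi' hc'
        exact ⟨t, _, rfl⟩
    · refine ⟨some (t, .overwritten, op, r),
        fun t' op' r' => ⟨fun h' => absurd h' (hm _ _ _), by simp⟩, by simp, ?_, ?_⟩
      · rintro _ _ _ ⟨⟩
        exact h
      · intro p' j' op' r' hi' hc'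
        obtain ⟨rfl, rfl⟩ := hr p' j' op' r' hi' hc'
        exact ⟨t, _, rfl⟩
  · refine ⟨none, fun t' op' r' => ⟨fun h' => absurd h' (hm _ _ _), by simp⟩, by simp, by simp, ?_⟩
    exact fun p j op r hi hc => absurd ⟨p, j, op, r, hi, hc⟩ hret

/-- A successful `ECSC` through the critical handle between two executions of `detect` belongs
to the operation between them. -/
theorem Trace.bracketed_spec (tr : Trace T H C) {i d₁ d₂ : ℕ} {r₂ : Resp V}
    (h : Bracketed H o i d₁ d₂ r₂) :
    ∃ p op j out, H[i]? = some (.inv p o op) ∧ Completes H p i j out ∧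
      d₁ ≤ det C p .critical (i + 1) ∧ det C p .critical (i + 1) ≤ det C p .critical j ∧
      det C p .critical j ≤ d₂ ∧
      (d₁ < d₂ → ∃ u c s x b, Open H p i u ∧ Succ H C u p .critical (o, c) s x b ∧
        r₂ = c.tag.resp) := by
  obtain ⟨p, op, a, b, j, r₁, out, hi, hai, ha, hc, hjb, hb, hno⟩ := h
  obtain ⟨rfl, -, hna, hoa⟩ := tr.detRet_spec ha
  obtain ⟨rfl, ⟨τ, hτ, rfl⟩, -, -⟩ := tr.detRet_spec hb
  have hij := hc.2.1
  refine ⟨p, op, j, out, hi, hc, tr.det_le p _ (by omega), tr.det_le p _ (by omega),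
    tr.det_le p _ hjb.le, fun hlt => ?_⟩
  -- No operation is open when the first `detect` returns and none but `i` is invoked before the
  -- second one returns.
  have huniq : ∀ k i' o' op', a ≤ k → k < b → H[i']? = some (.inv p o' op') → Open H p i' k →
      i' = i := by
    intro k i' o' op' h₁ h₂ h₃ h₄
    by_contra hne
    have hk := h₄.1
    by_cases hai' : a < i'
    · exact hno i' hai' (by omega) hne _ _ h₃
    · rcases (show i' = a ∨ i' < a by omega) with rfl | hlt
      · rw [ha] at h₃
        simp at h₃
      · exact hoa i' o' op' h₃ (h₄.of_le hlt h₁)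
  obtain ⟨u, ⟨o', c⟩, s, x, e, h₁, h₂, hs⟩ := tr.exists_succ (show a ≤ b by omega) hna hlt
  obtain ⟨i', op', h₃, h₄, -, h₅, h₆, -⟩ := hs.exists_open tr
  obtain rfl := huniq u i' o' op' h₁ h₂ h₃ h₄
  rw [hi, Option.some.injEq] at h₃
  cases h₃
  refine ⟨u, c, s, x, e, h₄, hs, ?_⟩
  -- From the success to the second `detect` the field `op` stays as the operation set it, so
  -- `detect` reports the right response.
  have h₇ := tr.tag_const h₂.le hi (h₅.trans h₆.symm) (tr.hnd_ne_none h₁ hna)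
    fun k i' o' op' k₁ k₂ => huniq k i' o' op' (by omega) k₂
  rw [hτ, h₆] at h₇
  rw [Option.some.inj h₇]

/-- Durable linearizability and detectability. -/
theorem exists_linearization (tr : Trace T H C) (o : Obj) :
    ∃ S : List (Entry V), IsDurableLinearization H o S ∧ Detects H o S := by
  by_cases hcr : ∃ (n : ℕ) (v : V), H[n]? = some (.newObj o v)
  swap
  · have hinv : ∀ (i : ℕ) (p : P) op, H[i]? ≠ some (.inv p o op) := fun i p op hi =>
      hcr (tr.exists_newObj_of_inv hi)
    have hnew : ∀ v, Label.newObj o v ∉ H := fun v hv =>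
      hcr ((List.mem_iff_getElem?.1 hv).imp fun n hn => ⟨v, hn⟩)
    have hbr : ∀ i d₁ d₂ r₂, ¬ Bracketed H o i d₁ d₂ r₂ := by
      rintro i d₁ d₂ r₂ ⟨p, op, a, b, j, r₁, out, hi, -⟩
      exact hinv _ _ _ hi
    exact ⟨[], ⟨by simp, by simp, fun p op i j r hi => absurd hi (hinv _ _ _), by simp,
      fun v hv => absurd hv (hnew v)⟩, fun i d₁ d₂ r₂ h => absurd h (hbr _ _ _ _),
      fun i d₁ d₂ r₂ h => absurd h (hbr _ _ _ _), fun A _ v hv => absurd hv (hnew v)⟩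
  obtain ⟨n, v, hn⟩ := hcr
  obtain ⟨L, hL⟩ := exists_assignment tr hn
  -- Every point lies after the invocation and not after the completion. The strict bound on the
  -- left yields the real-time order even if keys are compared by time only.
  have hinv : ∀ i t κ op r, L i = some (t, κ, op, r) → (∃ p, H[i]? = some (.inv p o op)) ∧
      i < t ∧ t ≤ H.length ∧ ∀ p j out, Completes H p i j out → t ≤ j := by
    intro i t κ op r h
    have hlt : ∀ {k : ℕ} {l : Label V Obj P}, H[k]? = some l → k < H.length := fun hk =>
      (List.getElem?_eq_some_iff.1 hk).1
    have hret : ∀ {p j r}, H[i]? = some (.inv p o op) → Completes H p i j (some r) → t ≤ j →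
        t ≤ H.length ∧ ∀ p j out, Completes H p i j out → t ≤ j := by
      intro p j r hi hc htj
      refine ⟨?_, fun p' j' out hc' => ?_⟩
      · rcases hc.2.2.1 with ⟨r, hj, -⟩ | ⟨hj, -⟩ <;> exact htj.trans (hlt hj).le
      · obtain ⟨o', op', hi'⟩ := hc'.1
        rw [hi, Option.some.injEq] at hi'
        cases hi'
        rwa [← (hc.unique hc').1]
    cases κ with
    | plain =>
      obtain ⟨p, j, hi, hc, h₁, h₂, -⟩ := (hL i).2.1 _ _ _ h
      exact ⟨⟨p, hi⟩, h₁, hret hi hc h₂⟩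
    | overwritten =>
      obtain ⟨p, j, x, hi, hc, h₁, h₂, -⟩ := (hL i).2.2.1 _ _ _ h
      exact ⟨⟨p, hi⟩, h₁, hret hi hc h₂⟩
    | main =>
      have hm := ((hL i).1 _ _ _).2 h
      refine ⟨hm.inv, hm.lt, ?_, fun p j out hc => (hm.lt_of_completes tr hn hc).le⟩
      cases hm with
      | cas p old new s b hi ho hs => exact (hlt hs.label).le
      | write p x u s b hi ho hs hu ht hw =>
        obtain ⟨p, s, x, b, hs⟩ := ht
        exact (hlt hs.label).le
  have hcons : Consistent L H.length fun t => (cellState C (o, .Z) v t).val := by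
    refine ⟨fun i t κ op r h => ?_, fun i t op r h => ?_, fun i t op r h => ?_, fun i t op r h => ?_,
      fun i i' t op op' r r' h h' => ?_, fun t h => ?_⟩
    · obtain ⟨⟨p, hp⟩, -⟩ := hinv _ _ _ _ _ h
      exact (List.getElem?_eq_some_iff.1 hp).1
    · obtain ⟨p, j, -, -, -, -, h⟩ := (hL i).2.1 _ _ _ h
      exact h
    · obtain ⟨p, j, x, -, -, -, -, h₁, h₂, h₃⟩ := (hL i).2.2.1 _ _ _ h
      refine ⟨⟨x, h₁, h₂⟩, ?_⟩
      obtain ⟨i', x', h'⟩ := exists_mainAt_of_transfers tr hn h₃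
      exact ⟨i', x', ((hL i').1 _ _ _).1 h'⟩
    · exact (((hL i).1 _ _ _).2 h).apply tr hn
    · exact (((hL i).1 _ _ _).2 h).unique_op tr (((hL i').1 _ _ _).2 h')
    · exact val_eq_of_not_mainAt tr hn fun i op r hm => h i op r (((hL i).1 _ _ _).1 hm)
  have hlegal : ∀ A : Finset ℕ, (∀ i ∈ A, ∀ t op r, L i ≠ some (t, .main, op, r)) →
      ∀ v', .newObj o v' ∈ H →
        Legal v' ((linearize L H.length (H.length + 1)).filter fun e => e.id ∉ A) := by
    intro A hA v' hv'
    obtain rfl := tr.newObj_unique hn hv'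
    have := (hcons.legal hA (H.length + 1)).1
    rwa [tr.val_of_le hn (by omega)] at this
  have hmem : ∀ {i t κ op r}, L i = some (t, κ, op, r) →
      ⟨i, op, r⟩ ∈ linearize L H.length (H.length + 1) := fun h =>
    mem_linearize.2 ⟨_, by have := (hinv _ _ _ _ _ h).2.2.1; omega, _,
      hcons.bound _ _ _ _ _ h, h⟩
  -- `hinv` bounds times by `t ≤ H.length`, hence `H.length + 1` slots.
  refine ⟨linearize L H.length (H.length + 1), ⟨?_, linearize_nodup _, ?_, ?_, ?_⟩, ?_, ?_, ?_⟩
  · intro e he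
    obtain ⟨t, -, κ, -, h⟩ := mem_linearize.1 he
    exact (hinv _ _ _ _ _ h).1
  · intro p op i j r hi hc
    obtain ⟨t, κ, h⟩ := (hL i).2.2.2 p j op r hi hc
    exact ⟨_, hmem h, rfl, rfl⟩
  · refine (linearize_pairwise _).imp_of_mem fun {a b} ha hb h => ?_
    rintro ⟨p, j, out, hc, hj⟩
    obtain ⟨t, -, κ, -, ha⟩ := mem_linearize.1 ha
    obtain ⟨t', -, κ', -, hb⟩ := mem_linearize.1 hb
    have h₁ := (hinv _ _ _ _ _ ha).2.1
    have h₂ := (hinv _ _ _ _ _ hb).2.2.2 p j out hc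
    rw [key_of ha, key_of hb] at h
    have := κ'.rank_lt
    omega
  · intro v' hv'
    simpa using hlegal ∅ (by simp) v' hv'
  · intro i d₁ d₂ r₂ h
    obtain ⟨p, op, j, out, -, -, h₁, h₂, h₃, -⟩ := tr.bracketed_spec h
    omega
  · intro i d₁ d₂ r₂ h hlt
    obtain ⟨p, op, j, out, hi, hc, -, -, -, h₄⟩ := tr.bracketed_spec h
    obtain ⟨u, c, s, x, b, ho, hs, rfl⟩ := h₄ hlt
    obtain ⟨t, hm⟩ := exists_mainAt_of_succ tr hn hi ho hs hc
    exact ⟨_, hmem (((hL i).1 _ _ _).1 hm), rfl, rfl⟩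
  · intro A hA
    refine hlegal A fun i hi t op r h => ?_
    obtain ⟨d, r₂, h'⟩ := hA i hi
    obtain ⟨p, op', j, out, hi', hc, h₁, h₂, h₃, -⟩ := tr.bracketed_spec h'
    have := (((hL i).1 _ _ _).2 h).det_lt tr hc
    omega

end Correctness

/-! ### Wait-freedom, step bound and space bound. -/

section Resources

set_option linter.unusedSectionVars false

variable {V : Type u} {Obj : Type v} {P : Type w}

/-- The code executes at most `n` instructions. -/
def Depth : Prog V Obj → ℕ → Prop
  | .done _, _ => True
  | .ecll _ _ k, n + 1 => ∀ s, Depth (k s) n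
  | .ecsc _ _ _ _ _ k, n + 1 => ∀ r, Depth (k r) n
  | .ecrecover _ _ k, n + 1 => Depth k n
  | .ecdetect _ k, n + 1 => ∀ d, Depth (k d) n
  | .setOp _ k, n + 1 => Depth k n
  | .getOp k, n + 1 => ∀ τ, Depth (k τ) n
  | _, 0 => False

theorem Depth.mono {k : Prog V Obj} : ∀ {n m : ℕ}, Depth k n → n ≤ m → Depth k m := by
  induction k with
  | done r => exact fun _ _ => trivial
  | ecll x g k ih | ecsc x g s v b k ih | ecdetect g k ih | getOp k ih =>
    rintro (_ | n) (_ | m) h hnm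
    · exact h
    · exact h.elim
    · omega
    · exact fun s => ih s (h s) (by omega)
  | ecrecover x g k ih | setOp τ k ih =>
    rintro (_ | n) (_ | m) h hnm
    · exact h
    · exact h.elim
    · omega
    · exact ih (n := n) h (by omega)

theorem depth_transferWrite {o : Obj} {k : Prog V Obj} {n : ℕ} (h : Depth k n) :
    Depth (transferWrite o k) (n + 3) := by
  intro z w
  beta_reduce
  split_ifs
  · exact fun _ => h
  · exact h.mono (by omega)

theorem depth_recoverCode (o : Obj) : Depth (recoverCode o : Prog V Obj) 11 := by
  intro τ
  cases τ with
  | cas => trivial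
  | write =>
    have h : Depth (.done .recovered : Prog V Obj) 1 := trivial
    exact depth_transferWrite (n := 4) (depth_transferWrite h)

theorem depth_detectCode : Depth (detectCode : Prog V Obj) 11 := by
  intro d τ
  cases τ <;> trivial

/-- The number of pending operations, 0 or 1, that have not taken effect. -/
def unresolved : Option (Pending V Obj) → ℕ
  | some (.ll _ none) => 1
  | some (.sc _ _ _ _ none) => 1
  | _ => 0

/-- The number of operations pending through a handle that have not taken effect. -/
def Handle.unresolved (h : Handle V Obj) : ℕ :=
  DuraCAS.unresolved (h.ec .critical).pend + DuraCAS.unresolved (h.ec .casual).pend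

/-- Process `p` executes a method and takes at most `B` more steps in it. -/
def Remaining (T : ℕ) (c : Config V Obj P) (p : P) (B : ℕ) : Prop :=
  ∃ x k h, c.hnd p = some h ∧
    ((∃ n, c.ctl p = .running x k none ∧ Depth k n ∧ h.unresolved + n * (T + 4) ≤ B) ∨
      ∃ f n, c.ctl p = .running x k (some f) ∧ Depth k (n + 1) ∧
        h.unresolved + n * (T + 4) + f + 1 ≤ B)

theorem unresolved_le (a : Option (Pending V Obj)) : unresolved a ≤ 1 := by
  rcases a with _ | ⟨x, _ | s⟩ | ⟨x, s, v, b, _ | r⟩ <;> simp [unresolved]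

variable [DecidableEq V] [DecidableEq Obj] [DecidableEq P]

theorem depth_casLoop {o : Obj} {old new : V} {n m : ℕ}
    (h : Depth (casLoop o old new n) m) : Depth (casLoop o old new (n + 1)) (m + 5) := by
  intro z
  beta_reduce
  split_ifs
  · trivial
  · trivial
  · refine depth_transferWrite (n := m + 1) fun r => ?_
    cases r with
    | true => trivial
    | false => exact h

/-- The bound 11 comes from CAS: one assignment to `op` and two rounds of five DurEC operations. A
write needs at most 10 instructions. -/
theorem depth_code (o : Obj) (op : Op V) : Depth (op.code o) 11 := by
  cases op with
  | read => exact fun _ => trivial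
  | cas old new => exact depth_casLoop (m := 5) (depth_casLoop (m := 0) trivial)
  | write v =>
    intro w z
    have h : Depth (transferWrite o (transferWrite o (.done (.resp .ack))) : Prog V Obj) 6 :=
      depth_transferWrite (n := 3) (depth_transferWrite (n := 0) trivial)
    beta_reduce
    split_ifs
    · trivial
    · exact fun _ => h.mono (show 6 ≤ 7 by omega)
    · exact h.mono (show 6 ≤ 8 by omega)

theorem Handle.unresolved_setEC (h : Handle V Obj) (g : Role) (a : ECHandle V Obj) :
    (h.setEC g a).unresolved + DuraCAS.unresolved (h.ec g).pend =
      h.unresolved + DuraCAS.unresolved a.pend := by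
  cases g <;> simp [Handle.unresolved, Handle.setEC_ec] <;> omega

theorem Handle.unresolved_setPend (h : Handle V Obj) (g : Role) (a : Option (Pending V Obj)) :
    (h.setPend g a).unresolved + DuraCAS.unresolved (h.ec g).pend =
      h.unresolved + DuraCAS.unresolved a :=
  h.unresolved_setEC g _

/-- The measure drops at each step of `p`. An instruction costs at most an invocation, `T` units of
internal work, an effect and a return, for which `T + 4` suffices; in a call, `f + 1` is left for
work and return. Effects are paid for by `unresolved`, since an operation left over from a crash can
take effect during any instruction. -/
theorem Remaining.step {T : ℕ} {c c' : Config V Obj P} {l : Label V Obj P} {p : P} {B : ℕ}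
    (h : Remaining T c p B) (hs : Step T c l c') (hr : ¬ l.Returns p) (hcr : l ≠ .crash p) :
    ∃ B', Remaining T c' p B' ∧ B' + (if l.isTau p then 1 else 0) ≤ B := by
  obtain ⟨x, k, h, hn, hk⟩ := h
  by_cases hp : l.proc = some p
  swap
  · obtain ⟨h₁, h₂⟩ := hs.frame hp
    refine ⟨B, ⟨x, k, h, h₁.trans hn, by rwa [h₂]⟩, ?_⟩
    have : l.isTau p = false := by
      cases l <;> simp_all [Label.isTau, Label.proc]
    simp [this]
  cases hs with
  | newObj o v w₀ sW sZ fresh => simp [Label.proc] at hp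
  | newHandle q d τ fresh =>
    obtain rfl : q = p := by simpa [Label.proc] using hp
    rw [fresh] at hn
    cases hn
  | inv q o op idle hh ho =>
    obtain rfl : q = p := by simpa [Label.proc] using hp
    simp [idle] at hk
  | recInv q o ready hh ho =>
    obtain rfl : q = p := by simpa [Label.proc] using hp
    rcases ready with e | e <;> simp [e] at hk
  | detInv q idle hh =>
    obtain rfl : q = p := by simpa [Label.proc] using hp
    simp [idle] at hk
  | finish q x r hc =>
    obtain rfl : q = p := by cases r <;> simpa [Label.proc, Out.label] using hp
    exfalso
    apply hr
    cases r <;> simp [Label.Returns, Out.label]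
  | crash q =>
    obtain rfl : q = p := by simpa [Label.proc] using hp
    exact absurd rfl hcr
  | setOp q x' a k' h' hc hh =>
    obtain rfl : q = p := by simpa [Label.proc] using hp
    obtain rfl : h = h' := by simpa [hn] using hh
    rcases hk with ⟨_ | n, e, hd, hB⟩ | ⟨f, n, e, hd, hB⟩ <;> rw [hc] at e <;> cases e
    · exact hd.elim
    · refine ⟨_, ⟨x, k', { h with op := a }, by simp [Config.setCtl, Config.setHnd],
        .inl ⟨n, by simp [Config.setCtl], hd, le_rfl⟩⟩, ?_⟩
      rw [Nat.succ_mul] at hB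
      simp only [Label.isTau, decide_true, if_true]
      change h.unresolved + _ + _ ≤ _
      omega
  | getOp q x' k' h' hc hh =>
    obtain rfl : q = p := by simpa [Label.proc] using hp
    rcases hk with ⟨_ | n, e, hd, hB⟩ | ⟨f, n, e, hd, hB⟩ <;> rw [hc] at e <;> cases e
    · exact hd.elim
    · refine ⟨_, ⟨x, k' h'.op, h, by simpa [Config.setCtl] using hn,
        .inl ⟨n, by simp [Config.setCtl], hd _, le_rfl⟩⟩, ?_⟩
      rw [Nat.succ_mul] at hB
      simp only [Label.isTau, decide_true, if_true]
      omega
  | work q x' k' f hc =>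
    obtain rfl : q = p := by simpa [Label.proc] using hp
    rcases hk with ⟨n, e, hd, hB⟩ | ⟨f', n, e, hd, hB⟩ <;> rw [hc] at e <;> cases e
    refine ⟨_, ⟨x, k, h, by simpa [Config.setCtl] using hn,
      .inr ⟨f, n, by simp [Config.setCtl], hd, le_rfl⟩⟩, ?_⟩
    simp only [Label.isTau, decide_true, if_true]
    omega
  | llInv q x' y g k' h' hc hh free =>
    obtain rfl : q = p := by simpa [Label.proc] using hp
    obtain rfl : h = h' := by simpa [hn] using hh
    rcases hk with ⟨_ | n, e, hd, hB⟩ | ⟨f, n, e, hd, hB⟩ <;> rw [hc] at e <;> cases e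
    · exact hd.elim
    · refine ⟨_, ⟨x, _, h.setPend g (some (.ll y none)), by simp [Config.setCtl, Config.setHnd],
        .inr ⟨T, n, by simp [Config.setCtl], hd, le_rfl⟩⟩, ?_⟩
      rw [Nat.succ_mul] at hB
      simp only [Label.isTau, decide_true, if_true]
      have h₁ := h.unresolved_setPend g (some (.ll y none))
      have h₂ := unresolved_le (some (.ll y none) : Option (Pending V Obj))
      omega
  | scInv q x' y g s v b k' h' hc hh free =>
    obtain rfl : q = p := by simpa [Label.proc] using hp
    obtain rfl : h = h' := by simpa [hn] using hh
    rcases hk with ⟨_ | n, e, hd, hB⟩ | ⟨f, n, e, hd, hB⟩ <;> rw [hc] at e <;> cases e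
    · exact hd.elim
    · refine ⟨_, ⟨x, _, h.setPend g (some (.sc y s v b none)),
        by simp [Config.setCtl, Config.setHnd],
        .inr ⟨T, n, by simp [Config.setCtl], hd, le_rfl⟩⟩, ?_⟩
      rw [Nat.succ_mul] at hB
      simp only [Label.isTau, decide_true, if_true]
      have h₁ := h.unresolved_setPend g (some (.sc y s v b none))
      have h₂ := unresolved_le (some (.sc y s v b none) : Option (Pending V Obj))
      omega
  | llEffect q y g h' s hh hpe hs =>
    obtain rfl : q = p := by simpa [Label.proc] using hp
    obtain rfl : h = h' := by simpa [hn] using hh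
    have h₁ := h.unresolved_setPend g (some (.ll y (some s)))
    rw [hpe] at h₁
    simp only [unresolved] at h₁
    refine ⟨B - 1, ⟨x, k, h.setPend g (some (.ll y (some s))), by simp [Config.setHnd],
      hk.imp ?_ ?_⟩, ?_⟩
    · rintro ⟨n, e, hd, hB⟩
      exact ⟨n, e, hd, by omega⟩
    · rintro ⟨f, n, e, hd, hB⟩
      exact ⟨f, n, e, hd, by omega⟩
    · simp only [Label.isTau, decide_true, if_true]
      rcases hk with ⟨n, e, hd, hB⟩ | ⟨f, n, e, hd, hB⟩ <;> omega
  | scFailure q y g s v b h' st hh hpe hy hseq =>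
    obtain rfl : q = p := by simpa [Label.proc] using hp
    obtain rfl : h = h' := by simpa [hn] using hh
    have h₁ := h.unresolved_setPend g (some (.sc y s v b (some false)))
    rw [hpe] at h₁
    simp only [unresolved] at h₁
    refine ⟨B - 1, ⟨x, k, h.setPend g (some (.sc y s v b (some false))), by simp [Config.setHnd],
      hk.imp ?_ ?_⟩, ?_⟩
    · rintro ⟨n, e, hd, hB⟩
      exact ⟨n, e, hd, by omega⟩
    · rintro ⟨f, n, e, hd, hB⟩
      exact ⟨f, n, e, hd, by omega⟩
    · simp only [Label.isTau, decide_true, if_true]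
      rcases hk with ⟨n, e, hd, hB⟩ | ⟨f, n, e, hd, hB⟩ <;> omega
  | scSuccess q y g s v b h' st seq' det' hh hpe hy hseq hseq' hdet' =>
    obtain rfl : q = p := by simpa [Label.proc] using hp
    obtain rfl : h = h' := by simpa [hn] using hh
    have h₁ := h.unresolved_setEC g ⟨det', some (.sc y s v b (some true))⟩
    rw [hpe] at h₁
    simp only [unresolved] at h₁
    refine ⟨B - 1, ⟨x, k, h.setEC g ⟨det', some (.sc y s v b (some true))⟩,
      by simp [Config.setHnd], hk.imp ?_ ?_⟩, ?_⟩
    · rintro ⟨n, e, hd, hB⟩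
      exact ⟨n, e, hd, by omega⟩
    · rintro ⟨f, n, e, hd, hB⟩
      exact ⟨f, n, e, hd, by omega⟩
    · simp only [Label.isTau, decide_true, if_true]
      rcases hk with ⟨n, e, hd, hB⟩ | ⟨f, n, e, hd, hB⟩ <;> omega
  | llRet q x' y g k' f h' s hc hh hpe =>
    obtain rfl : q = p := by simpa [Label.proc] using hp
    obtain rfl : h = h' := by simpa [hn] using hh
    rcases hk with ⟨n, e, hd, hB⟩ | ⟨f, n, e, hd, hB⟩ <;> rw [hc] at e <;> cases e
    refine ⟨_, ⟨x, _, h.setPend g none, by simp [Config.setCtl, Config.setHnd],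
      .inl ⟨n, by simp [Config.setCtl], hd s, le_rfl⟩⟩, ?_⟩
    simp only [Label.isTau, decide_true, if_true]
    have h₁ := h.unresolved_setPend g none
    have h₂ : unresolved (none : Option (Pending V Obj)) = 0 := rfl
    omega
  | scRet q x' y g s v b k' f h' r hc hh hpe =>
    obtain rfl : q = p := by simpa [Label.proc] using hp
    obtain rfl : h = h' := by simpa [hn] using hh
    rcases hk with ⟨n, e, hd, hB⟩ | ⟨f, n, e, hd, hB⟩ <;> rw [hc] at e <;> cases e
    refine ⟨_, ⟨x, _, h.setPend g none, by simp [Config.setCtl, Config.setHnd],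
      .inl ⟨n, by simp [Config.setCtl], hd r, le_rfl⟩⟩, ?_⟩
    simp only [Label.isTau, decide_true, if_true]
    have h₁ := h.unresolved_setPend g none
    have h₂ : unresolved (none : Option (Pending V Obj)) = 0 := rfl
    omega
  | ecrecoverInv q x' y g k' hc =>
    obtain rfl : q = p := by simpa [Label.proc] using hp
    rcases hk with ⟨_ | n, e, hd, hB⟩ | ⟨f, n, e, hd, hB⟩ <;> rw [hc] at e <;> cases e
    · exact hd.elim
    · refine ⟨_, ⟨x, _, h, by simpa [Config.setCtl] using hn,
        .inr ⟨T, n, by simp [Config.setCtl], hd, le_rfl⟩⟩, ?_⟩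
      rw [Nat.succ_mul] at hB
      simp only [Label.isTau, decide_true, if_true]
      omega
  | ecdetectInv q x' g k' h' hc hh free =>
    obtain rfl : q = p := by simpa [Label.proc] using hp
    rcases hk with ⟨_ | n, e, hd, hB⟩ | ⟨f, n, e, hd, hB⟩ <;> rw [hc] at e <;> cases e
    · exact hd.elim
    · refine ⟨_, ⟨x, _, h, by simpa [Config.setCtl] using hn,
        .inr ⟨T, n, by simp [Config.setCtl], hd, le_rfl⟩⟩, ?_⟩
      rw [Nat.succ_mul] at hB
      simp only [Label.isTau, decide_true, if_true]
      omega
  | ecrecoverRet q x' y g k' f h' hc hh =>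
    obtain rfl : q = p := by simpa [Label.proc] using hp
    obtain rfl : h = h' := by simpa [hn] using hh
    rcases hk with ⟨n, e, hd, hB⟩ | ⟨f, n, e, hd, hB⟩ <;> rw [hc] at e <;> cases e
    refine ⟨_, ⟨x, k', h.setPend g ((h.ec g).pend.filter fun a => a.target ≠ y),
      by simp [Config.setCtl, Config.setHnd],
      .inl ⟨n, by simp [Config.setCtl], hd, le_rfl⟩⟩, ?_⟩
    simp only [Label.isTau, decide_true, if_true]
    have h₁ := h.unresolved_setPend g ((h.ec g).pend.filter fun a => a.target ≠ y)
    have h₂ : unresolved ((h.ec g).pend.filter fun a => a.target ≠ y) ≤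
        unresolved (h.ec g).pend := by
      cases (h.ec g).pend with
      | none => simp
      | some a =>
        rw [Option.filter_some]
        split_ifs
        · exact le_rfl
        · exact Nat.zero_le _
    omega
  | ecdetectRet q x' g k' f h' hc hh =>
    obtain rfl : q = p := by simpa [Label.proc] using hp
    rcases hk with ⟨n, e, hd, hB⟩ | ⟨f, n, e, hd, hB⟩ <;> rw [hc] at e <;> cases e
    refine ⟨_, ⟨x, k' (h'.ec g).det, h, by simpa [Config.setCtl] using hn,
      .inl ⟨n, by simp [Config.setCtl], hd _, le_rfl⟩⟩, ?_⟩
    simp only [Label.isTau, decide_true, if_true]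
    omega

theorem Step.remaining_of_starts {T : ℕ} {c c' : Config V Obj P} {l : Label V Obj P} {p : P}
    (hs : Step T c l c') (hl : l.Starts p) : Remaining T c' p (11 * (T + 4) + 2) := by
  have key : ∀ x k, c.hnd p ≠ none → Depth k 11 →
      Remaining T (c.setCtl p (.running x k none)) p (11 * (T + 4) + 2) := by
    intro x k hn hk
    obtain ⟨h, hh⟩ := Option.ne_none_iff_exists'.1 hn
    -- The summand 2 covers one unresolved operation in each of the two DurEC handles, left by a
    -- crash.
    refine ⟨x, k, h, hh, .inl ⟨11, by simp [Config.setCtl], hk, ?_⟩⟩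
    have h₁ := unresolved_le (h.ec .critical).pend
    have h₂ := unresolved_le (h.ec .casual).pend
    rw [Handle.unresolved]
    omega
  cases hs with
  | inv q o op idle hh ho =>
    obtain rfl : q = p := by simpa [Label.Starts] using hl
    exact key _ _ hh (depth_code o op)
  | recInv q o ready hh ho =>
    obtain rfl : q = p := by simpa [Label.Starts] using hl
    exact key _ _ hh (depth_recoverCode o)
  | detInv q idle hh =>
    obtain rfl : q = p := by simpa [Label.Starts] using hl
    exact key _ _ hh depth_detectCode
  | finish q x r hc => cases r <;> simp [Label.Starts, Out.label] at hl
  | _ => simp [Label.Starts] at hl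

/-- A method takes a bounded number of steps. -/
theorem Trace.countP_le {T : ℕ} {C : ℕ → Config V Obj P} {H₁ H₂ : List (Label V Obj P)}
    {l : Label V Obj P} (tr : Trace T (H₁ ++ l :: H₂) C) {p : P} (hl : l.Starts p)
    (h : ∀ l' ∈ H₂, ¬ l'.Returns p ∧ l' ≠ .crash p) :
    H₂.countP (Label.isTau p) ≤ 11 * (T + 4) + 2 := by
  have key : ∀ m ≤ H₂.length, ∃ B, Remaining T (C (H₁.length + 1 + m)) p B ∧
      (H₂.take m).countP (Label.isTau p) + B ≤ 11 * (T + 4) + 2 := by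
    intro m
    induction m with
    | zero =>
      intro _
      exact ⟨_, (tr.step H₁.length l (by simp)).remaining_of_starts hl, by simp⟩
    | succ m ih =>
      intro hm
      obtain ⟨B, h₁, h₂⟩ := ih (by omega)
      have hm' : (H₁ ++ l :: H₂)[H₁.length + 1 + m]? = some H₂[m] := by
        rw [List.getElem?_append_right (by omega), show H₁.length + 1 + m - H₁.length = m + 1 by omega]
        simp
      obtain ⟨h₃, h₄⟩ := h H₂[m] (List.getElem_mem _)
      obtain ⟨B', h₅, h₆⟩ := h₁.step (tr.step _ _ hm') h₃ h₄
      refine ⟨B', h₅, ?_⟩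
      rw [List.take_succ_eq_append_getElem (by omega), List.countP_append, List.countP_singleton]
      omega
  obtain ⟨B, -, h₁⟩ := key H₂.length le_rfl
  rw [List.take_length] at h₁
  omega

/-- A process that executes a method is never blocked. -/
theorem Trace.exists_step {T : ℕ} {H : List (Label V Obj P)} {C : ℕ → Config V Obj P}
    (tr : Trace T H C) {t : ℕ} {p : P} (h : (C t).Active p) :
    ∃ l c', (l = .tau p ∨ l.Returns p) ∧ Step T (C t) l c' := by
  obtain ⟨x, k, call, hc⟩ := h
  have I := tr.inv t p
  obtain ⟨h, hh⟩ := Option.ne_none_iff_exists'.1 (I.hnd (by simp [hc]))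
  obtain ⟨D, Post, a, -, ha, hok, hpr⟩ := I.run _ _ _ hc
  have hec : ∀ y, x = some y.1 → ∃ s, (C t).ec y = some s := fun y hy =>
    Option.ne_none_iff_exists'.1 (I.obj y.1 (by rw [hc]; exact hy) y.2)
  cases call with
  | none =>
    -- Leftovers of a crash cannot block a DurEC invocation: `OK` asserts that its handle has no
    -- entry in `D`.
    have free : ∀ {g}, (∀ c, ¬ D g c) → (h.ec g).pend = none := fun hg =>
      pend_of hh _ ▸ hpr.free hg
    cases k with
    | done r =>
      refine ⟨_, _, .inr ?_, .finish (C t) p x r hc⟩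
      cases r <;> simp [Label.Returns, Out.label]
    | ecll y g k => exact ⟨_, _, .inl rfl, .llInv (C t) p x y g k h hc hh (free hok.1.2.1)⟩
    | ecsc y g s v b k =>
      exact ⟨_, _, .inl rfl, .scInv (C t) p x y g s v b k h hc hh (free hok.1.2.1)⟩
    | ecrecover y g k => exact ⟨_, _, .inl rfl, .ecrecoverInv (C t) p x y g k hc⟩
    | ecdetect g k =>
      obtain ⟨rfl, hD, -⟩ := hok
      exact ⟨_, _, .inl rfl, .ecdetectInv (C t) p x _ k h hc hh (free hD)⟩
    | setOp τ k => exact ⟨_, _, .inl rfl, .setOp (C t) p x τ k h hc hh⟩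
    | getOp k => exact ⟨_, _, .inl rfl, .getOp (C t) p x k h hc hh⟩
  | some f =>
    cases k with
    | done r => exact hpr.elim
    | setOp τ k => exact hpr.elim
    | getOp k => exact hpr.elim
    | ecll y g k =>
      obtain ⟨-, -, res, hp, -⟩ := hpr
      rw [pend_of hh] at hp
      obtain ⟨s, hs⟩ := hec y hok.1.1
      cases res with
      | none => exact ⟨_, _, .inl rfl, .llEffect (C t) p y g h s hh hp hs⟩
      | some s => exact ⟨_, _, .inl rfl, .llRet (C t) p x y g k f h s hc hh hp⟩
    | ecsc y g s v b k =>
      obtain ⟨-, -, -, res, hp, -⟩ := hpr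
      rw [pend_of hh] at hp
      obtain ⟨e, he⟩ := hec y hok.1.1
      cases res with
      | none =>
        by_cases hs : e.seq = s
        · exact ⟨_, _, .inl rfl, .scSuccess (C t) p y g s v b h e (e.seq + 1) ((h.ec g).det + 1)
            hh hp he hs (by omega) (by omega)⟩
        · exact ⟨_, _, .inl rfl, .scFailure (C t) p y g s v b h e hh hp he hs⟩
      | some r => exact ⟨_, _, .inl rfl, .scRet (C t) p x y g s v b k f h r hc hh hp⟩
    | ecrecover y g k => exact ⟨_, _, .inl rfl, .ecrecoverRet (C t) p x y g k f h hc hh⟩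
    | ecdetect g k => exact ⟨_, _, .inl rfl, .ecdetectRet (C t) p x g k f h hc hh⟩

theorem Step.hnd_created {T : ℕ} {c c' : Config V Obj P} {l : Label V Obj P} (hs : Step T c l c')
    {p : P} (h : c.hnd p = none) (h' : c'.hnd p ≠ none) : l = .newHandle p := by
  by_contra hne
  by_cases hp : l.proc = some p
  swap
  · rw [(hs.frame hp).1] at h'
    exact h' h
  cases hs with
  | newObj o v w₀ sW sZ fresh => simp [Label.proc] at hp
  | newHandle q d τ fresh =>
    obtain rfl : q = p := by simpa [Label.proc] using hp
    exact hne rfl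
  | finish q x r hc => exact h' h
  | inv | recInv | detInv | crash | getOp | work | ecrecoverInv | ecdetectInv | ecdetectRet =>
    exact h' h
  | _ =>
    simp only [Label.proc, Option.some.injEq] at hp
    subst hp
    simp_all

theorem Trace.newHandle_mem {T : ℕ} {H : List (Label V Obj P)} {C : ℕ → Config V Obj P}
    (tr : Trace T H C) {t : ℕ} {p : P} (h : (C t).hnd p ≠ none) : .newHandle p ∈ H := by
  induction t with
  | zero => simp [tr.init, Config.init] at h
  | succ t ih =>
    by_cases h' : (C t).hnd p = none
    · cases hl : H[t]? with
      | none => exact absurd h' (tr.stay t hl ▸ h)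
      | some l =>
        obtain rfl := (tr.step t l hl).hnd_created h' h
        exact List.mem_of_getElem? hl
    · exact ih h'

/-- Each object has two cells, and each handle has two DurEC handles and one field: `2 * M` and `2 *
M + 1` words. -/
theorem Trace.space_le {T : ℕ} {H : List (Label V Obj P)} {C : ℕ → Config V Obj P}
    (tr : Trace T H C) (M t : ℕ) : (C t).space M ≤
      ((2 * M + 1 : ℕ) : ℕ∞) * ((numObjects H + numHandles H : ℕ) : ℕ∞) := by
  -- Finiteness is needed because `ncard` would be 0 on an infinite set.
  have hO : {o : Obj | ∃ v, .newObj o v ∈ H}.Finite := by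
    refine ((List.finite_toSet H).preimage' (f := fun a : Obj × V => Label.newObj a.1 a.2)
      (fun b _ => Set.Subsingleton.finite ?_)).image Prod.fst |>.subset ?_
    · rintro ⟨a, b⟩ h ⟨a', b'⟩ h'
      simp only [Set.mem_preimage, Set.mem_singleton_iff] at h h'
      rw [← h'] at h
      simpa using h
    · rintro o ⟨v, hv⟩
      exact ⟨(o, v), hv, rfl⟩
  have hP : {p : P | .newHandle p ∈ H}.Finite := by
    refine ((List.finite_toSet H).preimage' (f := fun p : P => Label.newHandle p)
      (fun b _ => Set.Subsingleton.finite ?_)).subset ?_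
    · intro a h a' h'
      simp only [Set.mem_preimage, Set.mem_singleton_iff] at h h'
      rw [← h'] at h
      simpa using h
    · exact fun p hp => hp
  have hcell : (Set.univ : Set Cell).encard ≤ 2 := by
    have : (Set.univ : Set Cell) ⊆ {.W, .Z} := by rintro (_ | _) <;> simp
    exact (Set.encard_le_encard this).trans ((Set.encard_pair (by simp)).le)
  have hrole : (Set.univ : Set Role).encard ≤ 2 := by
    have : (Set.univ : Set Role) ⊆ {.critical, .casual} := by rintro (_ | _) <;> simp
    exact (Set.encard_le_encard this).trans ((Set.encard_pair (by simp)).le)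
  have h₁ : {x : Obj × Cell | (C t).ec x ≠ none}.encard ≤ numObjects H * 2 := by
    refine (Set.encard_le_encard (t := {o : Obj | ∃ v, .newObj o v ∈ H} ×ˢ Set.univ) ?_).trans ?_
    · intro x hx
      obtain ⟨n, v, hn⟩ := tr.exists_newObj hx
      exact ⟨⟨v, List.mem_of_getElem? hn⟩, trivial⟩
    · rw [Set.encard_prod, numObjects, hO.cast_ncard_eq]
      gcongr
  have h₂ : {y : P × Role | (C t).hnd y.1 ≠ none}.encard ≤ numHandles H * 2 := by
    refine (Set.encard_le_encard (t := {p : P | .newHandle p ∈ H} ×ˢ Set.univ) ?_).trans ?_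
    · exact fun y hy => ⟨tr.newHandle_mem hy, trivial⟩
    · rw [Set.encard_prod, numHandles, hP.cast_ncard_eq]
      gcongr
  have h₃ : {p : P | (C t).hnd p ≠ none}.encard ≤ numHandles H := by
    rw [numHandles, hP.cast_ncard_eq]
    exact Set.encard_le_encard fun p hp => tr.newHandle_mem hp
  calc (C t).space M ≤ M * (numObjects H * 2) + M * (numHandles H * 2) + numHandles H := by
        rw [Config.space]
        gcongr
    _ ≤ _ := by
        norm_cast
        nlinarith [Nat.zero_le (numObjects H)]

end Resources

end DuraCAS

/-- Suppose that each operation on a DurEC object spends at most `T` steps on internal work and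
that DurEC objects and DurEC handles occupy `M` words each.  Then DuraCAS objects are durably
linearizable and detectable, their methods are wait-free and run in constant time, and the space
used is linear in the number of objects created and handles acquired. -/
theorem mainTheorem1 (T M : ℕ) :
    ∃ K : ℕ, ∀ (V : Type*) (Obj : Type*) (P : Type*)
      [DecidableEq V] [DecidableEq Obj] [DecidableEq P]
      (H : List (DuraCAS.Label V Obj P)) (c : DuraCAS.Config V Obj P),
      DuraCAS.Run T H c →
      -- durable linearizability and detectability
      (∀ o : Obj, ∃ S : List (DuraCAS.Entry V),
        DuraCAS.IsDurableLinearization H o S ∧ DuraCAS.Detects H o S) ∧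
      -- a process that executes a method is never blocked
      (∀ p : P, c.Active p → ∃ (l : DuraCAS.Label V Obj P) (c' : DuraCAS.Config V Obj P),
        (l = .tau p ∨ l.Returns p) ∧ DuraCAS.Step T c l c') ∧
      -- unless it crashes, a process takes at most `K` steps in a method
      (∀ (p : P) (H₁ H₂ : List (DuraCAS.Label V Obj P)) (l : DuraCAS.Label V Obj P),
        H = H₁ ++ l :: H₂ → l.Starts p →
        (∀ l' ∈ H₂, ¬ l'.Returns p ∧ l' ≠ .crash p) →
        H₂.countP (DuraCAS.Label.isTau p) ≤ K) ∧
      -- space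
      c.space M ≤ K * ((DuraCAS.numObjects H + DuraCAS.numHandles H : ℕ) : ℕ∞) := by
  -- The sum of the constants for time and for space serves both bounds.
  refine ⟨11 * (T + 4) + 2 + (2 * M + 1), ?_⟩
  intro V Obj P _ _ _ H c hr
  obtain ⟨C, tr, rfl⟩ := hr.exists_trace
  refine ⟨fun o => DuraCAS.exists_linearization tr o, fun p hp => tr.exists_step hp, ?_, ?_⟩
  · rintro p H₁ H₂ l rfl hl h
    exact (tr.countP_le hl h).trans (by omega)
  · refine (tr.space_le M _).trans (mul_le_mul_left ?_ _)
    exact_mod_cast Nat.le_add_left _ _
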